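/- Let $\Gamma=(V,E)$ be a finite directed graph with non-empty vertex set $V$, without sinks (every vertex emits an edge) and without multiple edges (loops are allowed), with source and target maps $s,t$ and vertex matrix $D$ ($D_{vw}=1$ if there is an edge from $v$ to $w$, and $D_{vw}=0$ otherwise). Assume that $\Gamma$ is strongly connected: for all $v,w\in V$ there is a directed path from $v$ to $w$. Let $C^*(\Gamma)$ be the universal unital $C^*$-algebra generated by mutually orthogonal projections $(p_v)_{v\in V}$ with $\sum_v p_v=1$ and partial isometries $(S_e)_{e\in E}$ with $S_e^*S_e=p_{t(e)}$ and $\sum_{s(e)=v}S_eS_e^*=p_v$, with the dynamics $\sigma_t(S_e)=e^{it}S_e$, $\sigma_t(p_v)=p_v$ ($t\in\mathbb R$). A $\mathrm{KMS}_\beta$ state ($\beta\in\mathbb R$) is a $\sigma$-invariant state $\tau$ with $\tau(ab)=\tau(b\,\sigma_{i\beta}(a))$ for all $\sigma$-analytic elements $a,b$ (invariance is automatic for $\beta\neq 0$). Let $Q^{\rm aut}_{\rm Ban}(\Gamma)$ be the quantum automorphism group of $\Gamma$; its $C^*$-algebra is the universal unital $C^*$-algebra generated by self-adjoint elements $(u_{ij})_{i,j\in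 V}$ with $u_{ij}u_{ik}=\delta_{jk}u_{ij}$, $u_{ji}u_{ki}=\delta_{jk}u_{ji}$, $\sum_l u_{il}=\sum_l u_{li}=1$ and $AD=DA$, where $A=(u_{ij})$. It acts on $C^*(\Gamma)$ by the unital $*$-homomorphism $\alpha: C^*(\Gamma)\to C^*(\Gamma)\otimes Q^{\rm aut}_{\rm Ban}(\Gamma)$ (minimal tensor product) with $$\alpha(p_i)=\sum_{k\in V}p_k\otimes u_{ki},\qquad \alpha(S_e)=\sum_{f\in E}S_f\otimes u_{s(f)s(e)}u_{t(f)t(e)} .$$ Then $C^*(\Gamma)$ has exactly one KMS state $\tau$; it occurs only at the inverse temperature $\beta=\ln\rho(D)$, where $\rho(D)$ is the spectral radius of $D$; and $Q^{\rm aut}_{\rm Ban}(\Gamma)$ preserves $\tau$, that is, $(\tau\otimes\mathrm{id})(\alpha(a))=\tau(a)1$ for all $a\in C^*(\Gamma)$. -/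

import Mathlib

noncomputable section
universe u

/-- A family of unital `*`-homomorphisms from a unital complex `*`-algebra `X` to C⋆-algebras,
pointwise bounded in norm. -/
structure StarHomFamily (X : Type u) [Ring X] [StarRing X] [Algebra ℂ X] where
  ι : Type (u + 1)
  B : ι → Type u
  [cstar : ∀ i, CStarAlgebra (B i)]
  hom : ∀ i, X →⋆ₐ[ℂ] B i
  bdd : ∀ x, BddAbove (Set.range fun i => ‖hom i x‖)

namespace StarHomFamily

attribute [instance] StarHomFamily.cstar

variable {X : Type u} [Ring X] [StarRing X] [Algebra ℂ X] (F : StarHomFamily X)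

/-- The C⋆-seminorm `x ↦ sup_i ‖hom i x‖`. -/
def seminorm (x : X) : ℝ := ⨆ i, ‖F.hom i x‖

theorem seminorm_nonneg (x : X) : 0 ≤ F.seminorm x :=
  Real.iSup_nonneg fun _ => norm_nonneg _

theorem le_seminorm (i : F.ι) (x : X) : ‖F.hom i x‖ ≤ F.seminorm x :=
  le_ciSup (F.bdd x) i

theorem seminorm_le {x : X} {c : ℝ} (hc : 0 ≤ c) (h : ∀ i, ‖F.hom i x‖ ≤ c) :
    F.seminorm x ≤ c :=
  Real.iSup_le h hc

theorem seminorm_zero : F.seminorm 0 = 0 := by simp [seminorm]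

theorem seminorm_add (x y : X) : F.seminorm (x + y) ≤ F.seminorm x + F.seminorm y :=
  F.seminorm_le (add_nonneg (F.seminorm_nonneg _) (F.seminorm_nonneg _)) fun i => by
    rw [map_add]
    exact (norm_add_le _ _).trans (add_le_add (F.le_seminorm i x) (F.le_seminorm i y))

theorem seminorm_neg (x : X) : F.seminorm (-x) = F.seminorm x := by simp [seminorm]

theorem seminorm_star (x : X) : F.seminorm (star x) = F.seminorm x := by
  simp [seminorm, map_star]

theorem seminorm_mul (x y : X) : F.seminorm (x * y) ≤ F.seminorm x * F.seminorm y :=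
  F.seminorm_le (mul_nonneg (F.seminorm_nonneg _) (F.seminorm_nonneg _)) fun i => by
    rw [map_mul]
    exact (norm_mul_le _ _).trans (mul_le_mul (F.le_seminorm i x) (F.le_seminorm i y)
      (norm_nonneg _) (F.seminorm_nonneg _))

theorem seminorm_smul (c : ℂ) (x : X) : F.seminorm (c • x) ≤ ‖c‖ * F.seminorm x :=
  F.seminorm_le (mul_nonneg (norm_nonneg _) (F.seminorm_nonneg _)) fun i => by
    rw [map_smul, norm_smul]
    exact mul_le_mul_of_nonneg_left (F.le_seminorm i x) (norm_nonneg _)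

theorem seminorm_star_mul_self (x : X) :
    F.seminorm x * F.seminorm x ≤ F.seminorm (star x * x) := by
  have h : F.seminorm x ≤ √(F.seminorm (star x * x)) := by
    refine F.seminorm_le (Real.sqrt_nonneg _) fun i => Real.le_sqrt_of_sq_le ?_
    refine le_trans (le_of_eq ?_) (F.le_seminorm i (star x * x))
    rw [map_mul, map_star, CStarRing.norm_star_mul_self, sq]
  calc F.seminorm x * F.seminorm x
      ≤ √(F.seminorm (star x * x)) * √(F.seminorm (star x * x)) :=
        mul_self_le_mul_self (F.seminorm_nonneg x) h
    _ = _ := Real.mul_self_sqrt (F.seminorm_nonneg _)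

/-- The algebra `X`, to be equipped with the C⋆-seminorm of the family. -/
def Pre (_ : StarHomFamily X) : Type u := X

instance : Ring F.Pre := inferInstanceAs (Ring X)
instance : StarRing F.Pre := inferInstanceAs (StarRing X)
instance : Algebra ℂ F.Pre := inferInstanceAs (Algebra ℂ X)

/-- The identity map from `X` to its seminormed copy. -/
def toPre : X ≃⋆ₐ[ℂ] F.Pre where
  toFun x := x
  invFun x := x
  left_inv _ := rfl
  right_inv _ := rfl
  map_mul' _ _ := rfl
  map_add' _ _ := rfl
  map_star' _ := rfl
  map_smul' _ _ := rfl

instance : SeminormedAddCommGroup F.Pre :=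
  AddGroupSeminorm.toSeminormedAddCommGroup
    { toFun := fun x => F.seminorm (F.toPre.symm x)
      map_zero' := by rw [map_zero, seminorm_zero]
      add_le' := fun x y => by rw [map_add]; exact F.seminorm_add _ _
      neg' := fun x => by rw [map_neg, seminorm_neg] }

theorem norm_pre (x : F.Pre) : ‖x‖ = F.seminorm (F.toPre.symm x) := rfl

instance : SeminormedRing F.Pre where
  __ := (inferInstance : Ring F.Pre)
  __ := (inferInstance : SeminormedAddCommGroup F.Pre)
  norm_mul_le x y := by
    rw [norm_pre, norm_pre, norm_pre, map_mul]; exact F.seminorm_mul _ _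

instance : NormedAlgebra ℂ F.Pre where
  norm_smul_le c x := by
    rw [norm_pre, norm_pre, map_smul]; exact F.seminorm_smul c _

theorem norm_star_pre (x : F.Pre) : ‖star x‖ = ‖x‖ := by
  rw [norm_pre, norm_pre, map_star, seminorm_star]

/-- The C⋆-algebra obtained by separating and completing `X` in the C⋆-seminorm of the family. -/
def Completion : Type u := UniformSpace.Completion F.Pre

instance : NormedRing F.Completion := inferInstanceAs (NormedRing (UniformSpace.Completion F.Pre))
instance : CompleteSpace F.Completion :=
  (inferInstance : CompleteSpace (UniformSpace.Completion F.Pre))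
instance : Algebra ℂ F.Completion := inferInstanceAs (Algebra ℂ (UniformSpace.Completion F.Pre))

/-- The canonical map from `X` to its completion, as a ring homomorphism. -/
def coeHom : X →+* F.Completion :=
  (UniformSpace.Completion.coeRingHom : F.Pre →+* UniformSpace.Completion F.Pre).comp
    (F.toPre : X →+* F.Pre)

theorem denseRange_coeHom : DenseRange F.coeHom :=
  (UniformSpace.Completion.denseRange_coe (α := F.Pre)).comp F.toPre.surjective.denseRange
    (UniformSpace.Completion.continuous_coe _)

theorem norm_coeHom (x : X) : ‖F.coeHom x‖ = F.seminorm x :=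
  UniformSpace.Completion.norm_coe (E := F.Pre) (F.toPre x)

theorem coeHom_smul (c : ℂ) (x : X) : F.coeHom (c • x) = c • F.coeHom x :=
  UniformSpace.Completion.coe_smul c (F.toPre x)

instance : NormedAlgebra ℂ F.Completion where
  norm_smul_le c x :=
    (inferInstance : NormedSpace ℂ (UniformSpace.Completion F.Pre)).norm_smul_le c x

theorem uniformContinuous_star_pre : UniformContinuous (star : F.Pre → F.Pre) :=
  (AddMonoidHomClass.isometry_of_norm (starAddEquiv : F.Pre ≃+ F.Pre)
    F.norm_star_pre).uniformContinuous

instance : Star F.Completion :=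
  ⟨UniformSpace.Completion.map (star : F.Pre → F.Pre)⟩

theorem continuous_star_completion : Continuous (star : F.Completion → F.Completion) :=
  UniformSpace.Completion.continuous_map

theorem coeHom_star (x : X) : F.coeHom (star x) = star (F.coeHom x) :=
  (UniformSpace.Completion.map_coe F.uniformContinuous_star_pre (F.toPre x)).symm

instance : StarRing F.Completion where
  star_involutive := by
    intro y
    refine F.denseRange_coeHom.induction_on (p := fun x => star (star x) = x) y ?_ fun x => ?_
    · exact isClosed_eq (F.continuous_star_completion.comp F.continuous_star_completion)
        continuous_id
    · rw [← coeHom_star, ← coeHom_star, star_star]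
  star_mul := by
    refine F.denseRange_coeHom.induction_on₂ (p := fun x y => star (x * y) = star y * star x)
      ?_ fun x y => ?_
    · have := F.continuous_star_completion
      exact isClosed_eq (this.comp continuous_mul)
        ((this.comp continuous_snd).mul (this.comp continuous_fst))
    · rw [← map_mul, ← coeHom_star, ← coeHom_star, ← coeHom_star, ← map_mul, star_mul]
  star_add := by
    refine F.denseRange_coeHom.induction_on₂ (p := fun x y => star (x + y) = star x + star y)
      ?_ fun x y => ?_
    · have := F.continuous_star_completion
      exact isClosed_eq (this.comp continuous_add)
        ((this.comp continuous_fst).add (this.comp continuous_snd))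
    · rw [← map_add, ← coeHom_star, ← coeHom_star, ← coeHom_star, ← map_add, star_add]

instance [StarModule ℂ X] : CStarAlgebra F.Completion where
  norm_mul_self_le := by
    intro y
    refine F.denseRange_coeHom.induction_on
      (p := fun x => ‖x‖ * ‖x‖ ≤ ‖star x * x‖) y ?_ fun x => ?_
    · exact isClosed_le (continuous_norm.mul continuous_norm)
        (continuous_norm.comp (F.continuous_star_completion.mul continuous_id))
    · rw [← coeHom_star, ← map_mul, norm_coeHom, norm_coeHom]
      exact F.seminorm_star_mul_self x
  star_smul c := by
    intro y
    refine F.denseRange_coeHom.induction_on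
      (p := fun x => star (c • x) = star c • star x) y ?_ fun x => ?_
    · exact isClosed_eq (F.continuous_star_completion.comp (continuous_const_smul c))
        ((continuous_const_smul (star c)).comp F.continuous_star_completion)
    · rw [← coeHom_smul, ← coeHom_star, ← coeHom_star, ← coeHom_smul, star_smul]

/-- The canonical `*`-homomorphism from `X` to its completion. -/
def of : X →⋆ₐ[ℂ] F.Completion where
  toRingHom := F.coeHom
  commutes' c := by
    change F.coeHom _ = _
    rw [Algebra.algebraMap_eq_smul_one, coeHom_smul, map_one, Algebra.algebraMap_eq_smul_one]
  map_star' := F.coeHom_star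

theorem of_apply (x : X) : F.of x = F.coeHom x := rfl

theorem denseRange_of : DenseRange F.of := F.denseRange_coeHom

theorem norm_of (x : X) : ‖F.of x‖ = F.seminorm x := F.norm_coeHom x

/-- A `*`-homomorphism dominated by the seminorm extends to the completion. -/
def lift {C : Type*} [CStarAlgebra C] (f : X →⋆ₐ[ℂ] C) (hf : ∀ x, ‖f x‖ ≤ F.seminorm x) :
    F.Completion →⋆ₐ[ℂ] C :=
  have huc : UniformContinuous (fun x : F.Pre => f (F.toPre.symm x)) :=
    (AddMonoidHomClass.lipschitz_of_bound
      (f.toAlgHom.toLinearMap.toAddMonoidHom.comp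
        (F.toPre.symm : F.Pre →+* X).toAddMonoidHom) 1
      (fun x => by rw [one_mul]; exact hf _)).uniformContinuous
  let g : F.Completion → C := UniformSpace.Completion.extension fun x : F.Pre => f (F.toPre.symm x)
  have hg : Continuous g := UniformSpace.Completion.continuous_extension
  have hgc : ∀ x, g (F.coeHom x) = f x := fun x =>
    UniformSpace.Completion.extension_coe huc (F.toPre x)
  { toFun := g
    map_one' := by rw [← map_one F.coeHom, hgc, map_one]
    map_zero' := by rw [← map_zero F.coeHom, hgc, map_zero]
    map_mul' := by
      refine F.denseRange_coeHom.induction_on₂ (p := fun x y => g (x * y) = g x * g y)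
        ?_ fun x y => ?_
      · exact isClosed_eq (hg.comp continuous_mul)
          ((hg.comp continuous_fst).mul (hg.comp continuous_snd))
      · rw [← map_mul, hgc, hgc, hgc, map_mul]
    map_add' := by
      refine F.denseRange_coeHom.induction_on₂ (p := fun x y => g (x + y) = g x + g y)
        ?_ fun x y => ?_
      · exact isClosed_eq (hg.comp continuous_add)
          ((hg.comp continuous_fst).add (hg.comp continuous_snd))
      · rw [← map_add, hgc, hgc, hgc, map_add]
    commutes' := fun c => by
      rw [← F.of.commutes' c]
      exact (hgc _).trans (f.commutes' c)
    map_star' := by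
      intro y
      refine F.denseRange_coeHom.induction_on (p := fun x => g (star x) = star (g x)) y ?_
        fun x => ?_
      · exact isClosed_eq (hg.comp F.continuous_star_completion) (continuous_star.comp hg)
      · rw [← coeHom_star, hgc, hgc, map_star] }

theorem lift_of {C : Type*} [CStarAlgebra C] (f : X →⋆ₐ[ℂ] C)
    (hf : ∀ x, ‖f x‖ ≤ F.seminorm x) (x : X) : F.lift f hf (F.of x) = f x :=
  UniformSpace.Completion.extension_coe
    (AddMonoidHomClass.lipschitz_of_bound
      (f.toAlgHom.toLinearMap.toAddMonoidHom.comp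
        (F.toPre.symm : F.Pre →+* X).toAddMonoidHom) 1
      (fun x => by rw [one_mul]; exact hf _)).uniformContinuous (F.toPre x)

end StarHomFamily

/-- The free unital complex `*`-algebra on a set `G`: noncommutative polynomials in the letters
`g` (left summand) and `g^*` (right summand). -/
def FreeStarAlgebra (G : Type u) : Type u := FreeAlgebra ℂ (G ⊕ G)

namespace FreeStarAlgebra

variable {G : Type u}

instance : Ring (FreeStarAlgebra G) := inferInstanceAs (Ring (FreeAlgebra ℂ (G ⊕ G)))
instance : Algebra ℂ (FreeStarAlgebra G) := inferInstanceAs (Algebra ℂ (FreeAlgebra ℂ (G ⊕ G)))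

/-- The letter `g` or `g^*`. -/
def letter (g : G ⊕ G) : FreeStarAlgebra G := FreeAlgebra.ι ℂ g

/-- Evaluation of noncommutative polynomials. -/
def evalHom {B : Type*} [Ring B] [Algebra ℂ B] (f : G ⊕ G → B) : FreeStarAlgebra G →ₐ[ℂ] B :=
  FreeAlgebra.lift ℂ f

theorem evalHom_letter {B : Type*} [Ring B] [Algebra ℂ B] (f : G ⊕ G → B) (g : G ⊕ G) :
    evalHom f (letter g) = f g := FreeAlgebra.lift_ι_apply _ _

theorem induction {C : FreeStarAlgebra G → Prop}
    (h_scalar : ∀ r : ℂ, C (algebraMap ℂ (FreeStarAlgebra G) r)) (h_letter : ∀ g, C (letter g))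
    (h_mul : ∀ a b, C a → C b → C (a * b)) (h_add : ∀ a b, C a → C b → C (a + b))
    (a : FreeStarAlgebra G) : C a :=
  FreeAlgebra.induction ℂ (G ⊕ G) h_scalar h_letter h_mul h_add a

/-- The opposite algebra, with the complex conjugate scalar multiplication. -/
def ConjOp (G : Type u) : Type u := (FreeStarAlgebra G)ᵐᵒᵖ

instance : Ring (ConjOp G) := inferInstanceAs (Ring (FreeStarAlgebra G)ᵐᵒᵖ)

/-- The identity map onto the opposite algebra. -/
def toConjOp : (FreeStarAlgebra G)ᵐᵒᵖ ≃+* ConjOp G := RingEquiv.refl _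

instance : Algebra ℂ (ConjOp G) :=
  RingHom.toAlgebra'
    ((toConjOp (G := G)).toRingHom.comp
      ((algebraMap ℂ (FreeStarAlgebra G)ᵐᵒᵖ).comp (starRingEnd ℂ)))
    fun c x => Algebra.commutes (A := (FreeStarAlgebra G)ᵐᵒᵖ) (starRingEnd ℂ c) x

/-- The conjugate-linear anti-homomorphism exchanging `g` and `g^*`. -/
def starHom : FreeStarAlgebra G →+* (FreeStarAlgebra G)ᵐᵒᵖ :=
  (toConjOp (G := G)).symm.toRingHom.comp
    (evalHom (B := ConjOp G) fun g => toConjOp (MulOpposite.op (letter g.swap))).toRingHom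

theorem starHom_letter (g : G ⊕ G) : starHom (letter g) = MulOpposite.op (letter g.swap) :=
  evalHom_letter (B := ConjOp G) (fun g => toConjOp (MulOpposite.op (letter g.swap))) g

theorem starHom_algebraMap (c : ℂ) :
    starHom (algebraMap ℂ (FreeStarAlgebra G) c) =
      MulOpposite.op (algebraMap ℂ (FreeStarAlgebra G) (star c)) :=
  (evalHom (B := ConjOp G) fun g => toConjOp (MulOpposite.op (letter g.swap))).commutes c

instance : StarRing (FreeStarAlgebra G) where
  star x := (starHom x).unop
  star_involutive x := by
    induction x using induction with
    | h_scalar r => simp [starHom_algebraMap]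
    | h_letter g => simp [starHom_letter]
    | h_mul a b ha hb => simp [ha, hb]
    | h_add a b ha hb => simp [ha, hb]
  star_mul a b := by simp
  star_add a b := by simp

theorem star_letter (g : G ⊕ G) : star (letter g) = letter g.swap :=
  congrArg MulOpposite.unop (starHom_letter g)

theorem star_algebraMap' (c : ℂ) :
    star (algebraMap ℂ (FreeStarAlgebra G) c) = algebraMap ℂ (FreeStarAlgebra G) (star c) :=
  congrArg MulOpposite.unop (starHom_algebraMap c)

instance : StarModule ℂ (FreeStarAlgebra G) where
  star_smul c x := by
    rw [Algebra.smul_def, star_mul, star_algebraMap', Algebra.smul_def, Algebra.commutes]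

/-- The unital `*`-homomorphism determined by the images of the letters. -/
def lift {B : Type*} [Ring B] [StarRing B] [Algebra ℂ B] [StarModule ℂ B] (x : G → B) :
    FreeStarAlgebra G →⋆ₐ[ℂ] B where
  toAlgHom := evalHom (Sum.elim x fun g => star (x g))
  map_star' a := by
    change evalHom _ (star a) = star (evalHom _ a)
    induction a using induction with
    | h_scalar r => rw [star_algebraMap', AlgHom.commutes, AlgHom.commutes, algebraMap_star_comm]
    | h_letter g => rw [star_letter, evalHom_letter, evalHom_letter]; cases g <;> simp
    | h_mul a b ha hb => rw [star_mul, map_mul, map_mul, star_mul, ha, hb]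
    | h_add a b ha hb => rw [star_add, map_add, map_add, star_add, ha, hb]

theorem lift_letter_inl {B : Type*} [Ring B] [StarRing B] [Algebra ℂ B] [StarModule ℂ B]
    (x : G → B) (g : G) : lift x (letter (Sum.inl g)) = x g := evalHom_letter _ _

end FreeStarAlgebra

/-- A set of relations between generators indexed by `G`, meaningful in every unital C⋆-algebra,
which forces every generator to be a contraction. -/
structure CStarRelations (G : Type u) where
  Holds : ∀ (B : Type u) [CStarAlgebra B], (G → B) → Prop
  norm_le : ∀ (B : Type u) [CStarAlgebra B] (x : G → B), Holds B x → ∀ g, ‖x g‖ ≤ 1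

namespace CStarRelations

variable {G : Type u} (R : CStarRelations G)

open FreeStarAlgebra

theorem exists_bound (a : FreeStarAlgebra G) : ∃ c : ℝ, ∀ (B : Type u) [CStarAlgebra B]
    (x : G → B), R.Holds B x → ‖FreeStarAlgebra.lift x a‖ ≤ c := by
  induction a using FreeStarAlgebra.induction with
  | h_scalar r =>
    refine ⟨‖r‖, fun B _ x _ => ?_⟩
    rw [AlgHomClass.commutes, Algebra.algebraMap_eq_smul_one, norm_smul]
    refine mul_le_of_le_one_right (norm_nonneg _) ?_
    rcases subsingleton_or_nontrivial B with h | h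
    · rw [Subsingleton.elim (1 : B) 0, norm_zero]; exact zero_le_one
    · rw [CStarRing.norm_one]
  | h_letter g =>
    refine ⟨1, fun B _ x hx => ?_⟩
    change ‖evalHom _ (letter g)‖ ≤ 1
    rw [evalHom_letter]
    cases g with
    | inl g => exact R.norm_le B x hx g
    | inr g => simpa using R.norm_le B x hx g
  | h_mul a b ha hb =>
    obtain ⟨c, hc⟩ := ha
    obtain ⟨d, hd⟩ := hb
    refine ⟨c * d, fun B _ x hx => ?_⟩
    rw [map_mul]
    exact (norm_mul_le _ _).trans (mul_le_mul (hc B x hx) (hd B x hx) (norm_nonneg _)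
      ((norm_nonneg _).trans (hc B x hx)))
  | h_add a b ha hb =>
    obtain ⟨c, hc⟩ := ha
    obtain ⟨d, hd⟩ := hb
    refine ⟨c + d, fun B _ x hx => ?_⟩
    rw [map_add]
    exact (norm_add_le _ _).trans (add_le_add (hc B x hx) (hd B x hx))

/-- A C⋆-algebra together with elements satisfying the relations. -/
structure Model where
  B : Type u
  [cstar : CStarAlgebra B]
  x : G → B
  holds : R.Holds B x

attribute [instance] Model.cstar

/-- The family of all evaluations of polynomials at models of the relations. -/
def family : StarHomFamily (FreeStarAlgebra G) where
  ι := R.Model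
  B M := M.B
  hom M := FreeStarAlgebra.lift M.x
  bdd a := by
    obtain ⟨c, hc⟩ := R.exists_bound a
    refine ⟨c, ?_⟩
    rintro _ ⟨M, rfl⟩
    exact hc M.B M.x M.holds

/-- The universal unital C⋆-algebra with generators indexed by `G` subject to the relations `R`:
the completion of the free `*`-algebra in the largest C⋆-seminorm compatible with `R`. -/
abbrev Universal : Type u := R.family.Completion

/-- The canonical generators. -/
def gen (g : G) : R.Universal := R.family.of (letter (Sum.inl g))

/-- The universal property. -/
def lift {B : Type u} [CStarAlgebra B] (x : G → B) (hx : R.Holds B x) :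
    R.Universal →⋆ₐ[ℂ] B :=
  R.family.lift (FreeStarAlgebra.lift x) fun a => R.family.le_seminorm ⟨B, x, hx⟩ a

theorem lift_gen {B : Type u} [CStarAlgebra B] (x : G → B) (hx : R.Holds B x) (g : G) :
    R.lift x hx (R.gen g) = x g :=
  (R.family.lift_of _ _ _).trans (lift_letter_inl x g)

theorem lift_gen_eq (a : FreeStarAlgebra G) : FreeStarAlgebra.lift R.gen a = R.family.of a := by
  induction a using FreeStarAlgebra.induction with
  | h_scalar r => rw [AlgHomClass.commutes, AlgHomClass.commutes]
  | h_letter g =>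
    cases g with
    | inl g => exact lift_letter_inl _ g
    | inr g =>
      have h : (letter (Sum.inr g) : FreeStarAlgebra G) = star (letter (Sum.inl g)) :=
        (star_letter (Sum.inl g)).symm
      rw [h, map_star, map_star, lift_letter_inl, gen]
  | h_mul a b ha hb => rw [map_mul, map_mul, ha, hb]
  | h_add a b ha hb => rw [map_add, map_add, ha, hb]

/-- A polynomial identity valid in all models holds for the canonical generators. -/
theorem gen_identity (a b : FreeStarAlgebra G)
    (h : ∀ (B : Type u) [CStarAlgebra B] (x : G → B), R.Holds B x →
      FreeStarAlgebra.lift x a = FreeStarAlgebra.lift x b) :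
    FreeStarAlgebra.lift R.gen a = FreeStarAlgebra.lift R.gen b := by
  rw [lift_gen_eq, lift_gen_eq, ← sub_eq_zero, ← map_sub, ← norm_eq_zero, R.family.norm_of]
  refine le_antisymm (R.family.seminorm_le le_rfl fun (M : R.Model) => ?_) (R.family.seminorm_nonneg _)
  change ‖FreeStarAlgebra.lift M.x (a - b)‖ ≤ 0
  rw [map_sub]
  exact le_of_eq (norm_eq_zero.mpr (sub_eq_zero.mpr (h M.B M.x M.holds)))

end CStarRelations

section MinimalTensorProduct

open scoped TensorProduct

instance TensorProduct.instStarRingComplex {A B : Type*} [CStarAlgebra A] [CStarAlgebra B] :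
    StarRing (A ⊗[ℂ] B) where
  star_add := star_add
  star_mul x y := by
    induction x with
    | zero => simp
    | add a b ha hb => rw [add_mul, star_add, ha, hb, star_add, mul_add]
    | tmul a b =>
      induction y with
      | zero => simp
      | add c d hc hd => rw [mul_add, star_add, hc, hd, star_add, add_mul]
      | tmul c d => simp

/-- A unital `*`-representation of a C⋆-algebra on a Hilbert space. -/
structure HilbertRep (A : Type u) [CStarAlgebra A] where
  H : Type u
  [normed : NormedAddCommGroup H]
  [inner : InnerProductSpace ℂ H]
  [complete : CompleteSpace H]
  π : A →⋆ₐ[ℂ] (H →L[ℂ] H)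

attribute [instance] HilbertRep.normed HilbertRep.inner HilbertRep.complete

/-- The Hilbert space tensor product: the completion of the algebraic tensor product. -/
def HilbertTensor (H K : Type u) [NormedAddCommGroup H] [InnerProductSpace ℂ H]
    [NormedAddCommGroup K] [InnerProductSpace ℂ K] : Type u :=
  UniformSpace.Completion (H ⊗[ℂ] K)

section HilbertTensor

variable {H K : Type u} [NormedAddCommGroup H] [InnerProductSpace ℂ H]
  [NormedAddCommGroup K] [InnerProductSpace ℂ K]

instance : NormedAddCommGroup (HilbertTensor H K) :=
  inferInstanceAs (NormedAddCommGroup (UniformSpace.Completion (H ⊗[ℂ] K)))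
instance : InnerProductSpace ℂ (HilbertTensor H K) :=
  inferInstanceAs (InnerProductSpace ℂ (UniformSpace.Completion (H ⊗[ℂ] K)))
instance : CompleteSpace (HilbertTensor H K) :=
  (inferInstance : CompleteSpace (UniformSpace.Completion (H ⊗[ℂ] K)))

end HilbertTensor

/-- The bounded operator `S ⊗ T` on the Hilbert space tensor product. -/
def opTensor {H K : Type u} [NormedAddCommGroup H] [InnerProductSpace ℂ H]
    [NormedAddCommGroup K] [InnerProductSpace ℂ K] (S : H →L[ℂ] H) (T : K →L[ℂ] K) :
    HilbertTensor H K →L[ℂ] HilbertTensor H K :=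
  (TensorProduct.mapL S T).completion

section opTensor

variable {H K : Type u} [NormedAddCommGroup H] [InnerProductSpace ℂ H]
  [NormedAddCommGroup K] [InnerProductSpace ℂ K]

/-- The canonical map from the algebraic tensor product. -/
def hmk (x : H ⊗[ℂ] K) : HilbertTensor H K := (x : UniformSpace.Completion (H ⊗[ℂ] K))

theorem hmk_add (x y : H ⊗[ℂ] K) : hmk (x + y) = hmk x + hmk y :=
  UniformSpace.Completion.coe_add x y

theorem hmk_smul (c : ℂ) (x : H ⊗[ℂ] K) : hmk (c • x) = c • hmk x :=
  UniformSpace.Completion.coe_smul c x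

theorem norm_hmk (x : H ⊗[ℂ] K) : ‖hmk x‖ = ‖x‖ := UniformSpace.Completion.norm_coe x

theorem inner_hmk (x y : H ⊗[ℂ] K) : inner ℂ (hmk x) (hmk y) = inner ℂ x y :=
  UniformSpace.Completion.inner_coe x y

theorem hmk_induction {p : HilbertTensor H K → Prop} (y : HilbertTensor H K)
    (hp : IsClosed {y | p y}) (h : ∀ x : H ⊗[ℂ] K, p (hmk x)) : p y :=
  UniformSpace.Completion.induction_on y hp h

theorem opTensor_coe (S : H →L[ℂ] H) (T : K →L[ℂ] K) (x : H ⊗[ℂ] K) :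
    opTensor S T (hmk x) = hmk (TensorProduct.mapL S T x) :=
  ContinuousLinearMap.completion_apply_coe _ x

theorem opTensor_ext {P Q : HilbertTensor H K →L[ℂ] HilbertTensor H K}
    (h : ∀ x : H ⊗[ℂ] K, P (hmk x) = Q (hmk x)) : P = Q := by
  ext y
  exact hmk_induction y
    (isClosed_eq P.continuous Q.continuous) h

theorem norm_opTensor_le (S : H →L[ℂ] H) (T : K →L[ℂ] K) : ‖opTensor S T‖ ≤ ‖S‖ * ‖T‖ := by
  refine ContinuousLinearMap.opNorm_le_bound _ (by positivity) fun y => ?_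
  refine hmk_induction (p := fun y => ‖opTensor S T y‖ ≤ ‖S‖ * ‖T‖ * ‖y‖) y
    (isClosed_le (by fun_prop) (by fun_prop)) fun x => ?_
  rw [opTensor_coe, norm_hmk, norm_hmk]
  exact ((TensorProduct.mapL S T).le_opNorm x).trans
    (mul_le_mul_of_nonneg_right (TensorProduct.norm_mapL_le S T) (norm_nonneg _))

theorem opTensor_mul (S S' : H →L[ℂ] H) (T T' : K →L[ℂ] K) :
    opTensor (S * S') (T * T') = opTensor S T * opTensor S' T' :=
  opTensor_ext fun x => by
    rw [mul_apply_eq_comp, opTensor_coe, opTensor_coe, opTensor_coe,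
      TensorProduct.mapL_mul, mul_apply_eq_comp]

theorem opTensor_one : opTensor (1 : H →L[ℂ] H) (1 : K →L[ℂ] K) = 1 :=
  opTensor_ext fun x => by
    rw [opTensor_coe]
    exact congrArg _ (DFunLike.congr_fun TensorProduct.mapL_id_id x)

theorem opTensor_add_left (S S' : H →L[ℂ] H) (T : K →L[ℂ] K) :
    opTensor (S + S') T = opTensor S T + opTensor S' T :=
  opTensor_ext fun x => by
    rw [add_apply, opTensor_coe, opTensor_coe, opTensor_coe,
      TensorProduct.mapL_add_left, add_apply, hmk_add]

theorem opTensor_add_right (S : H →L[ℂ] H) (T T' : K →L[ℂ] K) :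
    opTensor S (T + T') = opTensor S T + opTensor S T' :=
  opTensor_ext fun x => by
    rw [add_apply, opTensor_coe, opTensor_coe, opTensor_coe,
      TensorProduct.mapL_add_right, add_apply,
      hmk_add]

theorem opTensor_smul_left (c : ℂ) (S : H →L[ℂ] H) (T : K →L[ℂ] K) :
    opTensor (c • S) T = c • opTensor S T :=
  opTensor_ext fun x => by
    rw [smul_apply, opTensor_coe, opTensor_coe,
      TensorProduct.mapL_smul_left, smul_apply,
      hmk_smul]

theorem opTensor_smul_right (c : ℂ) (S : H →L[ℂ] H) (T : K →L[ℂ] K) :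
    opTensor S (c • T) = c • opTensor S T :=
  opTensor_ext fun x => by
    rw [smul_apply, opTensor_coe, opTensor_coe,
      TensorProduct.mapL_smul_right, smul_apply,
      hmk_smul]

theorem opTensor_star [CompleteSpace H] [CompleteSpace K] (S : H →L[ℂ] H) (T : K →L[ℂ] K) :
    star (opTensor S T) = opTensor (star S) (star T) := by
  symm
  refine (ContinuousLinearMap.eq_adjoint_iff _ _).mpr fun x y => ?_
  refine hmk_induction (p := fun x => inner ℂ (opTensor (star S) (star T) x) y =
    inner ℂ x (opTensor S T y)) x (isClosed_eq (by fun_prop) (by fun_prop)) fun x => ?_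
  refine hmk_induction (p := fun y => inner ℂ (opTensor (star S) (star T) (hmk x)) y =
    inner ℂ (hmk x) (opTensor S T y)) y (isClosed_eq (by fun_prop) (by fun_prop)) fun y => ?_
  rw [opTensor_coe, opTensor_coe, inner_hmk, inner_hmk]
  induction x with
  | zero => simp
  | add a b ha hb => rw [map_add, inner_add_left, ha, hb, inner_add_left]
  | tmul a b =>
    induction y with
    | zero => simp
    | add c d hc hd => rw [inner_add_right, hc, hd, map_add, inner_add_right]
    | tmul c d =>
      simp [ContinuousLinearMap.star_eq_adjoint, ContinuousLinearMap.adjoint_inner_left]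

end opTensor

variable (A B : Type u) [CStarAlgebra A] [CStarAlgebra B]

variable {A B} in
/-- The tensor product `π ⊗ ρ` of representations as an algebra homomorphism. -/
def tensorRepAlg (p : HilbertRep A) (q : HilbertRep B) :
    A ⊗[ℂ] B →ₐ[ℂ] (HilbertTensor p.H q.H →L[ℂ] HilbertTensor p.H q.H) :=
  Algebra.TensorProduct.algHomOfLinearMapTensorProduct
    (TensorProduct.lift (LinearMap.mk₂ ℂ (fun a b => opTensor (p.π a) (q.π b))
      (fun a a' b => by rw [map_add, opTensor_add_left])
      (fun c a b => by rw [map_smul, opTensor_smul_left])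
      (fun a b b' => by rw [map_add, opTensor_add_right])
      (fun c a b => by rw [map_smul, opTensor_smul_right])))
    (fun a a' b b' => by
      simp only [TensorProduct.lift.tmul, LinearMap.mk₂_apply, map_mul, opTensor_mul])
    (by simp only [TensorProduct.lift.tmul, LinearMap.mk₂_apply, map_one, opTensor_one])

variable {A B} in
theorem tensorRepAlg_tmul (p : HilbertRep A) (q : HilbertRep B) (a : A) (b : B) :
    tensorRepAlg p q (a ⊗ₜ[ℂ] b) = opTensor (p.π a) (q.π b) := rfl

variable {A B} in
theorem tensorRepAlg_star (p : HilbertRep A) (q : HilbertRep B) (x : A ⊗[ℂ] B) :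
    tensorRepAlg p q (star x) = star (tensorRepAlg p q x) := by
  induction x with
  | zero => rw [star_zero, map_zero, star_zero]
  | add a b ha hb => rw [star_add, map_add, map_add, star_add, ha, hb]
  | tmul a b =>
    rw [TensorProduct.star_tmul, tensorRepAlg_tmul, tensorRepAlg_tmul, opTensor_star, map_star,
      map_star]

variable {A B} in
/-- The tensor product `π ⊗ ρ` of representations, on the algebraic tensor product. -/
def tensorRep (p : HilbertRep A) (q : HilbertRep B) :
    A ⊗[ℂ] B →⋆ₐ[ℂ] (HilbertTensor p.H q.H →L[ℂ] HilbertTensor p.H q.H) where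
  toAlgHom := tensorRepAlg p q
  map_star' := tensorRepAlg_star p q

variable {A B} in
theorem tensorRep_tmul (p : HilbertRep A) (q : HilbertRep B) (a : A) (b : B) :
    tensorRep p q (a ⊗ₜ[ℂ] b) = opTensor (p.π a) (q.π b) := rfl

/-- The family of all representations `π ⊗ ρ`, whose seminorm is the spatial (minimal)
C⋆-norm `‖x‖ = sup_{π, ρ} ‖(π ⊗ ρ)(x)‖` on the algebraic tensor product. -/
def spatialFamily : StarHomFamily (A ⊗[ℂ] B) where
  ι := HilbertRep A × HilbertRep B
  B i := HilbertTensor i.1.H i.2.H →L[ℂ] HilbertTensor i.1.H i.2.H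
  hom i := tensorRep i.1 i.2
  bdd x := by
    have h : ∃ c : ℝ, ∀ i : HilbertRep A × HilbertRep B, ‖tensorRep i.1 i.2 x‖ ≤ c := by
      induction x with
      | zero => exact ⟨0, fun i => by simp⟩
      | add x y hx hy =>
        obtain ⟨c, hc⟩ := hx
        obtain ⟨d, hd⟩ := hy
        refine ⟨c + d, fun i => ?_⟩
        rw [map_add]
        exact (norm_add_le _ _).trans (add_le_add (hc i) (hd i))
      | tmul a b =>
        refine ⟨‖a‖ * ‖b‖, fun i => ?_⟩
        rw [tensorRep_tmul]
        exact (norm_opTensor_le _ _).trans (mul_le_mul (NonUnitalStarAlgHom.norm_apply_le _ a)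
          (NonUnitalStarAlgHom.norm_apply_le _ b) (norm_nonneg _) (norm_nonneg _))
    obtain ⟨c, hc⟩ := h
    refine ⟨c, ?_⟩
    rintro _ ⟨i, rfl⟩
    exact hc i

/-- The minimal (spatial) C⋆-tensor product. -/
abbrev MinTensor : Type u := (spatialFamily A B).Completion

variable {A B} in
/-- The elementary tensor `a ⊗ b` in the minimal tensor product. -/
def minTmul (a : A) (b : B) : MinTensor A B := (spatialFamily A B).of (a ⊗ₜ[ℂ] b)

end MinimalTensorProduct

section MinTmul

open scoped TensorProduct

variable {A B : Type u} [CStarAlgebra A] [CStarAlgebra B]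

theorem minTmul_mul (a a' : A) (b b' : B) :
    minTmul a b * minTmul a' b' = minTmul (a * a') (b * b') := by
  rw [minTmul, minTmul, ← map_mul, Algebra.TensorProduct.tmul_mul_tmul, minTmul]

theorem star_minTmul (a : A) (b : B) : star (minTmul a b) = minTmul (star a) (star b) := by
  rw [minTmul, ← map_star, TensorProduct.star_tmul, minTmul]

theorem minTmul_one : minTmul (1 : A) (1 : B) = 1 :=
  map_one (spatialFamily A B).of

theorem zero_minTmul (b : B) : minTmul (0 : A) b = 0 := by
  rw [minTmul, TensorProduct.zero_tmul, map_zero]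

theorem minTmul_zero (a : A) : minTmul a (0 : B) = 0 := by
  rw [minTmul, TensorProduct.tmul_zero, map_zero]

theorem sum_minTmul {ι : Type*} (s : Finset ι) (f : ι → A) (b : B) :
    minTmul (∑ i ∈ s, f i) b = ∑ i ∈ s, minTmul (f i) b := by
  simp only [minTmul, TensorProduct.sum_tmul, map_sum]

theorem minTmul_sum {ι : Type*} (s : Finset ι) (a : A) (f : ι → B) :
    minTmul a (∑ i ∈ s, f i) = ∑ i ∈ s, minTmul a (f i) := by
  simp only [minTmul, TensorProduct.tmul_sum, map_sum]

end MinTmul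

theorem eq_zero_of_sum_star_mul_self {B : Type*} [CStarAlgebra B] {ι : Type*} (s : Finset ι)
    (f : ι → B) (h : ∑ i ∈ s, star (f i) * f i = 0) : ∀ i ∈ s, f i = 0 := by
  let _ := CStarAlgebra.spectralOrder B
  have _ := CStarAlgebra.spectralOrderedRing B
  intro i hi
  have := (Finset.sum_eq_zero_iff_of_nonneg fun j _ => star_mul_self_nonneg (f j)).mp h i hi
  exact (CStarRing.star_mul_self_eq_zero_iff _).mp this

/-! ### Graphs, graph C⋆-algebras and quantum automorphism groups -/

namespace Digraph

variable {V : Type u} (Γ : Digraph V)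

/-- The edges of a directed graph without multiple edges. -/
abbrev Edge : Type u := {e : V × V // Γ.Adj e.1 e.2}

/-- The source of an edge. -/
abbrev src (e : Γ.Edge) : V := e.1.1

/-- The target of an edge. -/
abbrev tgt (e : Γ.Edge) : V := e.1.2

/-- Every vertex emits an edge. -/
def NoSinks : Prop := Function.Surjective Γ.src

/-- Any two vertices are joined by a directed path. -/
def StronglyConnected : Prop := ∀ v w, Relation.ReflTransGen Γ.Adj v w

variable [Fintype V] [DecidableEq V] [DecidableRel Γ.Adj]

/-- The vertex matrix `D`. -/
def vertexMatrix (R : Type*) [Zero R] [One R] : Matrix V V R :=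
  Matrix.of fun v w => if Γ.Adj v w then 1 else 0

/-- Projections `p v` and partial isometries `S e` in a unital C⋆-algebra satisfying the relations
of the graph C⋆-algebra. As `V` is finite, `∑ v, p v` is a unit of the C⋆-algebra that they
generate, so in the category of unital C⋆-algebras it is required to be `1`. -/
structure IsGraphFamily {B : Type*} [CStarAlgebra B] (p : V → B) (S : Γ.Edge → B) : Prop where
  star_p : ∀ v, star (p v) = p v
  p_mul_p : ∀ v w, p v * p w = if v = w then p v else 0
  sum_p : ∑ v, p v = 1
  star_S_mul_S : ∀ e, star (S e) * S e = p (Γ.tgt e)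
  sum_S_mul_star_S : ∀ v, ∑ e with Γ.src e = v, S e * star (S e) = p v

/-- Entries `u v w` of a magic unitary `A` with `A D = D A`, in a unital C⋆-algebra. -/
structure IsQAutFamily {B : Type*} [CStarAlgebra B] (u : V → V → B) : Prop where
  star_u : ∀ i j, star (u i j) = u i j
  row_mul : ∀ i j k, u i j * u i k = if j = k then u i j else 0
  col_mul : ∀ i j k, u j i * u k i = if j = k then u j i else 0
  row_sum : ∀ i, ∑ l, u i l = 1
  col_sum : ∀ i, ∑ l, u l i = 1
  comm : Matrix.of u * Γ.vertexMatrix B = Γ.vertexMatrix B * Matrix.of u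

theorem norm_le_one_of_proj {B : Type*} [CStarAlgebra B] {a : B} (h1 : star a = a)
    (h2 : a * a = a) : ‖a‖ ≤ 1 := by
  have h := CStarRing.norm_star_mul_self (x := a)
  rw [h1, h2] at h
  by_contra hc
  push Not at hc
  nlinarith

theorem norm_le_one_of_star_mul_self {B : Type*} [CStarAlgebra B] {a : B}
    (h : ‖star a * a‖ ≤ 1) : ‖a‖ ≤ 1 := by
  rw [CStarRing.norm_star_mul_self] at h
  by_contra hc
  push Not at hc
  nlinarith

variable {Γ}

namespace IsGraphFamily

variable {B : Type*} [CStarAlgebra B] {p : V → B} {S : Γ.Edge → B}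

theorem norm_p_le (h : Γ.IsGraphFamily p S) (v : V) : ‖p v‖ ≤ 1 :=
  norm_le_one_of_proj (h.star_p v) (by rw [h.p_mul_p, if_pos rfl])

theorem norm_S_le (h : Γ.IsGraphFamily p S) (e : Γ.Edge) : ‖S e‖ ≤ 1 :=
  norm_le_one_of_star_mul_self (by rw [h.star_S_mul_S]; exact h.norm_p_le _)

theorem S_mul_p (h : Γ.IsGraphFamily p S) (e : Γ.Edge) : S e * p (Γ.tgt e) = S e := by
  have hp : p (Γ.tgt e) * p (Γ.tgt e) = p (Γ.tgt e) := by rw [h.p_mul_p, if_pos rfl]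
  rw [← sub_eq_zero, ← CStarRing.star_mul_self_eq_zero_iff, star_sub, star_mul, h.star_p, sub_mul,
    mul_sub, mul_sub, ← mul_assoc, mul_assoc (p _) (star _), h.star_S_mul_S, ← mul_assoc,
    h.star_S_mul_S, hp]
  simp [hp]

theorem p_mul_S (h : Γ.IsGraphFamily p S) (e : Γ.Edge) : p (Γ.src e) * S e = S e := by
  have hp : p (Γ.src e) * p (Γ.src e) = p (Γ.src e) := by rw [h.p_mul_p, if_pos rfl]
  have key := eq_zero_of_sum_star_mul_self (Finset.univ.filter fun f => Γ.src f = Γ.src e)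
    (fun f => star (S f) * (1 - p (Γ.src e))) (by
      have : ∀ f, star (star (S f) * (1 - p (Γ.src e))) * (star (S f) * (1 - p (Γ.src e))) =
          (1 - p (Γ.src e)) * (S f * star (S f)) * (1 - p (Γ.src e)) := fun f => by
        rw [star_mul, star_star, star_sub, star_one, h.star_p]; noncomm_ring
      simp only [this]
      rw [← Finset.sum_mul, ← Finset.mul_sum, h.sum_S_mul_star_S, sub_mul, hp, one_mul, sub_self,
        zero_mul]) e (by simp)
  have := congrArg star key
  rw [star_mul, star_star, star_sub, star_one, h.star_p, star_zero, sub_mul, one_mul,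
    sub_eq_zero] at this
  exact this.symm

theorem star_S_mul_S_of_ne (h : Γ.IsGraphFamily p S) {e f : Γ.Edge} (hef : e ≠ f) :
    star (S e) * S f = 0 := by
  by_cases hs : Γ.src e = Γ.src f
  · have hsum := h.sum_S_mul_star_S (Γ.src f)
    have h1 : S f * star (S f) * S f = S f := by rw [mul_assoc, h.star_S_mul_S, h.S_mul_p]
    have h0 : ∑ g ∈ (Finset.univ.filter fun g => Γ.src g = Γ.src f).erase f,
        star (star (S g) * S f) * (star (S g) * S f) = 0 := by
      have h2 : ∀ g, star (star (S g) * S f) * (star (S g) * S f) =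
          star (S f) * (S g * star (S g)) * S f := fun g => by
        rw [star_mul, star_star]; noncomm_ring
      simp only [h2]
      rw [← Finset.sum_mul, ← Finset.mul_sum]
      have h3 := Finset.add_sum_erase (Finset.univ.filter fun g => Γ.src g = Γ.src f)
        (fun g => S g * star (S g)) (a := f) (by simp)
      rw [hsum] at h3
      have h4 : ∑ g ∈ (Finset.univ.filter fun g => Γ.src g = Γ.src f).erase f,
          S g * star (S g) = p (Γ.src f) - S f * star (S f) := by
        rw [← h3]; abel
      rw [h4, mul_sub, sub_mul, mul_assoc, h.p_mul_S, mul_assoc (star (S f)), h1, sub_self]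
    exact eq_zero_of_sum_star_mul_self _ _ h0 e (by simp [hef, hs])
  · have : star (S e) * S f = star (p (Γ.src e) * S e) * (p (Γ.src f) * S f) := by
      rw [h.p_mul_S, h.p_mul_S]
    rw [this, star_mul, h.star_p, mul_assoc, ← mul_assoc (p _) (p _), h.p_mul_p, if_neg hs,
      zero_mul, mul_zero]

end IsGraphFamily

theorem sum_edge {V : Type u} [Fintype V] {Γ : Digraph V} [DecidableRel Γ.Adj] {B : Type*}
    [AddCommMonoid B] (f : V → V → B) :
    ∑ e : Γ.Edge, f (Γ.src e) (Γ.tgt e) = ∑ v, ∑ w, if Γ.Adj v w then f v w else 0 := by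
  rw [← Finset.sum_product', Finset.univ_product_univ, ← Finset.sum_filter]
  exact (Finset.sum_subtype _ (by simp) fun x : V × V => f x.1 x.2).symm

namespace IsQAutFamily

variable {B : Type*} [CStarAlgebra B] {u : V → V → B}

theorem norm_le (h : Γ.IsQAutFamily u) (i j : V) : ‖u i j‖ ≤ 1 :=
  norm_le_one_of_proj (h.star_u i j) (by rw [h.row_mul, if_pos rfl])

theorem transpose_mul (h : Γ.IsQAutFamily u) :
    (Matrix.of fun i j => u j i) * Matrix.of u = 1 := by
  ext i j
  rw [Matrix.mul_apply]
  simp only [Matrix.of_apply, h.row_mul, Matrix.one_apply]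
  split_ifs with hij
  · exact h.col_sum i
  · simp

theorem mul_transpose (h : Γ.IsQAutFamily u) :
    Matrix.of u * (Matrix.of fun i j => u j i) = 1 := by
  ext i j
  rw [Matrix.mul_apply]
  simp only [Matrix.of_apply, h.col_mul, Matrix.one_apply]
  split_ifs with hij
  · exact h.row_sum i
  · simp

theorem transpose_comm (h : Γ.IsQAutFamily u) :
    (Matrix.of fun i j => u j i) * Γ.vertexMatrix B =
      Γ.vertexMatrix B * (Matrix.of fun i j => u j i) := by
  set N : Matrix V V B := Matrix.of fun i j => u j i
  calc N * Γ.vertexMatrix B = N * Γ.vertexMatrix B * (Matrix.of u * N) := by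
        rw [h.mul_transpose, mul_one]
    _ = N * (Γ.vertexMatrix B * Matrix.of u) * N := by simp only [Matrix.mul_assoc]
    _ = (N * Matrix.of u) * Γ.vertexMatrix B * N := by rw [← h.comm]; simp only [Matrix.mul_assoc]
    _ = Γ.vertexMatrix B * N := by rw [h.transpose_mul, one_mul]

theorem sum_comm (h : Γ.IsQAutFamily u) (i w : V) :
    ∑ v, (if Γ.Adj v w then u v i else 0) = ∑ k, if Γ.Adj i k then u w k else 0 := by
  have := congrFun (congrFun h.transpose_comm i) w
  simpa [Matrix.mul_apply, vertexMatrix] using this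

theorem mul_sum_mul (h : Γ.IsQAutFamily u) {i k : V} (hik : Γ.Adj i k) (w : V) :
    ∑ v, (if Γ.Adj v w then u w k * u v i * u w k else 0) = u w k := by
  have h1 : ∑ v, (if Γ.Adj v w then u w k * u v i * u w k else 0) =
      u w k * (∑ v, if Γ.Adj v w then u v i else 0) * u w k := by
    rw [Finset.mul_sum, Finset.sum_mul]
    exact Finset.sum_congr rfl fun v _ => by split_ifs <;> simp
  have h2 : ∀ l, (u w k * if Γ.Adj i l then u w l else 0) = if k = l then u w k else 0 :=
    fun l => by
      by_cases hl : k = l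
      · subst hl; rw [if_pos hik, h.row_mul]
      · rw [if_neg hl]; split_ifs
        · rw [h.row_mul, if_neg hl]
        · simp
  rw [h1, h.sum_comm, Finset.mul_sum]
  simp only [h2, Finset.sum_ite_eq, Finset.mem_univ, if_true, h.row_mul]

theorem sum_mul_mul (h : Γ.IsQAutFamily u) (l l' : Γ.Edge) (i : V) :
    ∑ k, (if Γ.Adj i k then u (Γ.src l) i * u (Γ.tgt l) k * (u (Γ.tgt l') k * u (Γ.src l') i)
      else 0) = if l = l' then u (Γ.src l) i else 0 := by
  by_cases ht : Γ.tgt l = Γ.tgt l'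
  · have h1 : ∑ k, (if Γ.Adj i k then
        u (Γ.src l) i * u (Γ.tgt l) k * (u (Γ.tgt l') k * u (Γ.src l') i) else 0) =
        u (Γ.src l) i * (∑ k, if Γ.Adj i k then u (Γ.tgt l) k else 0) * u (Γ.src l') i := by
      rw [Finset.mul_sum, Finset.sum_mul]
      refine Finset.sum_congr rfl fun k _ => ?_
      split_ifs
      · rw [← ht, mul_assoc, ← mul_assoc (u (Γ.tgt l) k) (u (Γ.tgt l) k), h.row_mul,
          if_pos rfl, mul_assoc]
      · simp
    rw [h1, ← h.sum_comm, Finset.mul_sum]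
    have h2 : ∀ v, (u (Γ.src l) i * if Γ.Adj v (Γ.tgt l) then u v i else 0) =
        if Γ.src l = v then u (Γ.src l) i else 0 := fun v => by
      by_cases hv : Γ.src l = v
      · subst hv; rw [if_pos l.2, h.col_mul]
      · rw [if_neg hv]; split_ifs
        · rw [h.col_mul, if_neg hv]
        · simp
    simp only [h2, Finset.sum_ite_eq, Finset.mem_univ, if_true, h.col_mul]
    refine if_congr ⟨fun hs => Subtype.ext (Prod.ext hs ht), fun hl => by rw [hl]⟩ rfl rfl
  · rw [if_neg fun hl => ht (by rw [hl])]
    refine Finset.sum_eq_zero fun k _ => ?_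
    split_ifs
    · rw [mul_assoc, ← mul_assoc (u (Γ.tgt l) k), h.col_mul, if_neg ht, zero_mul, mul_zero]
    · rfl

end IsQAutFamily

variable (Γ)


/-- The relations of the graph C⋆-algebra. -/
def graphRelations : CStarRelations (V ⊕ Γ.Edge) where
  Holds _ _ x := Γ.IsGraphFamily (fun v => x (Sum.inl v)) fun e => x (Sum.inr e)
  norm_le _ _ _ h g := by
    cases g with
    | inl v => exact h.norm_p_le v
    | inr e => exact h.norm_S_le e

/-- The relations of the quantum automorphism group. -/
def qAutRelations : CStarRelations (V × V) where
  Holds _ _ x := Γ.IsQAutFamily fun i j => x (i, j)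
  norm_le _ _ _ h g := h.norm_le g.1 g.2

/-- The graph C⋆-algebra `C^*(Γ)`. -/
abbrev CStar : Type u := Γ.graphRelations.Universal

/-- The C⋆-algebra of the quantum automorphism group `Q^aut_Ban(Γ)`. -/
abbrev QAut : Type u := Γ.qAutRelations.Universal

/-- The vertex projections of `C^*(Γ)`. -/
def p (v : V) : Γ.CStar := Γ.graphRelations.gen (Sum.inl v)

/-- The edge partial isometries of `C^*(Γ)`. -/
def S (e : Γ.Edge) : Γ.CStar := Γ.graphRelations.gen (Sum.inr e)

/-- The generators of `Q^aut_Ban(Γ)`. -/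
def u (i j : V) : Γ.QAut := Γ.qAutRelations.gen (i, j)

theorem isGraphFamily : Γ.IsGraphFamily Γ.p Γ.S := by
  let P (v : V) : FreeStarAlgebra (V ⊕ Γ.Edge) := FreeStarAlgebra.letter (Sum.inl (Sum.inl v))
  let T (e : Γ.Edge) : FreeStarAlgebra (V ⊕ Γ.Edge) :=
    FreeStarAlgebra.letter (Sum.inl (Sum.inr e))
  have key := Γ.graphRelations.gen_identity
  have hP : ∀ {B : Type u} [CStarAlgebra B] (x : V ⊕ Γ.Edge → B) v,
      FreeStarAlgebra.lift x (P v) = x (Sum.inl v) := fun x v =>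
    FreeStarAlgebra.lift_letter_inl x _
  have hT : ∀ {B : Type u} [CStarAlgebra B] (x : V ⊕ Γ.Edge → B) e,
      FreeStarAlgebra.lift x (T e) = x (Sum.inr e) := fun x e =>
    FreeStarAlgebra.lift_letter_inl x _
  change Γ.IsGraphFamily (fun v => Γ.graphRelations.gen (Sum.inl v))
    fun e => Γ.graphRelations.gen (Sum.inr e)
  constructor
  · intro v
    simpa only [map_star, hP] using key (star (P v)) (P v) fun B _ x h => by
      simpa only [map_star, hP] using h.star_p v
  · intro v w
    have := key (P v * P w) (if v = w then P v else 0) fun B _ x h => by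
      simpa only [map_mul, apply_ite, map_zero, hP] using h.p_mul_p v w
    simpa only [map_mul, apply_ite, map_zero, hP] using this
  · simpa only [map_sum, map_one, hP] using key (∑ v, P v) 1 fun B _ x h => by
      simpa only [map_sum, map_one, hP] using h.sum_p
  · intro e
    simpa only [map_mul, map_star, hP, hT] using key (star (T e) * T e) (P (Γ.tgt e))
      fun B _ x h => by simpa only [map_mul, map_star, hP, hT] using h.star_S_mul_S e
  · intro v
    simpa only [map_sum, map_mul, map_star, hP, hT] using
      key (∑ e with Γ.src e = v, T e * star (T e)) (P v)
      fun B _ x h => by simpa only [map_sum, map_mul, map_star, hP, hT] using h.sum_S_mul_star_S v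

theorem isQAutFamily : Γ.IsQAutFamily Γ.u := by
  let U (i j : V) : FreeStarAlgebra (V × V) := FreeStarAlgebra.letter (Sum.inl (i, j))
  have key := Γ.qAutRelations.gen_identity
  have hU : ∀ {B : Type u} [CStarAlgebra B] (x : V × V → B) i j,
      FreeStarAlgebra.lift x (U i j) = x (i, j) := fun x i j =>
    FreeStarAlgebra.lift_letter_inl x _
  change Γ.IsQAutFamily fun i j => Γ.qAutRelations.gen (i, j)
  constructor
  · intro i j
    simpa only [map_star, hU] using key (star (U i j)) (U i j) fun B _ x h => by
      simpa only [map_star, hU] using h.star_u i j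
  · intro i j k
    have := key (U i j * U i k) (if j = k then U i j else 0) fun B _ x h => by
      simpa only [map_mul, apply_ite, map_zero, hU] using h.row_mul i j k
    simpa only [map_mul, apply_ite, map_zero, hU] using this
  · intro i j k
    have := key (U j i * U k i) (if j = k then U j i else 0) fun B _ x h => by
      simpa only [map_mul, apply_ite, map_zero, hU] using h.col_mul i j k
    simpa only [map_mul, apply_ite, map_zero, hU] using this
  · intro i
    simpa only [map_sum, map_one, hU] using key (∑ l, U i l) 1 fun B _ x h => by
      simpa only [map_sum, map_one, hU] using h.row_sum i
  · intro i
    simpa only [map_sum, map_one, hU] using key (∑ l, U l i) 1 fun B _ x h => by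
      simpa only [map_sum, map_one, hU] using h.col_sum i
  · ext i j
    have hcomm : ∀ {B : Type u} [CStarAlgebra B] (x : V × V → B),
        FreeStarAlgebra.lift x (∑ k, if Γ.Adj k j then U i k else 0) =
          ((Matrix.of fun i j => x (i, j)) * Γ.vertexMatrix B) i j ∧
        FreeStarAlgebra.lift x (∑ k, if Γ.Adj i k then U k j else 0) =
          (Γ.vertexMatrix B * (Matrix.of fun i j => x (i, j))) i j := fun x => by
      constructor <;>
      simp only [map_sum, apply_ite, map_zero, hU, Matrix.mul_apply, Matrix.of_apply,
        vertexMatrix, ite_mul, mul_one, one_mul, mul_zero, zero_mul]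
    have := key (∑ k, if Γ.Adj k j then U i k else 0) (∑ k, if Γ.Adj i k then U k j else 0)
      fun B _ x h => by
        rw [(hcomm x).1, (hcomm x).2]; exact congrFun (congrFun h.comm i) j
    rw [(hcomm _).1, (hcomm _).2] at this
    exact this

/-- The vertex elements `∑ k, p k ⊗ u k i` of the action. -/
def actionP (i : V) : MinTensor Γ.CStar Γ.QAut := ∑ k, minTmul (Γ.p k) (Γ.u k i)

/-- The edge elements `∑ l, S l ⊗ u (s l) (s j) u (t l) (t j)` of the action. -/
def actionS (j : Γ.Edge) : MinTensor Γ.CStar Γ.QAut :=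
  ∑ l, minTmul (Γ.S l) (Γ.u (Γ.src l) (Γ.src j) * Γ.u (Γ.tgt l) (Γ.tgt j))

theorem isGraphFamily_action : Γ.IsGraphFamily Γ.actionP Γ.actionS := by
  have hG := Γ.isGraphFamily
  have hQ := Γ.isQAutFamily
  constructor
  · intro v
    simp only [actionP, star_sum, star_minTmul, hG.star_p, hQ.star_u]
  · intro v w
    simp only [actionP, Finset.sum_mul_sum, minTmul_mul, hG.p_mul_p]
    have : ∀ i j : V, minTmul (if i = j then Γ.p i else 0) (Γ.u i v * Γ.u j w) =
        if i = j then minTmul (Γ.p i) (if v = w then Γ.u i v else 0) else 0 := fun i j => by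
      split_ifs with h1 h2
      · subst h1 h2; rw [hQ.row_mul, if_pos rfl]
      · subst h1; rw [hQ.row_mul, if_neg h2]
      · exact zero_minTmul _
    simp only [this, Finset.sum_ite_eq, Finset.mem_univ, if_true]
    by_cases h : v = w
    · simp only [h, if_true]
    · simp only [h, if_false, minTmul_zero, Finset.sum_const_zero]
  · simp only [actionP]
    rw [Finset.sum_comm]
    simp only [← minTmul_sum, hQ.row_sum]
    rw [← sum_minTmul, hG.sum_p, minTmul_one]
  · intro j
    simp only [actionS, actionP, star_sum, star_minTmul, Finset.sum_mul_sum, minTmul_mul,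
      star_mul, hQ.star_u]
    have : ∀ l l' : Γ.Edge, minTmul (star (Γ.S l) * Γ.S l')
        (Γ.u (Γ.tgt l) (Γ.tgt j) * Γ.u (Γ.src l) (Γ.src j) *
          (Γ.u (Γ.src l') (Γ.src j) * Γ.u (Γ.tgt l') (Γ.tgt j))) =
        if l = l' then minTmul (Γ.p (Γ.tgt l)) (Γ.u (Γ.tgt l) (Γ.tgt j) *
          Γ.u (Γ.src l) (Γ.src j) * Γ.u (Γ.tgt l) (Γ.tgt j)) else 0 := fun l l' => by
      split_ifs with h
      · subst h
        rw [hG.star_S_mul_S, mul_assoc, ← mul_assoc (Γ.u (Γ.src l) (Γ.src j)), hQ.row_mul,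
          if_pos rfl, mul_assoc]
      · rw [hG.star_S_mul_S_of_ne h, zero_minTmul]
    simp only [this, Finset.sum_ite_eq, Finset.mem_univ, if_true]
    rw [sum_edge fun v w => minTmul (Γ.p w) (Γ.u w (Γ.tgt j) * Γ.u v (Γ.src j) *
      Γ.u w (Γ.tgt j)), Finset.sum_comm]
    refine Finset.sum_congr rfl fun w _ => ?_
    conv_rhs => rw [← hQ.mul_sum_mul j.2 w, minTmul_sum]
    refine Finset.sum_congr rfl fun v _ => ?_
    split_ifs
    · rfl
    · exact (minTmul_zero _).symm
  · intro i
    simp only [actionS, actionP, star_sum, star_minTmul, Finset.sum_mul_sum, minTmul_mul,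
      star_mul, hQ.star_u]
    rw [Finset.sum_comm]
    have : ∀ l l' : Γ.Edge, ∑ j with Γ.src j = i, minTmul (Γ.S l * star (Γ.S l'))
        (Γ.u (Γ.src l) (Γ.src j) * Γ.u (Γ.tgt l) (Γ.tgt j) *
          (Γ.u (Γ.tgt l') (Γ.tgt j) * Γ.u (Γ.src l') (Γ.src j))) =
        if l = l' then minTmul (Γ.S l * star (Γ.S l)) (Γ.u (Γ.src l) i) else 0 := fun l l' => by
      rw [← minTmul_sum, Finset.sum_filter, sum_edge fun v k => if v = i then
        Γ.u (Γ.src l) v * Γ.u (Γ.tgt l) k * (Γ.u (Γ.tgt l') k * Γ.u (Γ.src l') v) else 0]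
      have h1 : (∑ v, ∑ k, if Γ.Adj v k then if v = i then
          Γ.u (Γ.src l) v * Γ.u (Γ.tgt l) k * (Γ.u (Γ.tgt l') k * Γ.u (Γ.src l') v)
          else 0 else 0) = if l = l' then Γ.u (Γ.src l) i else 0 := by
        rw [Finset.sum_eq_single i, ← hQ.sum_mul_mul]
        · simp
        · intro v _ hv
          simp [hv]
        · simp
      rw [h1]
      split_ifs with h
      · rw [h]
      · exact minTmul_zero _
    have h2 : ∀ l : Γ.Edge, ∑ j with Γ.src j = i, ∑ l', minTmul (Γ.S l * star (Γ.S l'))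
        (Γ.u (Γ.src l) (Γ.src j) * Γ.u (Γ.tgt l) (Γ.tgt j) *
          (Γ.u (Γ.tgt l') (Γ.tgt j) * Γ.u (Γ.src l') (Γ.src j))) =
        minTmul (Γ.S l * star (Γ.S l)) (Γ.u (Γ.src l) i) := fun l => by
      rw [Finset.sum_comm]
      simp only [this, Finset.sum_ite_eq, Finset.mem_univ, if_true]
    simp only [h2]
    rw [← Finset.sum_fiberwise Finset.univ Γ.src]
    refine Finset.sum_congr rfl fun v _ => ?_
    rw [← hG.sum_S_mul_star_S v, sum_minTmul]
    refine Finset.sum_congr rfl fun l hl => ?_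
    rw [(Finset.mem_filter.mp hl).2]

/-- The action `α : C^*(Γ) → C^*(Γ) ⊗ Q^aut_Ban(Γ)` determined by
`α (p i) = ∑ k, p k ⊗ u k i` and
`α (S j) = ∑ l, S l ⊗ u (s l) (s j) u (t l) (t j)`. -/
def action : Γ.CStar →⋆ₐ[ℂ] MinTensor Γ.CStar Γ.QAut :=
  Γ.graphRelations.lift (Sum.elim Γ.actionP Γ.actionS) Γ.isGraphFamily_action

theorem action_p (i : V) : Γ.action (Γ.p i) = ∑ k, minTmul (Γ.p k) (Γ.u k i) :=
  Γ.graphRelations.lift_gen _ _ _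

theorem action_S (j : Γ.Edge) : Γ.action (Γ.S j) =
    ∑ l, minTmul (Γ.S l) (Γ.u (Γ.src l) (Γ.src j) * Γ.u (Γ.tgt l) (Γ.tgt j)) :=
  Γ.graphRelations.lift_gen _ _ _

/-- The gauge action `γ_z (S e) = z S e`, `γ_z (p v) = p v` of the circle. -/
def gauge (z : Circle) : Γ.CStar →⋆ₐ[ℂ] Γ.CStar :=
  Γ.graphRelations.lift (Sum.elim Γ.p fun e => (z : ℂ) • Γ.S e)
    (by
      have hG := Γ.isGraphFamily
      have hz : star (z : ℂ) * z = 1 := by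
        rw [Complex.star_def, ← Circle.coe_inv_eq_conj, ← Circle.coe_mul, inv_mul_cancel,
          Circle.coe_one]
      refine ⟨hG.star_p, hG.p_mul_p, hG.sum_p, fun e => ?_, fun v => ?_⟩
      · simp only [Sum.elim_inr, Sum.elim_inl, star_smul, smul_mul_smul_comm, hz, one_smul,
          hG.star_S_mul_S]
      · simp only [Sum.elim_inr, Sum.elim_inl, star_smul, smul_mul_smul_comm, mul_comm (z : ℂ),
          hz, one_smul, hG.sum_S_mul_star_S])

theorem gauge_p (z : Circle) (v : V) : Γ.gauge z (Γ.p v) = Γ.p v :=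
  Γ.graphRelations.lift_gen (Sum.elim Γ.p fun e => (z : ℂ) • Γ.S e) _ (Sum.inl v)

theorem gauge_S (z : Circle) (e : Γ.Edge) : Γ.gauge z (Γ.S e) = (z : ℂ) • Γ.S e :=
  Γ.graphRelations.lift_gen (Sum.elim Γ.p fun e => (z : ℂ) • Γ.S e) _ (Sum.inr e)

/-- The dynamics `t ↦ γ_{e^{it}}` of the real line. -/
def dynamics (t : ℝ) : Γ.CStar →⋆ₐ[ℂ] Γ.CStar := Γ.gauge (Circle.exp t)

/-- The spectral radius `ρ(D)` of the vertex matrix. -/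
def vertexSpectralRadius : ℝ := (spectralRadius ℂ (Γ.vertexMatrix ℂ)).toReal

end Digraph

/-! ### KMS states and invariance -/

section States

open scoped ComplexOrder

variable {A Q : Type u} [CStarAlgebra A] [CStarAlgebra Q]

/-- States of a unital C⋆-algebra. -/
structure IsState (τ : A →L[ℂ] ℂ) : Prop where
  nonneg : ∀ a, 0 ≤ τ (star a * a)
  map_one : τ 1 = 1

/-- `f` is an extension of the orbit `t ↦ σ_t a` to an entire function, so that `a` is an analytic
element and `f z = σ_z a`. -/
structure IsEntireExtension (σ : ℝ → A →⋆ₐ[ℂ] A) (a : A) (f : ℂ → A) : Prop where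
  differentiable : Differentiable ℂ f
  eq_on_real : ∀ t : ℝ, f t = σ t a

/-- KMS states at inverse temperature `β`: the invariant states with `τ (a b) = τ (b σ_{iβ}(a))`
for all analytic elements `a`, `b`. (For `β ≠ 0` the invariance is automatic; for `β = 0` the
KMS states are, as usual, the invariant tracial states.) -/
structure IsKMS (σ : ℝ → A →⋆ₐ[ℂ] A) (β : ℝ) (τ : A →L[ℂ] ℂ) : Prop where
  isState : IsState τ
  invariant : ∀ t a, τ (σ t a) = τ a
  kms : ∀ (a b : A) (f g : ℂ → A), IsEntireExtension σ a f → IsEntireExtension σ b g →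
    τ (a * b) = τ (b * f (Complex.I * β))

/-- `α` preserves `τ`: `(τ ⊗ id) (α a) = τ(a) 1` for all `a`, where `E = τ ⊗ id` is the slice map,
the unique bounded linear map on the minimal tensor product with `E (a ⊗ q) = τ(a) q`. -/
def PreservesState (α : A →⋆ₐ[ℂ] MinTensor A Q) (τ : A →L[ℂ] ℂ) : Prop :=
  ∃ E : MinTensor A Q →L[ℂ] Q, (∀ a q, E (minTmul a q) = τ a • q) ∧
    ∀ a, E (α a) = τ a • (1 : Q)

end States

end

-- Write `r = e^β`. The KMS condition with `S_e` in the first slot says `φ(S_e a) = r⁻¹ φ(a S_e)`.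
-- With `p_v = ∑_{s(e)=v} S_e S_e^*` it makes `v ↦ φ(p_v)` a nonnegative, normalized eigenvector of
-- `D` with eigenvalue `r`. By Perron–Frobenius such a vector is unique and its eigenvalue is
-- `ρ(D)`, which fixes both `β` and the values on vertices. Invariance under the dynamics kills all
-- elements of nonzero degree, and on degree zero the scaling relation reduces `S_e a S_f^*` to
-- `p_{t(e)} a`, so the values on vertices determine `φ` (`eq_of_apply_p_eq`). Conversely, a state
-- which vanishes in nonzero degree and scales on the `S_e` is KMS: on the spanning elements `S_μ
-- p_v S_ν^*` the relation is accumulated factor by factor, and analytic continuation carries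
-- invariance to imaginary time (`isKMS_iff_isScalingState`).
--
-- Existence comes from two applications of Markov–Kakutani. Every `p_v` is nonzero, as a
-- representation on `ℓ²(V × ℕ)` shows, so some state takes the Perron weights `x_v` on the `p_v`.
-- Averaging under the dynamics at time 1 yields one that vanishes in nonzero degree. Averaging
-- under `a ↦ r⁻¹ ∑_e S_e^* a S_e` then yields one that scales; this map preserves the normalization
-- because `x` is an eigenvector.
--
-- For the quantum symmetry, `AD = DA` makes `y_i = ∑_k x_k u_{ki}` an eigenvector of `D` with
-- values in a Banach space. One-dimensionality of the eigenspace forces `y_i = x_i 1`, and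
-- multiplication by `u_{ki}` gives `x_k u_{ki} = x_i u_{ki}` (`smul_u`). With `E = τ ⊗ id`, the
-- invariance of `τ` is refined to one identity for each vertex `w`, `E((p_w ⊗ 1) α(a)) = ∑_i τ(p_i
-- a) u_{wi}`, and summed over `w` at the end. The refined form survives the passage from `a` to
-- `S_e a S_f^*`, so it propagates from the vertex projections, where it is `smul_u`, to the whole
-- algebra. The slice map itself is bounded on the minimal tensor product by a GNS argument
-- (`norm_algebraicSlice_le`).

universe u

/-! ### Perron–Frobenius theory for irreducible nonnegative matrices. -/

namespace Matrix

open scoped Matrix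

variable {V : Type*} [Fintype V] {M : Matrix V V ℝ}

/-- If `y j > 0` and `M i j > 0`, the eigenvalue equation at `i` gives `μ * y i ≥ M i j * y j > 0`.
Positivity thus travels backwards along edges, and irreducibility carries it everywhere. -/
theorem pos_of_nonneg_of_mulVec_eq_smul (hM : ∀ i j, 0 ≤ M i j)
    (hirr : ∀ v w, Relation.ReflTransGen (fun i j => 0 < M i j) v w) {y : V → ℝ} {μ : ℝ}
    (hy : ∀ v, 0 ≤ y v) (hne : y ≠ 0) (h : M *ᵥ y = μ • y) (v : V) : 0 < y v := by
  obtain ⟨w, hw⟩ := Function.ne_iff.mp hne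
  have hw : 0 < y w := (hy w).lt_of_ne' hw
  induction hirr v w using Relation.ReflTransGen.head_induction_on with
  | refl => exact hw
  | @head i j hij _ ih =>
    have h1 : M i j * y j ≤ μ * y i := by
      have := congrFun h i
      simp only [mulVec, dotProduct, Pi.smul_apply, smul_eq_mul] at this
      rw [← this]
      exact Finset.single_le_sum (f := fun j => M i j * y j)
        (fun j _ => mul_nonneg (hM i j) (hy j)) (Finset.mem_univ j)
    refine (hy i).lt_of_ne' fun h0 => ?_
    rw [h0, mul_zero] at h1
    exact (mul_pos hij ih).not_ge h1

/-- The summand `1` makes every coordinate nondecreasing in the exponent, so a coordinate once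
positive stays positive and the largest of the exponents found along paths serves all vertices.
Powers of `M` alone could fail by periodicity. -/
theorem exists_pos_one_add_pow_mulVec [DecidableEq V] (hM : ∀ i j, 0 ≤ M i j)
    (hirr : ∀ v w, Relation.ReflTransGen (fun i j => 0 < M i j) v w) {w : V → ℝ}
    (hw : ∀ v, 0 ≤ w v) (hne : w ≠ 0) : ∃ m : ℕ, ∀ v, 0 < (((1 + M) ^ m) *ᵥ w) v := by
  have hstep : ∀ m : ℕ, ((1 + M) ^ (m + 1)) *ᵥ w =
      ((1 + M) ^ m) *ᵥ w + M *ᵥ (((1 + M) ^ m) *ᵥ w) := fun m => by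
    rw [pow_succ', ← mulVec_mulVec, add_mulVec, one_mulVec]
  have hnn : ∀ m v, 0 ≤ (((1 + M) ^ m) *ᵥ w) v := by
    intro m
    induction m with
    | zero => simpa using hw
    | succ m ih =>
      intro v
      rw [hstep]
      exact add_nonneg (ih v) (Finset.sum_nonneg fun j _ => mul_nonneg (hM v j) (ih j))
  have hmono : ∀ v, Monotone fun m => (((1 + M) ^ m) *ᵥ w) v := fun v =>
    monotone_nat_of_le_succ fun m => by
      rw [hstep]
      exact le_add_of_nonneg_right (Finset.sum_nonneg fun j _ => mul_nonneg (hM v j) (hnn m j))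
  obtain ⟨u, hu⟩ := Function.ne_iff.mp hne
  have hu : 0 < w u := (hw u).lt_of_ne' hu
  have hex : ∀ v, ∃ m : ℕ, 0 < (((1 + M) ^ m) *ᵥ w) v := by
    intro v
    induction hirr v u using Relation.ReflTransGen.head_induction_on with
    | refl => exact ⟨0, by simpa using hu⟩
    | @head i j hij _ ih =>
      obtain ⟨m, hm⟩ := ih
      refine ⟨m + 1, ?_⟩
      rw [hstep]
      refine add_pos_of_nonneg_of_pos (hnn m i) ((mul_pos hij hm).trans_le ?_)
      exact Finset.single_le_sum (f := fun j => M i j * (((1 + M) ^ m) *ᵥ w) j)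
        (fun j _ => mul_nonneg (hM i j) (hnn m j)) (Finset.mem_univ j)
  choose m hm using hex
  exact ⟨Finset.univ.sup m, fun v => (hm v).trans_le (hmono v (Finset.le_sup (Finset.mem_univ v)))⟩

/-- Existence of the Perron–Frobenius eigenvector, with the Collatz–Wielandt maximality of its
eigenvalue. -/
theorem exists_perron_eigenvector [Nonempty V] (hM : ∀ i j, 0 ≤ M i j)
    (hirr : ∀ v w, Relation.ReflTransGen (fun i j => 0 < M i j) v w) :
    ∃ (x : V → ℝ) (r : ℝ), (∀ v, 0 < x v) ∧ ∑ v, x v = 1 ∧ M *ᵥ x = r • x ∧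
      ∀ (y : V → ℝ) (μ : ℝ), (∀ v, 0 ≤ y v) → y ≠ 0 → 0 ≤ μ →
        (∀ v, μ * y v ≤ (M *ᵥ y) v) → μ ≤ r := by
  classical
  set C : ℝ := ∑ i, ∑ j, M i j
  -- Summing `μ y ≤ M y` over the simplex bounds every admissible `μ`, which makes the set of
  -- admissible pairs below compact.
  have hC : ∀ y ∈ stdSimplex ℝ V, ∀ μ : ℝ, (∀ v, μ * y v ≤ (M *ᵥ y) v) → μ ≤ C := by
    intro y hy μ h
    calc μ = ∑ v, μ * y v := by rw [← Finset.mul_sum, hy.2, mul_one]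
      _ ≤ ∑ v, (M *ᵥ y) v := Finset.sum_le_sum fun v _ => h v
      _ ≤ C := Finset.sum_le_sum fun v _ => Finset.sum_le_sum fun j _ => by
        refine mul_le_of_le_one_right (hM v j) ?_
        rw [← hy.2]
        exact Finset.single_le_sum (fun j _ => hy.1 j) (Finset.mem_univ j)
  -- The Collatz–Wielandt value is maximized over pairs (vector, value); this avoids quotients by
  -- coordinates that may vanish.
  let K : Set ((V → ℝ) × ℝ) :=
    (stdSimplex ℝ V ×ˢ Set.Icc 0 C) ∩ {q | ∀ v, q.2 * q.1 v ≤ (M *ᵥ q.1) v}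
  have hKc : IsCompact K := by
    refine ((isCompact_stdSimplex ℝ V).prod isCompact_Icc).inter_right ?_
    simp only [Set.ofPred_forall]
    refine isClosed_iInter fun v => isClosed_le (by fun_prop) ?_
    simp only [mulVec, dotProduct]
    fun_prop
  obtain ⟨v₀⟩ := ‹Nonempty V›
  have hC0 : 0 ≤ C := Finset.sum_nonneg fun i _ => Finset.sum_nonneg fun j _ => hM i j
  have hKn : K.Nonempty := ⟨(Pi.single v₀ 1, 0), ⟨single_mem_stdSimplex ℝ v₀, le_rfl, hC0⟩,
    fun v => by
      simp only [zero_mul, mulVec, dotProduct]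
      exact Finset.sum_nonneg fun j _ => mul_nonneg (hM v j) ((single_mem_stdSimplex ℝ v₀).1 j)⟩
  obtain ⟨⟨x, r⟩, ⟨⟨hx, hr⟩, hxr⟩, hmax⟩ := hKc.exists_isMaxOn hKn continuous_snd.continuousOn
  have hmax' : ∀ (y : V → ℝ) (μ : ℝ), (∀ v, 0 ≤ y v) → y ≠ 0 → 0 ≤ μ →
        (∀ v, μ * y v ≤ (M *ᵥ y) v) → μ ≤ r := by
    intro y μ hy hne hμ h
    have hs : 0 < ∑ v, y v := by
      obtain ⟨u, hu⟩ := Function.ne_iff.mp hne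
      exact Finset.sum_pos' (fun v _ => hy v) ⟨u, Finset.mem_univ u, (hy u).lt_of_ne' hu⟩
    have hz : (∑ v, y v)⁻¹ • y ∈ stdSimplex ℝ V :=
      ⟨fun v => mul_nonneg (inv_nonneg.mpr hs.le) (hy v), by
        simp only [Pi.smul_apply, smul_eq_mul, ← Finset.mul_sum]
        exact inv_mul_cancel₀ hs.ne'⟩
    have hzM : ∀ v, μ * ((∑ v, y v)⁻¹ • y) v ≤ (M *ᵥ ((∑ v, y v)⁻¹ • y)) v := fun v => by
      rw [mulVec_smul, Pi.smul_apply, Pi.smul_apply, smul_eq_mul, smul_eq_mul, mul_left_comm]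
      exact mul_le_mul_of_nonneg_left (h v) (inv_nonneg.mpr hs.le)
    exact hmax (show ((∑ v, y v)⁻¹ • y, μ) ∈ K from ⟨⟨hz, hμ, hC _ hz μ hzM⟩, hzM⟩)
  have hxne : x ≠ 0 := fun h => by
    have := hx.2
    simp [h] at this
  -- The defect `w = M x - r x` is nonnegative. Were it nonzero, a power of `1 + M`, which commutes
  -- with `M`, would make both `x` and the defect strictly positive, leaving room to enlarge `r`.
  have heig : M *ᵥ x = r • x := by
    by_contra hcon
    set w : V → ℝ := M *ᵥ x - r • x
    obtain ⟨m, hm⟩ := exists_pos_one_add_pow_mulVec hM hirr (w := w)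
      (fun v => sub_nonneg.mpr (hxr v)) (sub_ne_zero.mpr hcon)
    obtain ⟨m', hm'⟩ := exists_pos_one_add_pow_mulVec hM hirr hx.1 hxne
    set y := ((1 + M) ^ (m + m')) *ᵥ x
    have hnn : ∀ (n : ℕ) (z : V → ℝ), (∀ v, 0 < z v) → ∀ v, 0 < (((1 + M) ^ n) *ᵥ z) v := by
      intro n z hz
      induction n with
      | zero => simpa using hz
      | succ n ih =>
        intro v
        rw [pow_succ', ← mulVec_mulVec, add_mulVec, one_mulVec]
        exact add_pos_of_pos_of_nonneg (ih v)
          (Finset.sum_nonneg fun j _ => mul_nonneg (hM v j) (ih j).le)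
    have hy : ∀ v, 0 < y v := fun v => by
      simp only [y, pow_add, ← mulVec_mulVec]; exact hnn _ _ hm' v
    have hyw : ∀ v, 0 < (M *ᵥ y - r • y) v := fun v => by
      have : M *ᵥ y - r • y = ((1 + M) ^ m') *ᵥ (((1 + M) ^ m) *ᵥ w) := by
        have hc : M * (1 + M) ^ (m + m') = (1 + M) ^ (m + m') * M :=
          ((Commute.one_right M).add_right (Commute.refl M)).pow_right _
        have he : (1 + M) ^ m' *ᵥ (((1 + M) ^ m) *ᵥ w) = (1 + M) ^ (m + m') *ᵥ w := by
          rw [mulVec_mulVec, ← pow_add, add_comm m']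
        rw [he]
        simp only [y, w, mulVec_sub, mulVec_mulVec, mulVec_smul, hc]
      rw [this]
      exact hnn _ _ hm v
    -- The smallest relative gain over all coordinates: `(r + ε) y ≤ M y` still holds, against
    -- maximality.
    let ε := Finset.univ.inf' ⟨v₀, Finset.mem_univ v₀⟩ fun v => (M *ᵥ y - r • y) v / y v
    have hε : 0 < ε := by
      exact (Finset.lt_inf'_iff _).mpr fun v _ => div_pos (hyw v) (hy v)
    have := hmax' y (r + ε) (fun v => (hy v).le) (fun h => (hy v₀).ne' (congrFun h v₀))
      (add_nonneg hr.1 hε.le) fun v => by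
        have h1 : ε ≤ (M *ᵥ y - r • y) v / y v := Finset.inf'_le _ (Finset.mem_univ v)
        rw [le_div_iff₀ (hy v), Pi.sub_apply, Pi.smul_apply, smul_eq_mul] at h1
        linarith
    linarith
  exact ⟨x, r, pos_of_nonneg_of_mulVec_eq_smul hM hirr hx.1 hxne heig, hx.2, heig, hmax'⟩

/-- A nonnegative eigenvector of an irreducible nonnegative matrix is proportional to a given
positive one, and has the same eigenvalue, provided that this eigenvalue is an upper bound. -/
theorem eq_smul_of_nonneg_eigenvector [Nonempty V] (hM : ∀ i j, 0 ≤ M i j)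
    (hirr : ∀ v w, Relation.ReflTransGen (fun i j => 0 < M i j) v w) {x y : V → ℝ} {r μ : ℝ}
    (hx : ∀ v, 0 < x v) (hxr : M *ᵥ x = r • x) (hy : ∀ v, 0 ≤ y v) (hne : y ≠ 0)
    (hyμ : M *ᵥ y = μ • y) (hle : μ ≤ r) : μ = r ∧ ∃ c : ℝ, y = c • x := by
  have hpos := pos_of_nonneg_of_mulVec_eq_smul hM hirr hy hne hyμ
  -- The minimal ratio `c` gives the largest multiple of `x` below `y`; the difference is
  -- nonnegative and vanishes at `i`.
  obtain ⟨i, -, hi⟩ := Finset.exists_min_image Finset.univ (fun v => y v / x v)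
    Finset.univ_nonempty
  set c := y i / x i
  have hci : y i = c * x i := (div_mul_cancel₀ _ (hx i).ne').symm
  have hc0 : 0 < c := div_pos (hpos i) (hx i)
  have hw : ∀ v, 0 ≤ (y - c • x) v := fun v => by
    have := (le_div_iff₀ (hx v)).mp (hi v (Finset.mem_univ v))
    simpa using this
  have hwM : M *ᵥ (y - c • x) = μ • y - (c * r) • x := by
    rw [mulVec_sub, mulVec_smul, hxr, hyμ, smul_smul]
  -- At `i`, where `y i = c * x i`, the nonnegative vector `M (y - c x)` equals `(μ - r) * y i`.
  have hge : r ≤ μ := by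
    have h1 : 0 ≤ (M *ᵥ (y - c • x)) i :=
      Finset.sum_nonneg fun j _ => mul_nonneg (hM i j) (hw j)
    rw [hwM] at h1
    simp only [Pi.sub_apply, Pi.smul_apply, smul_eq_mul] at h1
    have h2 : r * y i ≤ μ * y i := by rw [hci] at h1 ⊢; linarith
    exact le_of_mul_le_mul_right h2 (hpos i)
  have hμr := le_antisymm hle hge
  refine ⟨hμr, c, ?_⟩
  by_contra hcon
  -- A nonzero `y - c x` would be a nonnegative eigenvector, hence strictly positive, yet it
  -- vanishes at `i`.
  have := pos_of_nonneg_of_mulVec_eq_smul hM hirr hw (sub_ne_zero.mpr hcon) (μ := r) (by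
    rw [hwM, hμr, smul_sub, smul_smul, mul_comm c]) i
  simp [hci] at this

/-- Subtracting the right multiple of `x` makes an eigenvector of arbitrary sign nonnegative. This
form is needed for eigenvectors obtained by applying functionals to elements of the quantum group
algebra. -/
theorem exists_eq_smul_of_eigenvector [Nonempty V] (hM : ∀ i j, 0 ≤ M i j)
    (hirr : ∀ v w, Relation.ReflTransGen (fun i j => 0 < M i j) v w) {x : V → ℝ} {r : ℝ}
    (hx : ∀ v, 0 < x v) (hxr : M *ᵥ x = r • x) {y : V → ℝ} (hy : M *ᵥ y = r • y) :
    ∃ c : ℝ, y = c • x := by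
  obtain ⟨i, -, hi⟩ := Finset.exists_min_image Finset.univ (fun v => y v / x v)
    Finset.univ_nonempty
  set c := y i / x i
  by_cases h0 : y - c • x = 0
  · exact ⟨c, sub_eq_zero.mp h0⟩
  obtain ⟨-, d, hd⟩ := eq_smul_of_nonneg_eigenvector hM hirr hx hxr (y := y - c • x) (fun v => by
    have := (le_div_iff₀ (hx v)).mp (hi v (Finset.mem_univ v))
    simpa using this) h0 (by rw [mulVec_sub, mulVec_smul, hxr, hy, smul_sub, smul_comm]) le_rfl
  exact ⟨d + c, by rw [add_smul, ← hd, sub_add_cancel]⟩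

/-- The Perron–Frobenius eigenvalue is the spectral radius. -/
theorem spectralRadius_map_ofReal_of_maximal [DecidableEq V] [Nonempty V] (hM : ∀ i j, 0 ≤ M i j)
    {x : V → ℝ} {r : ℝ} (hx : ∀ v, 0 < x v) (hr : 0 ≤ r) (hxr : M *ᵥ x = r • x)
    (hmax : ∀ (y : V → ℝ) (μ : ℝ), (∀ v, 0 ≤ y v) → y ≠ 0 → 0 ≤ μ →
      (∀ v, μ * y v ≤ (M *ᵥ y) v) → μ ≤ r) :
    (spectralRadius ℂ (M.map ((↑) : ℝ → ℂ))).toReal = r := by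
  have hspec : ∀ z : ℂ, z ∈ spectrum ℂ (M.map ((↑) : ℝ → ℂ)) ↔
      ∃ y : V → ℂ, y ≠ 0 ∧ (M.map ((↑) : ℝ → ℂ)) *ᵥ y = z • y := fun z => by
    rw [← Matrix.spectrum_toLin', ← Module.End.hasEigenvalue_iff_mem_spectrum]
    constructor
    · intro h
      obtain ⟨y, hy⟩ := h.exists_hasEigenvector
      exact ⟨y, hy.2, by simpa using hy.apply_eq_smul⟩
    · rintro ⟨y, hy, h⟩
      exact Module.End.hasEigenvalue_of_hasEigenvector
        (Module.End.hasEigenvector_iff.mpr ⟨Module.End.mem_eigenspace_iff.mpr (by simpa using h), hy⟩)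
  have : spectralRadius ℂ (M.map ((↑) : ℝ → ℂ)) = ENNReal.ofReal r := by
    refine le_antisymm (iSup₂_le fun z hz => ?_) ?_
    · obtain ⟨y, hy, h⟩ := (hspec z).mp hz
      -- By the triangle inequality the vector of moduli satisfies `‖z‖ |y| ≤ M |y|`, so
      -- Collatz–Wielandt maximality applies to it.
      have hzr : ‖z‖ ≤ r := by
        refine hmax (fun v => ‖y v‖) ‖z‖ (fun v => norm_nonneg _) (fun h0 => hy ?_)
          (norm_nonneg _) fun v => ?_
        · ext v; simpa using congrFun h0 v
        · have h1 := congrArg norm (congrFun h v)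
          rw [Pi.smul_apply, smul_eq_mul, norm_mul] at h1
          rw [← h1]
          refine (norm_sum_le _ _).trans (Finset.sum_le_sum fun j _ => ?_)
          simp [abs_of_nonneg (hM v j)]
      rw [← enorm_eq_nnnorm, ← ofReal_norm]
      exact ENNReal.ofReal_le_ofReal hzr
    · have hmem : (r : ℂ) ∈ spectrum ℂ (M.map ((↑) : ℝ → ℂ)) := by
        refine (hspec _).mpr ⟨fun v => (x v : ℂ), fun h => ?_, ?_⟩
        · obtain ⟨v⟩ := ‹Nonempty V›
          exact (hx v).ne' (by simpa using congrFun h v)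
        · ext v
          have := congrArg ((↑) : ℝ → ℂ) (congrFun hxr v)
          simpa [mulVec, dotProduct] using this
      refine le_trans (le_of_eq ?_) (le_iSup₂ (f := fun k (_ : k ∈ spectrum ℂ
        (M.map ((↑) : ℝ → ℂ))) => (‖k‖₊ : ENNReal)) (r : ℂ) hmem)
      rw [← enorm_eq_nnnorm, ← ofReal_norm, Complex.norm_real, Real.norm_of_nonneg hr]
  rw [this, ENNReal.toReal_ofReal hr]

end Matrix

/-! ### States, norming states and the GNS representation. -/

section StateSpace

open scoped ComplexOrder

variable {A : Type u} [CStarAlgebra A]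

theorem isState_of_norm_le_one {f : A →L[ℂ] ℂ} (h1 : f 1 = 1) (hn : ‖f‖ ≤ 1) : IsState f := by
  refine ⟨fun b => ?_, h1⟩
  have : Nontrivial A := ⟨1, 0, fun h => by simp [h] at h1⟩
  let _ := CStarAlgebra.spectralOrder A
  have _ := CStarAlgebra.spectralOrderedRing A
  set a := star b * b
  have ha : 0 ≤ a := star_mul_self_nonneg b
  have hsa : star a = a := (IsSelfAdjoint.of_nonneg ha).star_eq
  have hle : ∀ x, ‖f x‖ ≤ ‖x‖ := fun x =>
    (f.le_of_opNorm_le hn x).trans_eq (one_mul _)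
  have him : (f a).im = 0 := by
    -- Since `a` is self-adjoint, `‖a + it‖² ≤ ‖a‖² + t²`; a nonzero imaginary part of `f a` would
    -- add a term linear in `t`.
    have key : ∀ t : ℝ, ((f a).im + t) ^ 2 ≤ ‖a‖ ^ 2 + t ^ 2 := fun t => by
      have h2 : ‖a + algebraMap ℂ A (Complex.I * t)‖ ^ 2 ≤ ‖a‖ ^ 2 + t ^ 2 := by
        rw [sq, ← CStarRing.norm_star_mul_self]
        have : star (a + algebraMap ℂ A (Complex.I * t)) * (a + algebraMap ℂ A (Complex.I * t)) =
            a * a + algebraMap ℂ A ((t : ℂ) ^ 2) := by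
          have hI : (starRingEnd ℂ) (Complex.I * t) = -(Complex.I * t) := by simp
          rw [star_add, hsa, ← algebraMap_star_comm, Complex.star_def, hI, map_neg, add_mul,
            mul_add, mul_add, neg_mul, neg_mul, ← map_mul, Algebra.commutes]
          have : Complex.I * t * (Complex.I * t) = -((t : ℂ) ^ 2) := by
            rw [mul_mul_mul_comm, Complex.I_mul_I]; ring
          rw [this, map_neg]
          abel
        rw [this]
        refine (norm_add_le _ _).trans (add_le_add ((norm_mul_le _ _).trans_eq (sq _).symm) ?_)
        rw [norm_algebraMap', norm_pow, Complex.norm_real, Real.norm_eq_abs, sq_abs]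
      have h3 : f (a + algebraMap ℂ A (Complex.I * t)) = f a + Complex.I * t := by
        rw [map_add, Algebra.algebraMap_eq_smul_one, map_smul, h1, smul_eq_mul, mul_one]
      have h4 : |(f a).im + t| ≤ ‖a + algebraMap ℂ A (Complex.I * t)‖ := by
        refine le_trans ?_ (hle _)
        rw [h3]
        refine le_trans (le_of_eq ?_) (Complex.abs_im_le_norm _)
        simp
      rw [← sq_abs]
      exact (pow_le_pow_left₀ (abs_nonneg _) h4 2).trans h2
    by_contra hne
    -- This `t` makes the cross term `2 t Im (f a)` equal to `‖a‖² + 1`, more than the bound allows.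
    have := key ((‖a‖ ^ 2 + 1) / (2 * (f a).im))
    have h5 : 2 * (f a).im * ((‖a‖ ^ 2 + 1) / (2 * (f a).im)) = ‖a‖ ^ 2 + 1 := by
      field_simp
    nlinarith [sq_nonneg (f a).im]
  have hre : 0 ≤ (f a).re := by
    -- From `0 ≤ ‖a‖ - a ≤ ‖a‖` and contractivity, `‖a‖ - Re (f a) ≤ ‖a‖`.
    have h2 : ‖algebraMap ℝ A ‖a‖ - a‖ ≤ ‖a‖ := by
      refine (CStarAlgebra.norm_le_norm_of_nonneg_of_le (a := algebraMap ℝ A ‖a‖ - a)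
        (b := algebraMap ℝ A ‖a‖) ?_ ?_).trans_eq ?_
      · exact sub_nonneg.mpr (IsSelfAdjoint.le_algebraMap_norm_self (IsSelfAdjoint.of_nonneg ha))
      · exact sub_le_self _ ha
      · rw [norm_algebraMap', norm_norm]
    have h3 : f (algebraMap ℝ A ‖a‖ - a) = ‖a‖ - f a := by
      have : algebraMap ℝ A ‖a‖ = (‖a‖ : ℂ) • (1 : A) := by
        rw [Algebra.algebraMap_eq_smul_one, Complex.coe_smul]
      rw [map_sub, this, map_smul, h1, smul_eq_mul, mul_one]
    have h4 := (Complex.abs_re_le_norm _).trans ((hle (algebraMap ℝ A ‖a‖ - a)).trans h2)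
    rw [h3, Complex.sub_re, Complex.ofReal_re] at h4
    linarith [(abs_le.mp h4).2]
  exact Complex.le_def.mpr ⟨by simpa using hre, by simpa using him.symm⟩

/-- For `a = b^* b` positive, `‖1 + a‖ = 1 + ‖a‖`. A norm-one functional attaining the norm of `1 +
a` must attain the norms of `1` and `a` separately, so it is a unital contraction, hence a state. -/
theorem exists_isState_apply_star_mul_self [Nontrivial A] (b : A) :
    ∃ f : A →L[ℂ] ℂ, IsState f ∧ f (star b * b) = (‖b‖ ^ 2 : ℝ) := by
  let _ := CStarAlgebra.spectralOrder A
  have _ := CStarAlgebra.spectralOrderedRing A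
  set a := star b * b with hab
  have ha : 0 ≤ a := star_mul_self_nonneg b
  have hnorm : ‖1 + a‖ = 1 + ‖a‖ := by
    refine le_antisymm ((norm_add_le _ _).trans_eq (by rw [norm_one])) ?_
    have h1 := CStarAlgebra.norm_mem_spectrum_of_nonneg ha
    have h2 : 1 + ‖a‖ ∈ spectrum ℝ (1 + a) := by
      simpa [add_comm] using (spectrum.add_mem_add_iff (s := (1 : ℝ))).mpr h1
    exact (le_abs_self _).trans (spectrum.norm_le_norm_of_mem h2)
  obtain ⟨g, hg, hgx⟩ := exists_dual_vector ℂ (1 + a) (by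
    intro h
    rw [h] at hnorm
    linarith [norm_nonneg a])
  have hle : ∀ x, ‖g x‖ ≤ ‖x‖ := fun x => (g.le_of_opNorm_le hg.le x).trans_eq (one_mul _)
  rw [map_add, hnorm] at hgx
  have h1 := hle 1
  rw [norm_one] at h1
  have h2 := hle a
  have hre := congrArg Complex.re hgx
  have him := congrArg Complex.im hgx
  simp only [Complex.add_re, Complex.coe_algebraMap, Complex.ofReal_re] at hre
  have h3 := Complex.re_le_norm (g 1)
  have h4 := Complex.re_le_norm (g a)
  have h5 : (g 1).re = 1 := by linarith
  have h6 : g 1 = 1 := by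
    have h7 : ‖g 1‖ ^ 2 ≤ 1 := pow_le_one₀ (norm_nonneg _) h1
    rw [Complex.sq_norm, Complex.normSq_apply, h5] at h7
    have h8 : (g 1).im = 0 := by nlinarith [mul_self_nonneg (g 1).im]
    exact Complex.ext h5 h8
  refine ⟨g, isState_of_norm_le_one h6 hg.le, ?_⟩
  rw [h6] at hgx
  have : g a = ‖a‖ := by
    have := add_left_cancel (hgx.trans (by push_cast; rfl : _ = (1 : ℂ) + ‖a‖))
    exact this
  rw [this, hab, CStarRing.norm_star_mul_self, sq]

/-- The GNS construction; the vector is the class of `1`. -/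
theorem IsState.exists_rep {τ : A →L[ℂ] ℂ} (h : IsState τ) :
    ∃ (p : HilbertRep A) (ξ : p.H), ‖ξ‖ = 1 ∧
      ∀ a b, inner ℂ (p.π a ξ) (p.π b ξ) = τ (star a * b) := by
  let _ := CStarAlgebra.spectralOrder A
  have _ := CStarAlgebra.spectralOrderedRing A
  let f : A →ₚ[ℂ] ℂ := PositiveLinearMap.mk₀ (τ : A →ₗ[ℂ] ℂ) fun a ha => by
    obtain ⟨b, rfl⟩ := CStarAlgebra.nonneg_iff_eq_star_mul_self.mp ha
    exact h.nonneg b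
  have hinner : ∀ a b : A, inner ℂ ((f.toPreGNS a : f.PreGNS) : f.GNS) ((f.toPreGNS b : f.PreGNS) : f.GNS) =
      τ (star a * b) := fun a b => by
    rw [UniformSpace.Completion.inner_coe, PositiveLinearMap.preGNS_inner_def]
    rfl
  have happ : ∀ a : A, f.gnsStarAlgHom a ((f.toPreGNS 1 : f.PreGNS) : f.GNS) =
      ((f.toPreGNS a : f.PreGNS) : f.GNS) := fun a => by
    refine (PositiveLinearMap.gnsNonUnitalStarAlgHom_apply_coe (f := f)).trans ?_
    rw [PositiveLinearMap.leftMulMapPreGNS_apply]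
    simp
  refine ⟨{ H := f.GNS, π := f.gnsStarAlgHom }, ((f.toPreGNS 1 : f.PreGNS) : f.GNS), ?_,
    fun a b => ?_⟩
  · have h1 := hinner 1 1
    rw [star_one, one_mul, h.map_one] at h1
    have h2 := inner_self_eq_norm_sq (𝕜 := ℂ) ((f.toPreGNS 1 : f.PreGNS) : f.GNS)
    rw [h1, RCLike.one_re] at h2
    exact (pow_eq_one_iff_of_nonneg (norm_nonneg _) two_ne_zero).mp h2.symm
  · change inner ℂ (f.gnsStarAlgHom a _) (f.gnsStarAlgHom b _) = _
    rw [happ, happ, hinner]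

theorem IsState.norm_apply_le {τ : A →L[ℂ] ℂ} (h : IsState τ) (a : A) : ‖τ a‖ ≤ ‖a‖ := by
  obtain ⟨p, ξ, hξ, hp⟩ := h.exists_rep
  have h1 := hp 1 a
  rw [star_one, one_mul, show p.π 1 = 1 from _root_.map_one p.π, one_apply_eq_self] at h1
  rw [← h1]
  refine (norm_inner_le_norm _ _).trans ?_
  rw [hξ, one_mul]
  refine ((p.π a).le_opNorm ξ).trans ?_
  rw [hξ, mul_one]
  exact NonUnitalStarAlgHom.norm_apply_le _ a

theorem IsState.map_star {τ : A →L[ℂ] ℂ} (h : IsState τ) (a : A) :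
    τ (star a) = star (τ a) := by
  obtain ⟨p, ξ, -, hp⟩ := h.exists_rep
  have h1 := hp a 1
  rw [mul_one] at h1
  rw [← h1, ← one_mul a, ← star_one, ← hp, Complex.star_def, inner_conj_symm, star_one, one_mul]

end StateSpace

/-! ### Slice maps on the minimal tensor product. -/

section SliceMap

open scoped TensorProduct ComplexOrder

variable {A B : Type u} [CStarAlgebra A] [CStarAlgebra B]

/-- The slice map `τ ⊗ id` on the algebraic tensor product. -/
noncomputable def algebraicSlice (τ : A →L[ℂ] ℂ) : A ⊗[ℂ] B →ₗ[ℂ] B :=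
  TensorProduct.lift ((LinearMap.lsmul ℂ B).comp (τ : A →ₗ[ℂ] ℂ))

theorem algebraicSlice_tmul (τ : A →L[ℂ] ℂ) (a : A) (b : B) :
    algebraicSlice τ (a ⊗ₜ[ℂ] b) = τ a • b := rfl

/-- The vector functional of `ξ` on the first leg is `τ`, so fixing `ξ` there turns matrix
coefficients of `p ⊗ q` into those of the slice. -/
theorem inner_hmk_tensorRep (p : HilbertRep A) (q : HilbertRep B) {τ : A →L[ℂ] ℂ} {ξ : p.H}
    (hξ : ∀ a, inner ℂ ξ (p.π a ξ) = τ a) (η η' : q.H) (x : A ⊗[ℂ] B) :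
    inner ℂ (hmk (ξ ⊗ₜ[ℂ] η')) (tensorRep p q x (hmk (ξ ⊗ₜ[ℂ] η))) =
      inner ℂ η' (q.π (algebraicSlice τ x) η) := by
  induction x with
  | zero => simp
  | add x y hx hy =>
    rw [map_add, map_add, map_add, add_apply, add_apply, inner_add_right, inner_add_right, hx, hy]
  | tmul a b =>
    rw [tensorRep_tmul, opTensor_coe, inner_hmk, algebraicSlice_tmul, map_smul, smul_apply,
      inner_smul_right, ← hξ]
    simp

/-- For the slice `b` of `x`, the GNS space of a state attaining `‖b‖²` at `b^* b` contains a unit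
vector `η` with `‖q(b) η‖ = ‖b‖`. The coefficient of `(p ⊗ q)(x)` between `ξ ⊗ η` and `ξ ⊗ q(b) η`
is `‖b‖²`, and Cauchy–Schwarz bounds it by `‖b‖` times the spatial norm. -/
theorem norm_algebraicSlice_le {τ : A →L[ℂ] ℂ} (h : IsState τ) (x : A ⊗[ℂ] B) :
    ‖algebraicSlice τ x‖ ≤ (spatialFamily A B).seminorm x := by
  rcases subsingleton_or_nontrivial B with hB | hB
  · rw [Subsingleton.elim (algebraicSlice τ x) 0, norm_zero]
    exact StarHomFamily.seminorm_nonneg _ _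
  obtain ⟨p, ξ, hξ, hp⟩ := h.exists_rep
  set b := algebraicSlice τ x
  obtain ⟨f, hf, hfb⟩ := exists_isState_apply_star_mul_self b
  obtain ⟨q, η, hη, hq⟩ := hf.exists_rep
  have hτ : ∀ a, inner ℂ ξ (p.π a ξ) = τ a := fun a => by
    have := hp 1 a
    rwa [star_one, one_mul, show p.π 1 = 1 from map_one p.π, one_apply_eq_self] at this
  have key := inner_hmk_tensorRep p q hτ η (q.π b η) x
  have hnorm : ‖q.π b η‖ = ‖b‖ := by
    have h1 := inner_self_eq_norm_sq (𝕜 := ℂ) (q.π b η)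
    rw [hq, hfb] at h1
    have h2 : ‖b‖ ^ 2 = ‖q.π b η‖ ^ 2 := by rw [← h1]; exact (Complex.ofReal_re _).symm
    exact ((pow_left_inj₀ (norm_nonneg _) (norm_nonneg _) two_ne_zero).mp h2).symm
  have h1 : ‖b‖ ^ 2 ≤ ‖b‖ * (spatialFamily A B).seminorm x := by
    calc ‖b‖ ^ 2 = ‖(inner ℂ (q.π b η) (q.π b η) : ℂ)‖ := by
          rw [hq, hfb, Complex.norm_real, Real.norm_of_nonneg (by positivity)]
      _ ≤ ‖hmk (ξ ⊗ₜ[ℂ] (q.π b η))‖ * ‖tensorRep p q x (hmk (ξ ⊗ₜ[ℂ] η))‖ := by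
          rw [← key]; exact norm_inner_le_norm _ _
      _ ≤ ‖b‖ * (‖tensorRep p q x‖ * 1) := by
          rw [norm_hmk, TensorProduct.norm_tmul, hξ, one_mul, hnorm]
          refine mul_le_mul_of_nonneg_left ?_ (norm_nonneg _)
          refine ((tensorRep p q x).le_opNorm _).trans_eq ?_
          rw [norm_hmk, TensorProduct.norm_tmul, hξ, hη, one_mul]
      _ ≤ ‖b‖ * (spatialFamily A B).seminorm x := by
          rw [mul_one]
          exact mul_le_mul_of_nonneg_left ((spatialFamily A B).le_seminorm (p, q) x)
            (norm_nonneg _)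
  rcases (norm_nonneg b).eq_or_lt with h0 | h0
  · rw [← h0]; exact StarHomFamily.seminorm_nonneg _ _
  · rw [sq] at h1; exact le_of_mul_le_mul_left h1 h0

/-- The slice map `τ ⊗ id` of a state is bounded for the minimal tensor product. -/
theorem exists_sliceMap {τ : A →L[ℂ] ℂ} (h : IsState τ) :
    ∃ E : MinTensor A B →L[ℂ] B, ∀ a b, E (minTmul a b) = τ a • b := by
  let F := spatialFamily A B
  let f : F.Pre →L[ℂ] B := LinearMap.mkContinuous
    ((algebraicSlice τ).comp (F.toPre.symm.toAlgEquiv.toLinearMap)) 1 fun x => by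
      rw [one_mul]; exact norm_algebraicSlice_le h _
  let e : F.Pre →L[ℂ] UniformSpace.Completion F.Pre := UniformSpace.Completion.toComplL
  have he : DenseRange e := UniformSpace.Completion.denseRange_coe
  have hi : IsUniformInducing e := UniformSpace.Completion.isUniformInducing_coe F.Pre
  exact ⟨f.extend e, fun a b => f.extend_eq he hi (F.toPre (a ⊗ₜ[ℂ] b))⟩

end SliceMap

/-! ### Invariant functionals from Cesàro means. -/

section FixedPoint

open Filter Topology

variable {A : Type*} [NormedAddCommGroup A] [NormedSpace ℂ A]

/-- A Markov–Kakutani fixed point theorem: a bounded convex set of functionals which is closed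
under pointwise limits and invariant under composition with `T` contains a `T`-invariant one. -/
theorem exists_invariant_functional (K : Set (A →L[ℂ] ℂ)) (hne : K.Nonempty)
    (hbdd : ∀ φ ∈ K, ∀ a, ‖φ a‖ ≤ ‖a‖)
    (hmean : ∀ (n : ℕ) (φ : ℕ → A →L[ℂ] ℂ), (∀ i, φ i ∈ K) →
      ((n : ℂ) + 1)⁻¹ • ∑ i ∈ Finset.range (n + 1), φ i ∈ K)
    (hclosed : ∀ (l : Filter ℕ) [l.NeBot] (φ : ℕ → A →L[ℂ] ℂ) (ψ : A →L[ℂ] ℂ),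
      (∀ i, φ i ∈ K) → (∀ a, Tendsto (fun n => φ n a) l (𝓝 (ψ a))) → ψ ∈ K)
    (T : A →L[ℂ] A) (hT : ∀ φ ∈ K, φ.comp T ∈ K) : ∃ φ ∈ K, ∀ a, φ (T a) = φ a := by
  obtain ⟨φ₀, h₀⟩ := hne
  let φ : ℕ → A →L[ℂ] ℂ := fun i => (fun φ => φ.comp T)^[i] φ₀
  have hφ : ∀ i, φ i ∈ K := fun i => by
    induction i with
    | zero => exact h₀
    | succ i ih =>
      have := hT _ ih
      rwa [← Function.iterate_succ_apply' (fun φ : A →L[ℂ] ℂ => φ.comp T)] at this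
  have hφT : ∀ i a, φ i (T a) = φ (i + 1) a := fun i a => by
    simp only [φ, Function.iterate_succ_apply']; rfl
  let ψ : ℕ → A →L[ℂ] ℂ := fun n => ((n : ℂ) + 1)⁻¹ • ∑ i ∈ Finset.range (n + 1), φ i
  have hψ : ∀ n, ψ n ∈ K := fun n => hmean n φ hφ
  -- Limits along a free ultrafilter exist for every bounded scalar sequence and replace weak-*
  -- compactness.
  let U : Ultrafilter ℕ := Filter.hyperfilter ℕ
  have hlim : ∀ a, ∃ z : ℂ, Tendsto (fun n : ℕ => ψ n a) U (𝓝 z) := fun a => by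
    obtain ⟨z, -, hz⟩ := (isCompact_closedBall (0 : ℂ) ‖a‖).ultrafilter_le_nhds
      (U.map fun n : ℕ => ψ n a) (le_principal_iff.mpr (Filter.mem_map.mpr (Filter.Eventually.of_forall fun n => by
        simpa using hbdd _ (hψ n) a)))
    exact ⟨z, hz⟩
  choose L hL using hlim
  let Ψ : A →L[ℂ] ℂ := LinearMap.mkContinuous
    { toFun := L
      map_add' := fun a b => tendsto_nhds_unique (hL (a + b)) (by
        simpa only [map_add] using (hL a).add (hL b))
      map_smul' := fun c a => tendsto_nhds_unique (hL (c • a)) (by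
        simpa only [map_smul, RingHom.id_apply] using (hL a).const_smul c) } 1 fun a => by
    rw [one_mul]
    exact le_of_tendsto (hL a).norm (Filter.Eventually.of_forall fun n => hbdd _ (hψ n) a)
  refine ⟨Ψ, hclosed U ψ Ψ hψ hL, fun a => ?_⟩
  have h1 : Tendsto (fun n => ψ n (T a) - ψ n a) U (𝓝 (L (T a) - L a)) := (hL _).sub (hL _)
  have h2 : Tendsto (fun n => ψ n (T a) - ψ n a) U (𝓝 0) := by
    have hle : (U : Filter ℕ) ≤ atTop := by
      rw [← Nat.cofinite_eq_atTop]; exact Filter.hyperfilter_le_cofinite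
    refine Tendsto.mono_left ?_ hle
    have hb : Tendsto (fun n : ℕ => 2 * ‖a‖ * (1 / ((n : ℝ) + 1))) atTop (𝓝 0) := by
      simpa using tendsto_one_div_add_atTop_nhds_zero_nat.const_mul (2 * ‖a‖)
    refine squeeze_zero_norm (fun n => ?_) hb
    -- The difference telescopes: only the two extreme terms of the orbit remain, divided by `n +
    -- 1`.
    have h3 : ψ n (T a) - ψ n a = ((n : ℂ) + 1)⁻¹ * (φ (n + 1) a - φ 0 a) := by
      simp only [ψ, smul_apply, _root_.sum_apply, hφT, smul_eq_mul, ← mul_sub,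
        ← Finset.sum_sub_distrib]
      rw [Finset.sum_range_sub (fun i => φ i a)]
    have h4 : ‖((n : ℂ) + 1)⁻¹‖ = 1 / ((n : ℝ) + 1) := by
      rw [norm_inv, one_div]
      congr 1
      exact_mod_cast Complex.norm_natCast (n + 1)
    rw [h3, norm_mul, h4, mul_comm]
    refine mul_le_mul_of_nonneg_right ((norm_sub_le _ _).trans ?_) (by positivity)
    linarith [hbdd _ (hφ (n + 1)) a, hbdd _ (hφ 0) a]
  exact sub_eq_zero.mp (tendsto_nhds_unique h1 h2)

end FixedPoint

/-! ### Partial isometries of `ℓ²` from partial bijections. -/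

namespace PEquiv

open scoped ENNReal lp

variable {α : Type u}

/-- Each `b` has at most one preimage under `f`, so no value `g b` is counted twice. -/
theorem sum_option_elim_le (f : α ≃. α) (g : α → ℝ) (hg : ∀ a, 0 ≤ g a) (s : Finset α) :
    ∃ t : Finset α, ∑ a ∈ s, (f a).elim 0 g ≤ ∑ b ∈ t, g b := by
  classical
  refine ⟨s.biUnion fun a => (f a).toFinset, ?_⟩
  have h : ∀ a ∈ s, (f a).elim 0 g =
      ∑ b ∈ s.biUnion fun a => (f a).toFinset, if f a = some b then g b else 0 := fun a ha => by
    cases hfa : f a with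
    | none => simp
    | some c =>
      have hc : c ∈ s.biUnion fun a => (f a).toFinset :=
        Finset.mem_biUnion.mpr ⟨a, ha, by simp [hfa]⟩
      simp only [Option.elim_some, Option.some.injEq, Finset.sum_ite_eq, hc, if_true]
  rw [Finset.sum_congr rfl h, Finset.sum_comm]
  refine Finset.sum_le_sum fun b _ => ?_
  have h' : ∀ a, (f a = some b) ↔ f.symm b = some a := fun a => (f.eq_some_iff).symm
  simp only [h']
  cases f.symm b with
  | none => simpa using hg b
  | some c =>
    simp only [Option.some.injEq, Finset.sum_ite_eq]
    split_ifs
    · exact le_rfl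
    · exact hg b

theorem sum_norm_option_elim_le (f : α ≃. α) (g : lp (fun _ : α => ℂ) 2) (s : Finset α) :
    ∑ a ∈ s, ‖(f a).elim 0 g‖ ^ (2 : ℝ≥0∞).toReal ≤ ‖g‖ ^ (2 : ℝ≥0∞).toReal := by
  obtain ⟨t, ht⟩ := f.sum_option_elim_le (fun b => ‖g b‖ ^ (2 : ℝ≥0∞).toReal)
    (fun b => by positivity) s
  refine le_trans (le_of_eq (Finset.sum_congr rfl fun a _ => ?_))
    (ht.trans (lp.sum_rpow_le_norm_rpow (by norm_num) g t))
  cases f a <;> simp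

/-- The partial isometry of `ℓ²` defined by a partial bijection of the index set. -/
noncomputable def l2Op (f : α ≃. α) : lp (fun _ : α => ℂ) 2 →L[ℂ] lp (fun _ : α => ℂ) 2 :=
  LinearMap.mkContinuous
    -- The operator pulls functions back along `f`: the basis vector at `b` goes to the one at
    -- `f.symm b`, or to `0`.
    { toFun := fun g => ⟨fun a => (f a).elim 0 g, memℓp_gen' (f.sum_norm_option_elim_le g)⟩
      map_add' := fun g h => by
        ext a
        change ((f a).elim 0 ⇑(g + h) : ℂ) = (f a).elim 0 ⇑g + (f a).elim 0 ⇑h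
        cases f a
        · exact (add_zero 0).symm
        · rfl
      map_smul' := fun c g => by
        ext a
        change ((f a).elim 0 ⇑(c • g) : ℂ) = c • (f a).elim 0 ⇑g
        cases f a <;> simp } 1 fun g => by
    rw [one_mul]
    exact lp.norm_le_of_forall_sum_le (by norm_num) (norm_nonneg _) (f.sum_norm_option_elim_le g)

theorem l2Op_apply (f : α ≃. α) (g : lp (fun _ : α => ℂ) 2) (a : α) :
    f.l2Op g a = (f a).elim 0 g := rfl

theorem l2Op_mul (f g : α ≃. α) : f.l2Op * g.l2Op = (f.trans g).l2Op := by
  ext x a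
  rw [mul_apply_eq_comp, l2Op_apply, l2Op_apply]
  change _ = ((f a).bind g).elim 0 x
  cases f a with
  | none => rfl
  | some b => exact l2Op_apply g x b

theorem star_l2Op (f : α ≃. α) : star f.l2Op = f.symm.l2Op := by
  classical
  refine lp.ext_continuousLinearMap (by norm_num) fun i => ?_
  ext j
  simp only [ContinuousLinearMap.comp_apply, lp.singleContinuousLinearMap_apply]
  have h1 := lp.inner_single_left (𝕜 := ℂ) j (1 : ℂ) (star f.l2Op (lp.single 2 i (1 : ℂ)))
  rw [ContinuousLinearMap.star_eq_adjoint, ContinuousLinearMap.adjoint_inner_right,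
    lp.inner_single_right] at h1
  simp only [RCLike.inner_apply, one_mul, map_one, mul_one] at h1
  rw [ContinuousLinearMap.star_eq_adjoint, ← h1, l2Op_apply, l2Op_apply]
  have h2 : (f i).elim 0 (lp.single 2 j (1 : ℂ)) = if f i = some j then 1 else 0 := by
    cases f i with
    | none => simp
    | some k => simp [lp.coeFn_single, Pi.single_apply]
  have h3 : (f.symm j).elim 0 (lp.single 2 i (1 : ℂ)) = if f.symm j = some i then 1 else 0 := by
    cases f.symm j with
    | none => simp
    | some k => simp [lp.coeFn_single, Pi.single_apply]
  rw [h2, h3]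
  simp only [f.eq_some_iff]
  split_ifs <;> simp

end PEquiv

/-! ### A concrete graph family with nonzero vertex projections. -/

namespace Digraph

open scoped Matrix ENNReal

variable {V : Type u} (Γ : Digraph V)

/-- Without sinks, each fibre of the source map is nonempty, so its product with `ℕ` is countably
infinite and can be matched with `{v} × ℕ`. The range projections of the edges leaving `v` then fill
the space at `v` exactly. -/
theorem exists_edge_prod_equiv [Countable V] (h : Γ.NoSinks) :
    ∃ Ψ : Γ.Edge × ℕ ≃ V × ℕ, ∀ a, Γ.src (Ψ.symm a).1 = a.1 := by
  have hψ : ∀ v, Nonempty ({e // Γ.src e = v} × ℕ ≃ ℕ) := fun v => by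
    obtain ⟨e, he⟩ := h v
    have : Nonempty {e // Γ.src e = v} := ⟨⟨e, he⟩⟩
    exact nonempty_equiv_of_countable
  let ψ := fun v => (hψ v).some
  have aux : ∀ v (y : {e // Γ.src e = v} × ℕ),
      (Γ.src y.1.1, ψ (Γ.src y.1.1) (⟨y.1.1, rfl⟩, y.2)) = (v, ψ v y) := by
    rintro v ⟨⟨e, rfl⟩, m⟩
    rfl
  refine ⟨{ toFun := fun x => (Γ.src x.1, ψ (Γ.src x.1) (⟨x.1, rfl⟩, x.2))
            invFun := fun a => (((ψ a.1).symm a.2).1.1, ((ψ a.1).symm a.2).2)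
            left_inv := fun x => by simp
            right_inv := fun a => (aux a.1 ((ψ a.1).symm a.2)).trans (by simp) },
    fun a => ((ψ a.1).symm a.2).1.2⟩

variable [Fintype V] [DecidableEq V] [DecidableRel Γ.Adj]

/-- On `ℓ²(V × ℕ)`, let `S_e` send the basis vector at `(t(e), m)` to the one at `Ψ(e, m)`, and let
`p_v` be the projection onto `{v} × ℕ`. This is a graph family in which every vertex projection is
visibly nonzero. -/
theorem p_ne_zero (h : Γ.NoSinks) (v : V) : Γ.p v ≠ 0 := by
  obtain ⟨Ψ, hΨ⟩ := Γ.exists_edge_prod_equiv h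
  let s : Γ.Edge → (V × ℕ ≃. V × ℕ) := fun e =>
    { toFun := fun a => if (Ψ.symm a).1 = e then some (Γ.tgt e, (Ψ.symm a).2) else none
      invFun := fun b => if b.1 = Γ.tgt e then some (Ψ (e, b.2)) else none
      inv := fun a b => by
        constructor
        · intro hb
          split_ifs at hb with h1
          · obtain rfl := Option.some.inj hb
            simp [← h1]
        · intro ha
          split_ifs at ha with h1
          · obtain rfl := Option.some.inj ha
            simp [← h1] }
  have hs : ∀ e a, s e a = if (Ψ.symm a).1 = e then some (Γ.tgt e, (Ψ.symm a).2) else none :=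
    fun _ _ => rfl
  have hs' : ∀ e b, (s e).symm b = if b.1 = Γ.tgt e then some (Ψ (e, b.2)) else none :=
    fun _ _ => rfl
  let q : V → (V × ℕ ≃. V × ℕ) := fun v => PEquiv.ofSet {a | a.1 = v}
  have hq : ∀ v a, q v a = if a.1 = v then some a else none := fun _ _ => rfl
  have hfam : Γ.IsGraphFamily (fun v => (q v).l2Op) (fun e => (s e).l2Op) := by
    refine ⟨fun v => ?_, fun v w => ?_, ?_, fun e => ?_, fun v => ?_⟩
    · rw [PEquiv.star_l2Op, PEquiv.ofSet_symm]
    · rw [PEquiv.l2Op_mul]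
      ext g a
      rw [PEquiv.l2Op_apply]
      change ((q v a).bind (q w)).elim 0 g = _
      split_ifs with hvw
      · subst hvw
        rw [PEquiv.l2Op_apply, hq]
        split_ifs with h1 <;> simp [hq, h1]
      · rw [hq]
        split_ifs with h1
        · simp [hq, h1, hvw]
        · simp
    · ext g a
      rw [_root_.sum_apply, lp.coeFn_sum, Finset.sum_apply]
      simp only [PEquiv.l2Op_apply, hq, apply_ite (fun o : Option (V × ℕ) => o.elim 0 g)]
      simp
    · rw [PEquiv.star_l2Op, PEquiv.l2Op_mul]
      congr 1
      refine PEquiv.ext fun a => ?_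
      change ((s e).symm a).bind (s e) = _
      rw [hs', hq]
      split_ifs with h1
      · simp [hs, ← h1]
      · rfl
    · ext g a
      rw [_root_.sum_apply, lp.coeFn_sum, Finset.sum_apply]
      have : ∀ e, ((s e).l2Op * star (s e).l2Op) g a = if (Ψ.symm a).1 = e then g a else 0 :=
        fun e => by
          rw [PEquiv.star_l2Op, PEquiv.l2Op_mul, PEquiv.l2Op_apply]
          change ((s e a).bind (s e).symm).elim 0 g = _
          rw [hs]
          split_ifs with h1
          · simp [hs', ← h1]
          · rfl
      simp only [this, Finset.sum_ite_eq, Finset.mem_filter, Finset.mem_univ, true_and, hΨ,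
        PEquiv.l2Op_apply, hq]
      split_ifs <;> rfl
  let π := Γ.graphRelations.lift
    (Sum.elim (fun v => (q v).l2Op) (fun e => (s e).l2Op)) hfam
  intro h0
  have h1 : π (Γ.p v) = (q v).l2Op := Γ.graphRelations.lift_gen _ _ (Sum.inl v)
  rw [h0, map_zero] at h1
  have h2 : (q v).l2Op (lp.single 2 (v, 0) (1 : ℂ)) (v, 0) = 1 := by
    rw [PEquiv.l2Op_apply, hq]; simp
  rw [← h1] at h2
  simp at h2

end Digraph

/-! ### Spanning elements and the grading of the graph algebra. -/

namespace Digraph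

variable {V : Type u} {Γ : Digraph V} [Fintype V] [DecidableEq V] [DecidableRel Γ.Adj]

namespace IsGraphFamily

variable {B : Type*} [CStarAlgebra B] {p : V → B} {S : Γ.Edge → B}

theorem p_mul_p_self (h : Γ.IsGraphFamily p S) (v : V) : p v * p v = p v := by
  rw [h.p_mul_p, if_pos rfl]

theorem p_mul_S_eq (h : Γ.IsGraphFamily p S) (v : V) (e : Γ.Edge) :
    p v * S e = if v = Γ.src e then S e else 0 := by
  rw [← h.p_mul_S, ← mul_assoc, h.p_mul_p]
  split_ifs with hv
  · rw [hv]
  · rw [zero_mul]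

theorem S_mul_p_eq (h : Γ.IsGraphFamily p S) (v : V) (e : Γ.Edge) :
    S e * p v = if Γ.tgt e = v then S e else 0 := by
  rw [← h.S_mul_p, mul_assoc, h.p_mul_p]
  split_ifs <;> simp

theorem star_S_mul_p (h : Γ.IsGraphFamily p S) (e : Γ.Edge) (v : V) :
    star (S e) * p v = if v = Γ.src e then star (S e) else 0 := by
  rw [← h.star_p v, ← star_mul, h.p_mul_S_eq]
  split_ifs <;> simp

theorem p_mul_star_S (h : Γ.IsGraphFamily p S) (e : Γ.Edge) (v : V) :
    p v * star (S e) = if Γ.tgt e = v then star (S e) else 0 := by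
  rw [← h.star_p v, ← star_mul, h.S_mul_p_eq]
  split_ifs <;> simp

theorem star_S_mul_S_eq (h : Γ.IsGraphFamily p S) (e f : Γ.Edge) :
    star (S e) * S f = if e = f then p (Γ.tgt e) else 0 := by
  split_ifs with hef
  · rw [← hef, h.star_S_mul_S]
  · exact h.star_S_mul_S_of_ne hef

end IsGraphFamily

variable (Γ)

/-- The product of the partial isometries along a list of edges. -/
noncomputable def pathS (l : List Γ.Edge) : Γ.CStar := (l.map Γ.S).prod

theorem pathS_nil : Γ.pathS [] = 1 := rfl

theorem pathS_cons (e : Γ.Edge) (l : List Γ.Edge) : Γ.pathS (e :: l) = Γ.S e * Γ.pathS l := by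
  rw [pathS, List.map_cons, List.prod_cons, pathS]

theorem pathS_concat (e : Γ.Edge) (l : List Γ.Edge) :
    Γ.pathS (l ++ [e]) = Γ.pathS l * Γ.S e := by
  simp [pathS]

/-- A closed subspace containing `1` and stable under left multiplication by generators is
everything. -/
theorem eq_top_of_generators_mul_mem (C : Submodule ℂ Γ.CStar) (hC : IsClosed (C : Set Γ.CStar))
    (h1 : 1 ∈ C) (hp : ∀ v, ∀ a ∈ C, Γ.p v * a ∈ C) (hS : ∀ e, ∀ a ∈ C, Γ.S e * a ∈ C)
    (hS' : ∀ e, ∀ a ∈ C, star (Γ.S e) * a ∈ C) (a : Γ.CStar) : a ∈ C := by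
  refine Γ.graphRelations.family.denseRange_of.induction_on (p := fun x => x ∈ C) a hC fun x => ?_
  -- Left multiplication by an arbitrary word is what the induction can carry; the claim is the case
  -- `y = 1`.
  have key : ∀ y ∈ C, Γ.graphRelations.family.of x * y ∈ C := by
    induction x using FreeStarAlgebra.induction with
    | h_scalar r =>
      intro y hy
      rw [AlgHomClass.commutes, Algebra.algebraMap_eq_smul_one, smul_mul_assoc, one_mul]
      exact C.smul_mem r hy
    | h_letter g =>
      intro y hy
      rcases g with (v | e) | (v | e)
      · exact hp v y hy
      · exact hS e y hy
      · have : Γ.graphRelations.family.of (FreeStarAlgebra.letter (Sum.inr (Sum.inl v))) =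
            star (Γ.p v) := by
          rw [← Sum.swap_inl, ← FreeStarAlgebra.star_letter, map_star]; rfl
        rw [this, Γ.isGraphFamily.star_p]
        exact hp v y hy
      · have : Γ.graphRelations.family.of (FreeStarAlgebra.letter (Sum.inr (Sum.inr e))) =
            star (Γ.S e) := by
          rw [← Sum.swap_inl, ← FreeStarAlgebra.star_letter, map_star]; rfl
        rw [this]
        exact hS' e y hy
    | h_mul a b ha hb => intro y hy; rw [map_mul, mul_assoc]; exact ha _ (hb y hy)
    | h_add a b ha hb => intro y hy; rw [map_add, add_mul]; exact C.add_mem (ha y hy) (hb y hy)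
  simpa using key 1 h1

/-- The elements `S_μ p_v S_ν^*` span a dense subspace. -/
theorem mem_of_spanning (C : Submodule ℂ Γ.CStar) (hC : IsClosed (C : Set Γ.CStar))
    (h : ∀ l v l', Γ.pathS l * Γ.p v * star (Γ.pathS l') ∈ C) (a : Γ.CStar) : a ∈ C := by
  have hG := Γ.isGraphFamily
  let T : Set Γ.CStar := {a | ∃ l v l', a = Γ.pathS l * Γ.p v * star (Γ.pathS l')}
  let M : Submodule ℂ Γ.CStar := Submodule.span ℂ T
  have hT : ∀ l v l', Γ.pathS l * Γ.p v * star (Γ.pathS l') ∈ M := fun l v l' =>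
    Submodule.subset_span ⟨l, v, l', rfl⟩
  have hpM : ∀ w l v l', Γ.p w * (Γ.pathS l * Γ.p v * star (Γ.pathS l')) ∈ M := by
    intro w l v l'
    cases l with
    | nil =>
      rw [pathS_nil, one_mul, ← mul_assoc, hG.p_mul_p]
      split_ifs with hw
      · rw [hw]; simpa [pathS_nil] using hT [] v l'
      · simp
    | cons e l =>
      rw [pathS_cons]
      simp only [← mul_assoc]
      rw [hG.p_mul_S_eq]
      split_ifs with hw
      · simpa only [pathS_cons] using hT (e :: l) v l'
      · simp
  have ext : ∀ b : Γ.CStar, (∀ l v l', b * (Γ.pathS l * Γ.p v * star (Γ.pathS l')) ∈ M) →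
      ∀ a ∈ M.topologicalClosure, b * a ∈ M.topologicalClosure := by
    intro b hb
    have hle : M ≤ M.comap (LinearMap.mulLeft ℂ b) := Submodule.span_le.mpr (by
      rintro _ ⟨l, v, l', rfl⟩
      exact hb l v l')
    intro a ha
    exact map_mem_closure (continuous_const_mul b) ha fun x hx => hle hx
  have hle : M.topologicalClosure ≤ C := Submodule.topologicalClosure_minimal _
    (Submodule.span_le.mpr (by rintro _ ⟨l, v, l', rfl⟩; exact h l v l')) hC
  refine hle (Γ.eq_top_of_generators_mul_mem M.topologicalClosure
    (Submodule.isClosed_topologicalClosure _) ?_ (fun w => ext _ (hpM w)) (fun e => ext _ ?_)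
    (fun e => ext _ ?_) a)
  · refine Submodule.le_topologicalClosure _ ?_
    rw [← hG.sum_p]
    exact Submodule.sum_mem _ fun v _ => by simpa [pathS_nil] using hT [] v []
  · intro l v l'
    simpa only [pathS_cons, mul_assoc] using hT (e :: l) v l'
  · intro l v l'
    cases l with
    | nil =>
      rw [pathS_nil, one_mul, ← mul_assoc, hG.star_S_mul_p]
      split_ifs with hv
      -- With no edge on the left to cancel, `S_e^*` is absorbed into the adjoint path on the right,
      -- lengthening it by `e`.
      · have := hT [] (Γ.tgt e) (l' ++ [e])
        rwa [pathS_nil, one_mul, pathS_concat, star_mul, ← mul_assoc, hG.p_mul_star_S,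
          if_pos rfl] at this
      · simp
    | cons f l =>
      have : star (Γ.S e) * (Γ.pathS (f :: l) * Γ.p v * star (Γ.pathS l')) =
          (star (Γ.S e) * Γ.S f) * (Γ.pathS l * Γ.p v * star (Γ.pathS l')) := by
        simp only [pathS_cons, mul_assoc]
      rw [this, hG.star_S_mul_S_eq]
      split_ifs
      · exact hpM _ l v l'
      · simp

/-- Induction principle for closed subspaces of `C^*(Γ)`: vertex projections, the operations
`a ↦ S_e a S_f^*`, and elements of nonzero degree. -/
theorem mem_of_sandwich (C : Submodule ℂ Γ.CStar) (hC : IsClosed (C : Set Γ.CStar))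
    (hp : ∀ v, Γ.p v ∈ C) (hS : ∀ e f, ∀ a ∈ C, Γ.S e * a * star (Γ.S f) ∈ C)
    (h : ∀ l v l', l.length ≠ l'.length → Γ.pathS l * Γ.p v * star (Γ.pathS l') ∈ C)
    (a : Γ.CStar) : a ∈ C := by
  refine Γ.mem_of_spanning C hC (fun l v l' => ?_) a
  by_cases hl : l.length = l'.length
  · induction l generalizing l' with
    | nil =>
      rw [List.length_nil, eq_comm, List.length_eq_zero_iff] at hl
      rw [hl, pathS_nil, star_one, one_mul, mul_one]
      exact hp v
    | cons e l ih =>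
      cases l' with
      | nil => simp at hl
      | cons f l' =>
        have := hS e f _ (ih l' (by simpa using hl))
        simpa only [pathS_cons, star_mul, mul_assoc] using this
  · exact h l v l' hl

theorem dynamics_p (t : ℝ) (v : V) : Γ.dynamics t (Γ.p v) = Γ.p v := Γ.gauge_p _ v

theorem dynamics_S (t : ℝ) (e : Γ.Edge) :
    Γ.dynamics t (Γ.S e) = Complex.exp (Complex.I * t) • Γ.S e := by
  rw [dynamics, gauge_S, Circle.coe_exp, mul_comm]

/-- The spectral subspace of degree `k` of the dynamics. -/
noncomputable def spectralSubspace (k : ℤ) : Submodule ℂ Γ.CStar where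
  carrier := {a | ∀ t : ℝ, Γ.dynamics t a = Complex.exp (Complex.I * k * t) • a}
  add_mem' ha hb t := by rw [map_add, ha t, hb t, smul_add]
  zero_mem' t := by simp
  smul_mem' c a ha t := by rw [map_smul, ha t, smul_comm]

variable {Γ}

theorem p_mem_spectralSubspace (v : V) : Γ.p v ∈ Γ.spectralSubspace 0 := fun t => by
  simp [dynamics_p]

theorem S_mem_spectralSubspace (e : Γ.Edge) : Γ.S e ∈ Γ.spectralSubspace 1 := fun t => by
  simp [dynamics_S]

theorem mul_mem_spectralSubspace {a b : Γ.CStar} {k l : ℤ} (ha : a ∈ Γ.spectralSubspace k)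
    (hb : b ∈ Γ.spectralSubspace l) : a * b ∈ Γ.spectralSubspace (k + l) := fun t => by
  rw [map_mul, ha t, hb t, smul_mul_smul_comm, ← Complex.exp_add]
  congr 2
  push_cast
  ring

theorem star_mem_spectralSubspace {a : Γ.CStar} {k : ℤ} (ha : a ∈ Γ.spectralSubspace k) :
    star a ∈ Γ.spectralSubspace (-k) := fun t => by
  rw [map_star, ha t, star_smul, Complex.star_def, ← Complex.exp_conj]
  congr 2
  simp

theorem pathS_mem_spectralSubspace (l : List Γ.Edge) :
    Γ.pathS l ∈ Γ.spectralSubspace l.length := by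
  induction l with
  | nil => intro t; simp [pathS_nil]
  | cons e l ih =>
    rw [pathS_cons, List.length_cons, Nat.cast_succ, add_comm]
    exact mul_mem_spectralSubspace (S_mem_spectralSubspace e) ih

theorem spanning_mem_spectralSubspace (l : List Γ.Edge) (v : V) (l' : List Γ.Edge) :
    Γ.pathS l * Γ.p v * star (Γ.pathS l') ∈
      Γ.spectralSubspace ((l.length : ℤ) - l'.length) := by
  have := mul_mem_spectralSubspace (mul_mem_spectralSubspace (pathS_mem_spectralSubspace l)
    (p_mem_spectralSubspace v)) (star_mem_spectralSubspace (pathS_mem_spectralSubspace l'))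
  rwa [add_zero, ← sub_eq_add_neg] at this

end Digraph

/-! ### KMS states as scaling states. -/

theorem Complex.eq_of_eqOn_real {f g : ℂ → ℂ} (hf : Differentiable ℂ f) (hg : Differentiable ℂ g)
    (h : ∀ t : ℝ, f t = g t) (z : ℂ) : f z = g z := by
  have hfa : AnalyticOnNhd ℂ f Set.univ := fun z _ => hf.analyticAt z
  have hga : AnalyticOnNhd ℂ g Set.univ := fun z _ => hg.analyticAt z
  refine congrFun (hfa.eq_of_frequently_eq hga (z₀ := 0) ?_) z
  have ht : Filter.Tendsto ((↑) : ℝ → ℂ) (nhdsWithin 0 {0}ᶜ) (nhdsWithin 0 {0}ᶜ) := by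
    refine tendsto_nhdsWithin_of_tendsto_nhds_of_eventually_within _ ?_ ?_
    · exact (Complex.continuous_ofReal.tendsto' 0 0 Complex.ofReal_zero).mono_left
        nhdsWithin_le_nhds
    · filter_upwards [self_mem_nhdsWithin] with t ht
      simpa using ht
  exact ht.frequently (Filter.Frequently.of_forall h)

namespace Digraph

variable {V : Type u} {Γ : Digraph V} [Fintype V] [DecidableEq V] [DecidableRel Γ.Adj]

theorem isEntireExtension_of_mem_spectralSubspace {a : Γ.CStar} {k : ℤ}
    (ha : a ∈ Γ.spectralSubspace k) :
    IsEntireExtension Γ.dynamics a fun z => Complex.exp (Complex.I * k * z) • a :=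
  ⟨by fun_prop, fun t => (ha t).symm⟩

variable (Γ) in
/-- States of `C^*(Γ)` which vanish on elements of nonzero degree and which satisfy the KMS
condition on the generators, `e^β` being `r`. -/
structure IsScalingState (r : ℝ) (φ : Γ.CStar →L[ℂ] ℂ) : Prop where
  isState : IsState φ
  degree : ∀ k : ℤ, k ≠ 0 → ∀ a ∈ Γ.spectralSubspace k, φ a = 0
  S_mul : ∀ e a, φ (Γ.S e * a) = (r : ℂ)⁻¹ * φ (a * Γ.S e)

/-- Invariance gives `φ(a) = e^{ik} φ(a)`, and `e^{ik} = 1` with `k ≠ 0` would make `π` rational.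
Hence the single time `1` already detects the whole grading. -/
theorem degree_of_invariant {φ : Γ.CStar →L[ℂ] ℂ} (h : ∀ a, φ (Γ.dynamics 1 a) = φ a) {k : ℤ}
    (hk : k ≠ 0) {a : Γ.CStar} (ha : a ∈ Γ.spectralSubspace k) : φ a = 0 := by
  have h1 := h a
  rw [ha 1, map_smul, smul_eq_mul] at h1
  by_contra hne
  have h2 : Complex.exp (Complex.I * k * (1 : ℝ)) = 1 := mul_right_cancel₀ hne (by rw [h1, one_mul])
  obtain ⟨n, hn⟩ := Complex.exp_eq_one_iff.mp h2
  have h3 : (k : ℝ) = n * (2 * Real.pi) := by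
    have h4 : (k : ℂ) * Complex.I = (n * (2 * Real.pi)) * Complex.I := by
      rw [← mul_assoc] at hn ⊢
      simpa [mul_comm, mul_assoc, mul_left_comm] using hn
    exact_mod_cast mul_right_cancel₀ Complex.I_ne_zero h4
  have hn0 : (n : ℝ) ≠ 0 := fun h0 => hk (by
    rw [h0, zero_mul] at h3
    exact_mod_cast h3)
  refine irrational_pi ⟨(k : ℚ) / (2 * n), ?_⟩
  push_cast
  rw [h3]
  field_simp

namespace IsScalingState

variable {r : ℝ} {φ : Γ.CStar →L[ℂ] ℂ}

theorem star_S_mul (h : Γ.IsScalingState r φ) (hr : r ≠ 0) (e : Γ.Edge) (a : Γ.CStar) :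
    φ (star (Γ.S e) * a) = r * φ (a * star (Γ.S e)) := by
  have h1 := congrArg star (h.S_mul e (star a))
  rw [star_mul', ← h.isState.map_star, ← h.isState.map_star, star_mul, star_mul, star_star] at h1
  rw [h1]
  simp [hr]

theorem p_mul (h : Γ.IsScalingState r φ) (hr : r ≠ 0) (v : V) (a : Γ.CStar) :
    φ (Γ.p v * a) = φ (a * Γ.p v) := by
  rw [← Γ.isGraphFamily.sum_S_mul_star_S, Finset.sum_mul, Finset.mul_sum, map_sum, map_sum]
  refine Finset.sum_congr rfl fun e _ => ?_
  rw [mul_assoc, h.S_mul, mul_assoc, h.star_S_mul hr, ← mul_assoc, inv_mul_cancel₀, one_mul,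
    mul_assoc]
  exact_mod_cast hr

/-- Letters are moved cyclically one at a time: each `S_e` contributes `r⁻¹`, each `S_e^*`
contributes `r`, and `p_v` contributes nothing. -/
theorem spanning_mul (h : Γ.IsScalingState r φ) (hr : r ≠ 0) (l : List Γ.Edge) (v : V)
    (l' : List Γ.Edge) (a : Γ.CStar) :
    φ (Γ.pathS l * Γ.p v * star (Γ.pathS l') * a) =
      (r : ℂ) ^ ((l'.length : ℤ) - l.length) * φ (a * (Γ.pathS l * Γ.p v * star (Γ.pathS l'))) := by
  have hr' : (r : ℂ) ≠ 0 := by exact_mod_cast hr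
  have h1 : ∀ (l : List Γ.Edge) (a : Γ.CStar),
      φ (Γ.pathS l * a) = ((r : ℂ) ^ l.length)⁻¹ * φ (a * Γ.pathS l) := by
    intro l
    induction l with
    | nil => intro a; simp [pathS_nil]
    | cons e l ih =>
      intro a
      rw [pathS_cons, mul_assoc, h.S_mul, mul_assoc, ih, mul_assoc, List.length_cons, pow_succ',
        mul_inv, mul_assoc]
  have h2 : ∀ (l : List Γ.Edge) (a : Γ.CStar),
      φ (star (Γ.pathS l) * a) = (r : ℂ) ^ l.length * φ (a * star (Γ.pathS l)) := by
    intro l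
    induction l with
    | nil => intro a; simp [pathS_nil]
    | cons e l ih =>
      intro a
      rw [pathS_cons, star_mul, mul_assoc, ih, mul_assoc, h.star_S_mul hr, mul_assoc,
        List.length_cons, pow_succ, mul_assoc]
  rw [mul_assoc, mul_assoc, h1, mul_assoc, h.p_mul hr, mul_assoc, mul_assoc, h2, mul_assoc, zpow_sub₀ hr',
    div_eq_mul_inv, zpow_natCast, zpow_natCast]
  simp only [mul_assoc]
  ring

/-- The eigenvalue equation: `φ(S_e S_e^*) = r⁻¹ φ(S_e^* S_e)` is summed over the edges leaving `v`.
-/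
theorem apply_p (h : Γ.IsScalingState r φ) (v : V) :
    φ (Γ.p v) = (r : ℂ)⁻¹ * ∑ w, if Γ.Adj v w then φ (Γ.p w) else 0 := by
  have hG := Γ.isGraphFamily
  rw [← hG.sum_S_mul_star_S, map_sum, Finset.sum_filter]
  simp only [h.S_mul, hG.star_S_mul_S]
  rw [sum_edge fun i j => if i = v then (r : ℂ)⁻¹ * φ (Γ.p j) else 0,
    Finset.sum_eq_single v (fun i _ hi => by simp [hi]) (by simp), Finset.mul_sum]
  simp

theorem p_nonneg (h : IsState φ) (v : V) : 0 ≤ (φ (Γ.p v)).re ∧ ((φ (Γ.p v)).re : ℂ) = φ (Γ.p v) := by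
  have hG := Γ.isGraphFamily
  have h1 := h.nonneg (Γ.p v)
  rw [hG.star_p, hG.p_mul_p_self] at h1
  obtain ⟨h2, h3⟩ := Complex.le_def.mp h1
  exact ⟨by simpa using h2, Complex.ext rfl (by simpa using h3)⟩

/-- A scaling state is determined by its values on the vertex projections. -/
theorem eq_of_apply_p_eq (h : Γ.IsScalingState r φ) {ψ : Γ.CStar →L[ℂ] ℂ}
    (h' : Γ.IsScalingState r ψ) (hr : r ≠ 0) (hp : ∀ v, φ (Γ.p v) = ψ (Γ.p v)) : φ = ψ := by
  have hG := Γ.isGraphFamily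
  -- The factor `p_v` is kept because scaling reduces `φ(p_v S_e a S_f^*)` to `0` or to `r⁻¹
  -- φ(p_{t(e)} a)`, which the hypothesis on `a` must cover.
  let C : Submodule ℂ Γ.CStar :=
    { carrier := {a | ∀ v, φ (Γ.p v * a) = ψ (Γ.p v * a)}
      add_mem' := fun ha hb v => by rw [mul_add, map_add, map_add, ha v, hb v]
      zero_mem' := fun v => by simp
      smul_mem' := fun c a ha v => by rw [mul_smul_comm, map_smul, map_smul, ha v] }
  have hC : IsClosed (C : Set Γ.CStar) := by
    have : (C : Set Γ.CStar) = {a | ∀ v, φ (Γ.p v * a) = ψ (Γ.p v * a)} := rfl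
    rw [this, Set.ofPred_forall]
    exact isClosed_iInter fun v => isClosed_eq (by fun_prop) (by fun_prop)
  have key : ∀ a, a ∈ C := Γ.mem_of_sandwich C hC
    (fun v w => by
      rw [hG.p_mul_p]
      split_ifs
      · exact hp w
      · simp)
    (fun e f a ha v => by
      rw [← mul_assoc, ← mul_assoc, hG.p_mul_S_eq]
      split_ifs
      · rw [mul_assoc, h.S_mul, h'.S_mul, mul_assoc, hG.star_S_mul_S_eq]
        split_ifs
        · rw [← h.p_mul hr, ← h'.p_mul hr, ha]
        · simp
      · simp)
    (fun l v l' hl w => by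
      have h1 := mul_mem_spectralSubspace (p_mem_spectralSubspace w)
        (spanning_mem_spectralSubspace l v l')
      have h2 : (0 : ℤ) + (l.length - l'.length) ≠ 0 := by omega
      rw [h.degree _ h2 _ h1, h'.degree _ h2 _ h1])
  ext a
  rw [← one_mul a, ← hG.sum_p, Finset.sum_mul, map_sum, map_sum]
  exact Finset.sum_congr rfl fun v _ => key a v

end IsScalingState

theorem isScalingState_of_isKMS {β : ℝ} {φ : Γ.CStar →L[ℂ] ℂ} (h : IsKMS Γ.dynamics β φ) :
    Γ.IsScalingState (Real.exp β) φ := by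
  refine ⟨h.isState, fun k hk a ha => degree_of_invariant (h.invariant 1) hk ha, fun e a => ?_⟩
  let C : Submodule ℂ Γ.CStar :=
    { carrier := {a | φ (Γ.S e * a) = ((Real.exp β : ℝ) : ℂ)⁻¹ * φ (a * Γ.S e)}
      add_mem' := fun {a b} ha hb => by
        change φ (Γ.S e * (a + b)) = _ * φ ((a + b) * Γ.S e)
        rw [mul_add, add_mul, map_add, map_add, ha, hb, mul_add]
      zero_mem' := by simp
      smul_mem' := fun c a ha => by
        change φ (Γ.S e * (c • a)) = _ * φ ((c • a) * Γ.S e)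
        rw [mul_smul_comm, smul_mul_assoc, map_smul, map_smul, ha, smul_eq_mul, smul_eq_mul]
        ring }
  -- The KMS condition requires `b` analytic, so it is used for the homogeneous spanning elements
  -- and extended by linearity and continuity.
  refine Γ.mem_of_spanning C (isClosed_eq (by fun_prop) (by fun_prop)) (fun l v l' => ?_) a
  have h1 := h.kms _ _ _ _ (isEntireExtension_of_mem_spectralSubspace (S_mem_spectralSubspace e))
    (isEntireExtension_of_mem_spectralSubspace (spanning_mem_spectralSubspace l v l'))
  refine h1.trans ?_
  rw [mul_smul_comm, map_smul, smul_eq_mul]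
  congr 1
  rw [Complex.ofReal_exp, ← Complex.exp_neg]
  congr 1
  rw [Int.cast_one, mul_one, ← mul_assoc, Complex.I_mul_I, neg_one_mul]

theorem isKMS_of_isScalingState {β : ℝ} {φ : Γ.CStar →L[ℂ] ℂ}
    (h : Γ.IsScalingState (Real.exp β) φ) : IsKMS Γ.dynamics β φ := by
  have hr := (Real.exp_pos β).ne'
  have hcont : ∀ t, Continuous (Γ.dynamics t) := fun t =>
    (AddMonoidHomClass.lipschitz_of_bound (Γ.dynamics t) 1 fun x => by
      rw [one_mul]; exact NonUnitalStarAlgHom.norm_apply_le _ x).continuous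
  have hinv : ∀ t a, φ (Γ.dynamics t a) = φ a := fun t a => by
    let C : Submodule ℂ Γ.CStar :=
      { carrier := {a | φ (Γ.dynamics t a) = φ a}
        add_mem' := fun {a b} ha hb => by
          change φ (Γ.dynamics t (a + b)) = φ (a + b)
          rw [map_add, map_add, map_add, ha, hb]
        zero_mem' := by simp
        smul_mem' := fun c a ha => by
          change φ (Γ.dynamics t (c • a)) = φ (c • a)
          rw [map_smul, map_smul, map_smul, ha] }
    refine Γ.mem_of_spanning C (isClosed_eq (φ.continuous.comp (hcont t)) φ.continuous)
      (fun l v l' => ?_) a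
    change φ (Γ.dynamics t _) = φ _
    have h1 := spanning_mem_spectralSubspace l v l'
    rw [h1 t, map_smul]
    by_cases hl : (l.length : ℤ) - l'.length = 0
    · simp [hl]
    · rw [h.degree _ hl _ h1, smul_zero]
  refine ⟨h.isState, hinv, fun a b f g hf _ => ?_⟩
  let C : Submodule ℂ Γ.CStar :=
    { carrier := {b | φ (a * b) = φ (b * f (Complex.I * β))}
      add_mem' := fun {b c} hb hc => by
        change φ (a * (b + c)) = φ ((b + c) * _)
        rw [mul_add, add_mul, map_add, map_add, hb, hc]
      zero_mem' := by simp
      smul_mem' := fun c b hb => by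
        change φ (a * (c • b)) = φ ((c • b) * _)
        rw [mul_smul_comm, smul_mul_assoc, map_smul, map_smul, hb] }
  refine Γ.mem_of_spanning C (isClosed_eq (by fun_prop) (by fun_prop)) (fun l v l' => ?_) b
  change φ (a * _) = φ (_ * f _)
  set w := Γ.pathS l * Γ.p v * star (Γ.pathS l')
  set k : ℤ := (l.length : ℤ) - l'.length
  have hw : w ∈ Γ.spectralSubspace k := spanning_mem_spectralSubspace l v l'
  have h1 := h.spanning_mul hr l v l' a
  -- For real `t`, invariance gives `φ(w σ_t(a)) = e^{-ikt} φ(w a)`. Both sides are entire in `t`,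
  -- so the formula holds at `iβ`; no grading of `a` is needed.
  have h2 : φ (w * f (Complex.I * β)) =
      Complex.exp (-(Complex.I * k * (Complex.I * β))) * φ (w * a) := by
    refine Complex.eq_of_eqOn_real (f := fun z => φ (w * f z))
      (g := fun z => Complex.exp (-(Complex.I * k * z)) * φ (w * a)) ?_ (by fun_prop)
      (fun t => ?_) _
    · have hfd := hf.differentiable
      exact φ.differentiable.comp (hfd.const_mul w)
    · have h3 := hinv t (w * a)
      rw [map_mul, hw t, smul_mul_assoc, map_smul, smul_eq_mul, ← hf.eq_on_real] at h3
      rw [← h3, ← mul_assoc, ← Complex.exp_add, neg_add_cancel, Complex.exp_zero, one_mul]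
  rw [h2]
  change φ (w * a) = _ at h1
  rw [h1, ← mul_assoc (Complex.exp _)]
  have h3 : Complex.exp (-(Complex.I * k * (Complex.I * β))) *
      ((Real.exp β : ℝ) : ℂ) ^ ((l'.length : ℤ) - l.length) = 1 := by
    rw [Complex.ofReal_exp, ← Complex.exp_int_mul, ← Complex.exp_add]
    have : -(Complex.I * k * (Complex.I * β)) + (((l'.length : ℤ) - l.length : ℤ) : ℂ) * β = 0 := by
      simp only [k]
      push_cast
      linear_combination (-((l.length : ℂ) - l'.length) * β) * Complex.I_mul_I
    rw [this, Complex.exp_zero]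
  rw [h3, one_mul]

theorem isKMS_iff_isScalingState {β : ℝ} {φ : Γ.CStar →L[ℂ] ℂ} :
    IsKMS Γ.dynamics β φ ↔ Γ.IsScalingState (Real.exp β) φ :=
  ⟨isScalingState_of_isKMS, isKMS_of_isScalingState⟩

end Digraph

/-! ### Existence of a scaling state with Perron weights. -/

section StateSets

open Filter Topology
open scoped ComplexOrder

variable {A : Type u} [CStarAlgebra A]

/-- The fixed point theorem for the set of states with prescribed values on a given set. -/
theorem exists_invariant_isState {ι : Type*} (a : ι → A) (c : ι → ℂ)
    (hne : ∃ φ : A →L[ℂ] ℂ, IsState φ ∧ ∀ i, φ (a i) = c i) (T : A →L[ℂ] A)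
    (hT : ∀ φ : A →L[ℂ] ℂ, IsState φ → (∀ i, φ (a i) = c i) →
      IsState (φ.comp T) ∧ ∀ i, φ (T (a i)) = c i) :
    ∃ φ : A →L[ℂ] ℂ, IsState φ ∧ (∀ i, φ (a i) = c i) ∧ ∀ b, φ (T b) = φ b := by
  have hmean1 : ∀ (n : ℕ) (z : ℂ), ((n : ℂ) + 1)⁻¹ * ∑ i ∈ Finset.range (n + 1), z = z :=
    fun n z => by
      rw [Finset.sum_const, Finset.card_range, nsmul_eq_mul, ← mul_assoc, Nat.cast_succ,
        inv_mul_cancel₀ (by exact_mod_cast n.succ_ne_zero), one_mul]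
  have happ : ∀ (n : ℕ) (φ : ℕ → A →L[ℂ] ℂ) (b : A),
      (((n : ℂ) + 1)⁻¹ • ∑ i ∈ Finset.range (n + 1), φ i) b =
        ((n : ℂ) + 1)⁻¹ * ∑ i ∈ Finset.range (n + 1), φ i b := fun n φ b => by
    rw [smul_apply, _root_.sum_apply, smul_eq_mul]
  suffices h : ∃ φ ∈ {φ : A →L[ℂ] ℂ | IsState φ ∧ ∀ i, φ (a i) = c i}, ∀ b, φ (T b) = φ b by
    obtain ⟨φ, ⟨hφ, hφc⟩, hφT⟩ := h
    exact ⟨φ, hφ, hφc, hφT⟩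
  refine exists_invariant_functional _ hne (fun φ hφ => hφ.1.norm_apply_le)
    (fun n φ hφ => ⟨⟨fun b => ?_, ?_⟩, fun i => ?_⟩)
    (fun l _ φ ψ hφ hlim => ⟨⟨fun b => ?_, ?_⟩, fun i => ?_⟩)
    T (fun φ hφ => hT φ hφ.1 hφ.2)
  · rw [happ]
    refine mul_nonneg ?_ (Finset.sum_nonneg fun i _ => (hφ i).1.nonneg b)
    have : ((n : ℂ) + 1)⁻¹ = (((n : ℝ) + 1)⁻¹ : ℝ) := by push_cast; rfl
    rw [this]
    exact Complex.zero_le_real.mpr (by positivity)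
  · rw [happ, Finset.sum_congr rfl fun i _ => (hφ i).1.map_one, hmean1]
  · rw [happ, Finset.sum_congr rfl fun j _ => (hφ j).2 i, hmean1]
  · exact ge_of_tendsto (hlim _) (Eventually.of_forall fun n => (hφ n).1.nonneg b)
  · exact tendsto_nhds_unique (hlim 1)
      (tendsto_const_nhds.congr fun n => ((hφ n).1.map_one).symm)
  · exact tendsto_nhds_unique (hlim _) (tendsto_const_nhds.congr fun n => ((hφ n).2 i).symm)

end StateSets

namespace Digraph

open scoped ComplexOrder Matrix

theorem vertexMatrix_mulVec {V : Type u} {Γ : Digraph V} [Fintype V] [DecidableRel Γ.Adj]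
    (x : V → ℝ) (v : V) : (Γ.vertexMatrix ℝ *ᵥ x) v = ∑ w, if Γ.Adj v w then x w else 0 := by
  simp [Matrix.mulVec, dotProduct, vertexMatrix]

variable {V : Type u} {Γ : Digraph V} [Fintype V] [DecidableEq V] [DecidableRel Γ.Adj]

/-- A state equal to `1` at `p_v` vanishes at the other vertex projections, because these values are
nonnegative and sum to `1`. The convex combination with weights `x v` is the required state. -/
theorem exists_isState_apply_p (hsink : Γ.NoSinks) {x : V → ℝ} (hx : ∀ v, 0 ≤ x v)
    (hsum : ∑ v, x v = 1) : ∃ φ : Γ.CStar →L[ℂ] ℂ, IsState φ ∧ ∀ v, φ (Γ.p v) = x v := by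
  have hG := Γ.isGraphFamily
  have hf : ∀ v, ∃ f : Γ.CStar →L[ℂ] ℂ, IsState f ∧ f (Γ.p v) = 1 := fun v => by
    have : Nontrivial Γ.CStar := ⟨Γ.p v, 0, Γ.p_ne_zero hsink v⟩
    obtain ⟨f, hf, h⟩ := exists_isState_apply_star_mul_self (Γ.p v)
    have hn : ‖Γ.p v‖ ^ 2 = 1 := by
      have h1 := CStarRing.norm_star_mul_self (x := Γ.p v)
      rw [hG.star_p, hG.p_mul_p_self] at h1
      have h2 := mul_right_cancel₀ (norm_ne_zero_iff.mpr (Γ.p_ne_zero hsink v))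
        (h1.symm.trans (one_mul _).symm)
      rw [h2, one_pow]
    rw [hG.star_p, hG.p_mul_p_self, hn, Complex.ofReal_one] at h
    exact ⟨f, hf, h⟩
  choose f hf hfp using hf
  have hfp' : ∀ v w, f v (Γ.p w) = if v = w then 1 else 0 := fun v w => by
    split_ifs with hvw
    · rw [← hvw, hfp]
    · have h1 : ∑ w ∈ Finset.univ.erase v, (f v (Γ.p w)).re = 0 := by
        have h2 := congrArg (fun a => (f v a).re) hG.sum_p
        simp only [map_sum, Complex.re_sum, (hf v).map_one] at h2
        rw [← Finset.add_sum_erase _ _ (Finset.mem_univ v), hfp] at h2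
        simpa using h2
      have h2 := (Finset.sum_eq_zero_iff_of_nonneg fun w _ =>
        (IsScalingState.p_nonneg (hf v) w).1).mp h1 w (by simp [Ne.symm hvw])
      rw [← (IsScalingState.p_nonneg (hf v) w).2, h2, Complex.ofReal_zero]
  refine ⟨∑ v, (x v : ℂ) • f v, ⟨fun a => ?_, ?_⟩, fun w => ?_⟩
  · simp only [_root_.sum_apply, smul_apply, smul_eq_mul]
    exact Finset.sum_nonneg fun v _ =>
      mul_nonneg (Complex.zero_le_real.mpr (hx v)) ((hf v).nonneg a)
  · simp only [_root_.sum_apply, smul_apply, smul_eq_mul, (hf _).map_one, mul_one]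
    exact_mod_cast hsum
  · simp [hfp']

variable (Γ) in
/-- The operator `a ↦ r⁻¹ ∑ e, S_e^* a S_e`. -/
noncomputable def transferOp (r : ℝ) : Γ.CStar →L[ℂ] Γ.CStar :=
  (r : ℂ)⁻¹ • ∑ e, (ContinuousLinearMap.mul ℂ Γ.CStar (star (Γ.S e))).comp
    ((ContinuousLinearMap.mul ℂ Γ.CStar).flip (Γ.S e))

theorem transferOp_apply (r : ℝ) (a : Γ.CStar) :
    Γ.transferOp r a = (r : ℂ)⁻¹ • ∑ e, star (Γ.S e) * (a * Γ.S e) := by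
  simp [transferOp]

/-- Write `T` for the transfer operator. `T(p_v a) = T(a p_v)` since both retain only the edges
leaving `v`, so `φ` commutes past vertex projections. Moreover `T(S_e a) = r⁻¹ p_{t(e)} a S_e`, and
the projection can be moved to the right and absorbed. -/
theorem S_mul_of_transferOp_invariant {r : ℝ} {φ : Γ.CStar →L[ℂ] ℂ}
    (h : ∀ a, φ (Γ.transferOp r a) = φ a) (e : Γ.Edge) (a : Γ.CStar) :
    φ (Γ.S e * a) = (r : ℂ)⁻¹ * φ (a * Γ.S e) := by
  have hG := Γ.isGraphFamily
  have hp : ∀ v a, φ (Γ.p v * a) = φ (a * Γ.p v) := fun v a => by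
    rw [← h, ← h (a * Γ.p v), transferOp_apply, transferOp_apply]
    congr 2
    refine Finset.sum_congr rfl fun f _ => ?_
    rw [mul_assoc (Γ.p v), ← mul_assoc, hG.star_S_mul_p, mul_assoc a, hG.p_mul_S_eq]
    split_ifs <;> simp
  rw [← h, transferOp_apply, map_smul, smul_eq_mul]
  congr 1
  have : ∀ f, star (Γ.S f) * (Γ.S e * a * Γ.S f) =
      if f = e then Γ.p (Γ.tgt e) * (a * Γ.S e) else 0 := fun f => by
    rw [mul_assoc, ← mul_assoc, hG.star_S_mul_S_eq]
    split_ifs with hf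
    · rw [hf]
    · rw [zero_mul]
  simp only [this, Finset.sum_ite_eq', Finset.mem_univ, if_true]
  rw [hp, mul_assoc, hG.S_mul_p]

theorem exists_isScalingState (hsink : Γ.NoSinks) {x : V → ℝ} {r : ℝ} (hx : ∀ v, 0 ≤ x v)
    (hsum : ∑ v, x v = 1) (hr : 0 < r) (hxr : Γ.vertexMatrix ℝ *ᵥ x = r • x) :
    ∃ φ : Γ.CStar →L[ℂ] ℂ, Γ.IsScalingState r φ ∧ ∀ v, φ (Γ.p v) = x v := by
  have hG := Γ.isGraphFamily
  let σ : Γ.CStar →L[ℂ] Γ.CStar := LinearMap.mkContinuous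
    ((Γ.dynamics 1 : Γ.CStar →ₐ[ℂ] Γ.CStar).toLinearMap) 1 fun a => by
      rw [one_mul]
      exact NonUnitalStarAlgHom.norm_apply_le (Γ.dynamics 1) a
  have hσ : ∀ a, σ a = Γ.dynamics 1 a := fun a => rfl
  -- First averaging: the resulting state is invariant at time `1`, hence vanishes in nonzero
  -- degree.
  obtain ⟨φ₁, h₁, hp₁, hσ₁⟩ := exists_invariant_isState Γ.p (fun v => (x v : ℂ))
    (exists_isState_apply_p hsink hx hsum) σ fun φ hφ hφp =>
      ⟨⟨fun a => by
        rw [ContinuousLinearMap.comp_apply, hσ, map_mul, map_star]; exact hφ.nonneg _,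
        by rw [ContinuousLinearMap.comp_apply, hσ, map_one, hφ.map_one]⟩,
        fun v => by rw [hσ, dynamics_p, hφp]⟩
  let Z := {y : ℤ × Γ.CStar // y.1 ≠ 0 ∧ y.2 ∈ Γ.spectralSubspace y.1}
  have hrx : ∀ v, ∑ w, (if Γ.Adj v w then (x w : ℂ) else 0) = r * x v := fun v => by
    have := congrFun hxr v
    rw [vertexMatrix_mulVec, Pi.smul_apply, smul_eq_mul] at this
    rw [← Complex.ofReal_mul, ← this, Complex.ofReal_sum]
    exact Finset.sum_congr rfl fun w _ => by split_ifs <;> simp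
  have hr' : (r : ℂ) ≠ 0 := by exact_mod_cast hr.ne'
  have hΨp : ∀ (φ : Γ.CStar →L[ℂ] ℂ), (∀ v, φ (Γ.p v) = x v) → ∀ v,
      φ (Γ.transferOp r (Γ.p v)) = x v := fun φ hφ v => by
    rw [transferOp_apply, map_smul, map_sum, smul_eq_mul]
    have : ∀ e, φ (star (Γ.S e) * (Γ.p v * Γ.S e)) =
        if v = Γ.src e then (x (Γ.tgt e) : ℂ) else 0 := fun e => by
      rw [hG.p_mul_S_eq]
      split_ifs
      · rw [hG.star_S_mul_S, hφ]
      · simp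
    simp only [this]
    rw [sum_edge fun i j => if v = i then (x j : ℂ) else 0,
      Finset.sum_eq_single v (fun i _ hi => by simp [Ne.symm hi]) (by simp)]
    simp only [if_true]
    rw [hrx, inv_mul_cancel_left₀ hr']
  -- Second averaging, with vanishing on all homogeneous elements of nonzero degree imposed as a
  -- constraint so that it is not lost.
  obtain ⟨φ, hφ, hφc, hφT⟩ := exists_invariant_isState
    (Sum.elim Γ.p fun z : Z => z.1.2) (Sum.elim (fun v => (x v : ℂ)) fun _ => 0)
    ⟨φ₁, h₁, fun i => by
      rcases i with v | ⟨⟨k, a⟩, hk, ha⟩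
      · exact hp₁ v
      · exact degree_of_invariant hσ₁ hk ha⟩ (Γ.transferOp r) fun φ hφ hφc => by
    have hφp : ∀ v, φ (Γ.p v) = x v := fun v => hφc (Sum.inl v)
    refine ⟨⟨fun a => ?_, ?_⟩, fun i => ?_⟩
    · rw [ContinuousLinearMap.comp_apply, transferOp_apply, map_smul, map_sum, smul_eq_mul]
      refine mul_nonneg ?_ (Finset.sum_nonneg fun e _ => ?_)
      · rw [← Complex.ofReal_inv]
        exact Complex.zero_le_real.mpr (inv_nonneg.mpr hr.le)
      · have := hφ.nonneg (a * Γ.S e)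
        rwa [star_mul, mul_assoc, ← mul_assoc (star a)] at this
    -- The transfer operator need not be unital; normalization survives because the prescribed
    -- values at the `p_v` form an eigenvector for `r`.
    · rw [ContinuousLinearMap.comp_apply, ← hG.sum_p, map_sum, map_sum]
      simp only [hΨp φ hφp]
      exact_mod_cast hsum
    · rcases i with v | ⟨⟨k, a⟩, hk, ha⟩
      · exact hΨp φ hφp v
      · change φ (Γ.transferOp r a) = 0
        rw [transferOp_apply, map_smul, map_sum, Finset.sum_eq_zero, smul_zero]
        intro e _
        have h1 := mul_mem_spectralSubspace
          (star_mem_spectralSubspace (S_mem_spectralSubspace e))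
          (mul_mem_spectralSubspace ha (S_mem_spectralSubspace e))
        have h2 : -1 + (k + 1) = k := by ring
        rw [h2] at h1
        exact hφc (Sum.inr ⟨⟨k, star (Γ.S e) * (a * Γ.S e)⟩, hk, h1⟩)
  exact ⟨φ, ⟨hφ, fun k hk a ha => hφc (Sum.inr ⟨⟨k, a⟩, hk, ha⟩),
    S_mul_of_transferOp_invariant hφT⟩, fun v => hφc (Sum.inl v)⟩

end Digraph

/-! ### The Perron vector and its quantum symmetry. -/

namespace Digraph

open scoped Matrix

theorem isPerron_hypotheses {V : Type u} {Γ : Digraph V} [DecidableRel Γ.Adj]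
    (hconn : Γ.StronglyConnected) : (∀ i j, 0 ≤ Γ.vertexMatrix ℝ i j) ∧
      ∀ v w, Relation.ReflTransGen (fun i j => 0 < Γ.vertexMatrix ℝ i j) v w := by
  refine ⟨fun i j => ?_, fun v w => Relation.ReflTransGen.mono (fun i j hij => ?_) v w (hconn v w)⟩
  · rw [vertexMatrix, Matrix.of_apply]; split_ifs <;> norm_num
  · simp [vertexMatrix, hij]

variable {V : Type u} {Γ : Digraph V} [Fintype V] [DecidableEq V] [DecidableRel Γ.Adj]

variable (Γ) in
/-- A strictly positive normalized eigenvector of the vertex matrix, whose eigenvalue is the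
spectral radius and positive. -/
structure IsPerronVector (x : V → ℝ) (r : ℝ) : Prop where
  pos : ∀ v, 0 < x v
  sum_eq : ∑ v, x v = 1
  eigen : Γ.vertexMatrix ℝ *ᵥ x = r • x
  r_pos : 0 < r
  r_eq : Γ.vertexSpectralRadius = r
  unique : ∀ (y : V → ℝ) (μ : ℝ), (∀ v, 0 ≤ y v) → ∑ v, y v = 1 →
    0 < μ → Γ.vertexMatrix ℝ *ᵥ y = μ • y → μ = r ∧ y = x

theorem exists_isPerronVector [Nonempty V] (hsink : Γ.NoSinks) (hconn : Γ.StronglyConnected) :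
    ∃ x r, Γ.IsPerronVector x r := by
  obtain ⟨hM, hirr⟩ := isPerron_hypotheses hconn
  obtain ⟨x, r, hx, hsum, hxr, hmax⟩ := Matrix.exists_perron_eigenvector hM hirr
  -- The constant vector `1` satisfies `1 ≤ D 1` because each vertex emits an edge.
  have hr : 1 ≤ r := hmax (fun _ => 1) 1 (fun _ => zero_le_one)
    (fun h => one_ne_zero (congrFun h (Classical.arbitrary V))) zero_le_one fun v => by
      obtain ⟨e, rfl⟩ := hsink v
      rw [vertexMatrix_mulVec, mul_one]
      have := Finset.single_le_sum (f := fun w => if Γ.Adj (Γ.src e) w then (1 : ℝ) else 0)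
        (fun w _ => by split_ifs <;> norm_num) (Finset.mem_univ (Γ.tgt e))
      simpa [e.2] using this
  refine ⟨x, r, hx, hsum, hxr, by linarith, ?_, fun y μ hy hys hμ h => ?_⟩
  · rw [← Matrix.spectralRadius_map_ofReal_of_maximal hM hx (by linarith) hxr hmax,
      vertexSpectralRadius]
    congr 2
    ext i j
    simp only [vertexMatrix, Matrix.map_apply, Matrix.of_apply]
    split_ifs <;> simp
  · have hne : y ≠ 0 := fun h0 => by simp [h0] at hys
    obtain ⟨hμr, c, hc⟩ := Matrix.eq_smul_of_nonneg_eigenvector hM hirr hx hxr hy hne h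
      (hmax y μ hy hne hμ.le fun v => by rw [h]; rfl)
    refine ⟨hμr, ?_⟩
    rw [hc] at hys
    simp only [Pi.smul_apply, smul_eq_mul, ← Finset.mul_sum, hsum, mul_one] at hys
    rw [hc, hys, one_smul]

theorem IsScalingState.mulVec_apply_p {μ : ℝ} (hμ : μ ≠ 0) {φ : Γ.CStar →L[ℂ] ℂ}
    (h : Γ.IsScalingState μ φ) :
    Γ.vertexMatrix ℝ *ᵥ (fun v => (φ (Γ.p v)).re) = μ • fun v => (φ (Γ.p v)).re := by
  ext v
  rw [vertexMatrix_mulVec, Pi.smul_apply, smul_eq_mul]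
  have h1 := congrArg Complex.re (h.apply_p v)
  rw [← Complex.ofReal_inv, Complex.re_ofReal_mul, Complex.re_sum] at h1
  rw [h1, mul_inv_cancel_left₀ hμ]
  exact Finset.sum_congr rfl fun w _ => by split_ifs <;> simp

theorem IsPerronVector.isScalingState_apply_p {x : V → ℝ} {r : ℝ} (hx : Γ.IsPerronVector x r)
    {μ : ℝ} (hμ : 0 < μ) {φ : Γ.CStar →L[ℂ] ℂ} (h : Γ.IsScalingState μ φ) :
    μ = r ∧ ∀ v, φ (Γ.p v) = x v := by
  obtain ⟨h1, h2⟩ := hx.unique (fun v => (φ (Γ.p v)).re) μ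
    (fun v => (IsScalingState.p_nonneg h.isState v).1)
    (by
      have := congrArg (fun a => (φ a).re) Γ.isGraphFamily.sum_p
      simpa [h.isState.map_one] using this) hμ (h.mulVec_apply_p hμ.ne')
  exact ⟨h1, fun v => by rw [← h2, (IsScalingState.p_nonneg h.isState v).2]⟩

/-- Eigenvectors with values in a Banach space are proportional to the Perron–Frobenius vector. -/
theorem IsPerronVector.eq_smul_sum [Nonempty V] {x : V → ℝ} {r : ℝ} (hx : Γ.IsPerronVector x r)
    (hconn : Γ.StronglyConnected) {Q : Type*} [NormedAddCommGroup Q] [NormedSpace ℂ Q] {y : V → Q}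
    (hy : ∀ v, ∑ w, (if Γ.Adj v w then y w else 0) = (r : ℂ) • y v) (v : V) :
    y v = (x v : ℂ) • ∑ w, y w := by
  obtain ⟨hM, hirr⟩ := isPerron_hypotheses hconn
  have hreal : ∀ g : V → ℝ, (∀ v, ∑ w, (if Γ.Adj v w then g w else 0) = r * g v) →
      ∀ v, g v = x v * ∑ w, g w := fun g hg v => by
    obtain ⟨c, hc⟩ := Matrix.exists_eq_smul_of_eigenvector hM hirr hx.pos hx.eigen (y := g) (by
      ext v; rw [vertexMatrix_mulVec, hg]; rfl)
    rw [hc]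
    simp only [Pi.smul_apply, smul_eq_mul, ← Finset.mul_sum, hx.sum_eq]
    ring
  rw [← sub_eq_zero]
  -- Functionals separate points, and the real and imaginary parts of their values are real
  -- eigenvectors.
  refine SeparatingDual.eq_zero_of_forall_dual_eq_zero (R := ℂ) fun f => ?_
  have hf : ∀ v, ∑ w, (if Γ.Adj v w then f (y w) else 0) = r * f (y v) := fun v => by
    have := congrArg f (hy v)
    rw [map_sum, map_smul, smul_eq_mul] at this
    rw [← this]
    exact Finset.sum_congr rfl fun w _ => by split_ifs <;> simp
  have hre := hreal (fun w => (f (y w)).re) fun v => by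
    have := congrArg Complex.re (hf v)
    rw [Complex.re_ofReal_mul, Complex.re_sum] at this
    rw [← this]
    exact Finset.sum_congr rfl fun w _ => by split_ifs <;> simp
  have him := hreal (fun w => (f (y w)).im) fun v => by
    have := congrArg Complex.im (hf v)
    rw [Complex.im_ofReal_mul, Complex.im_sum] at this
    rw [← this]
    exact Finset.sum_congr rfl fun w _ => by split_ifs <;> simp
  rw [map_sub, map_smul, map_sum, sub_eq_zero, smul_eq_mul]
  refine Complex.ext ?_ ?_
  · rw [Complex.re_ofReal_mul, Complex.re_sum]; exact hre v
  · rw [Complex.im_ofReal_mul, Complex.im_sum]; exact him v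

/-- The quantum automorphism group preserves the Perron–Frobenius vector. -/
theorem IsPerronVector.smul_u [Nonempty V] {x : V → ℝ} {r : ℝ} (hx : Γ.IsPerronVector x r)
    (hconn : Γ.StronglyConnected) (k i : V) : (x k : ℂ) • Γ.u k i = (x i : ℂ) • Γ.u k i := by
  have hQ := Γ.isQAutFamily
  -- The row vector `x A`, an eigenvector of `D` because `D` also commutes with the transpose of
  -- `A`; its entries sum to `1`.
  let y : V → Γ.QAut := fun i => ∑ k, (x k : ℂ) • Γ.u k i
  have hxe : ∀ v, ∑ w, (if Γ.Adj v w then (x w : ℂ) else 0) = (r : ℂ) * x v := fun v => by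
    have := congrFun hx.eigen v
    rw [vertexMatrix_mulVec, Pi.smul_apply, smul_eq_mul] at this
    rw [← Complex.ofReal_mul, ← this, Complex.ofReal_sum]
    exact Finset.sum_congr rfl fun w _ => by split_ifs <;> simp
  have hy : ∀ v, ∑ w, (if Γ.Adj v w then y w else 0) = (r : ℂ) • y v := fun v => by
    have h1 : ∀ w, (if Γ.Adj v w then y w else 0) =
        ∑ k, (x k : ℂ) • (if Γ.Adj v w then Γ.u k w else 0) := fun w => by
      split_ifs <;> simp [y]
    simp only [h1]
    rw [Finset.sum_comm]
    simp only [← Finset.smul_sum, ← hQ.sum_comm]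
    have h2 : ∀ k, (x k : ℂ) • ∑ j, (if Γ.Adj j k then Γ.u j v else 0) =
        ∑ j, (if Γ.Adj j k then (x k : ℂ) else 0) • Γ.u j v := fun k => by
      rw [Finset.smul_sum]
      exact Finset.sum_congr rfl fun j _ => by split_ifs <;> simp
    simp only [h2]
    rw [Finset.sum_comm]
    simp only [← Finset.sum_smul, hxe, y, Finset.smul_sum, smul_smul]
  have hsum : ∑ w, y w = 1 := by
    simp only [y]
    rw [Finset.sum_comm]
    simp only [← Finset.smul_sum, hQ.row_sum]
    rw [← Finset.sum_smul]
    have : ∑ k, (x k : ℂ) = 1 := by exact_mod_cast congrArg ((↑) : ℝ → ℂ) hx.sum_eq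
    rw [this, one_smul]
  -- Multiplying `∑_j x_j u_{ji} = x_i 1` by `u_{ki}` isolates the term `j = k`, by orthogonality in
  -- the column `i`.
  have h3 := congrArg (fun q => Γ.u k i * q) (hx.eq_smul_sum hconn hy i)
  simp only [hsum, mul_smul_comm, mul_one] at h3
  rw [← h3]
  simp only [y, Finset.mul_sum, mul_smul_comm, hQ.col_mul]
  simp

variable (Γ) in
/-- The span of the elementary tensors `a ⊗ q` with `a` of degree `k`. -/
noncomputable def tensorSpectralSubspace (k : ℤ) : Submodule ℂ (MinTensor Γ.CStar Γ.QAut) :=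
  Submodule.span ℂ {y | ∃ a ∈ Γ.spectralSubspace k, ∃ q, y = minTmul a q}

theorem minTmul_mem_tensorSpectralSubspace {k : ℤ} {a : Γ.CStar} (ha : a ∈ Γ.spectralSubspace k)
    (q : Γ.QAut) : minTmul a q ∈ Γ.tensorSpectralSubspace k :=
  Submodule.subset_span ⟨a, ha, q, rfl⟩

theorem mul_mem_tensorSpectralSubspace {k l : ℤ} {x y : MinTensor Γ.CStar Γ.QAut}
    (hx : x ∈ Γ.tensorSpectralSubspace k) (hy : y ∈ Γ.tensorSpectralSubspace l) :
    x * y ∈ Γ.tensorSpectralSubspace (k + l) := by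
  have h := Submodule.mul_mem_mul hx hy
  rw [tensorSpectralSubspace, tensorSpectralSubspace, Submodule.span_mul_span] at h
  refine Submodule.span_mono ?_ h
  rintro _ ⟨_, ⟨a, ha, q, rfl⟩, _, ⟨b, hb, q', rfl⟩, rfl⟩
  exact ⟨a * b, mul_mem_spectralSubspace ha hb, q * q', minTmul_mul a b q q'⟩

/-- The action sends each generator to a combination of generators of the same degree, so the
grading is respected. -/
theorem action_spanning_mem (l : List Γ.Edge) (v : V) (l' : List Γ.Edge) :
    Γ.action (Γ.pathS l * Γ.p v * star (Γ.pathS l')) ∈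
      Γ.tensorSpectralSubspace ((l.length : ℤ) - l'.length) := by
  have hone : (1 : MinTensor Γ.CStar Γ.QAut) ∈ Γ.tensorSpectralSubspace 0 := by
    rw [← minTmul_one]
    exact minTmul_mem_tensorSpectralSubspace (fun t => by simp) 1
  have h1 : ∀ l : List Γ.Edge, Γ.action (Γ.pathS l) ∈ Γ.tensorSpectralSubspace l.length := by
    intro l
    induction l with
    | nil => rw [pathS_nil, map_one]; exact hone
    | cons e l ih =>
      rw [pathS_cons, map_mul, List.length_cons, Nat.cast_succ, add_comm]
      refine mul_mem_tensorSpectralSubspace ?_ ih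
      rw [action_S]
      exact Submodule.sum_mem _ fun f _ =>
        minTmul_mem_tensorSpectralSubspace (S_mem_spectralSubspace f) _
  have h2 : ∀ l : List Γ.Edge,
      Γ.action (star (Γ.pathS l)) ∈ Γ.tensorSpectralSubspace (-l.length) := by
    intro l
    induction l with
    | nil => rw [pathS_nil, star_one, map_one]; exact hone
    | cons e l ih =>
      rw [pathS_cons, star_mul, map_mul, List.length_cons, Nat.cast_succ, neg_add]
      refine mul_mem_tensorSpectralSubspace ih ?_
      rw [map_star, action_S, star_sum]
      refine Submodule.sum_mem _ fun f _ => ?_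
      rw [star_minTmul]
      exact minTmul_mem_tensorSpectralSubspace
        (star_mem_spectralSubspace (S_mem_spectralSubspace f)) _
  have h3 : Γ.action (Γ.p v) ∈ Γ.tensorSpectralSubspace 0 := by
    rw [action_p]
    exact Submodule.sum_mem _ fun f _ =>
      minTmul_mem_tensorSpectralSubspace (p_mem_spectralSubspace f) _
  rw [map_mul, map_mul]
  have := mul_mem_tensorSpectralSubspace (mul_mem_tensorSpectralSubspace (h1 l) h3) (h2 l')
  rwa [add_zero, ← sub_eq_add_neg] at this

end Digraph

/-! ### Invariance of the scaling state under the quantum automorphism group. -/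

namespace Digraph

open scoped TensorProduct

variable {V : Type u} {Γ : Digraph V} [Fintype V] [DecidableEq V] [DecidableRel Γ.Adj]

/-- By `AD = DA` the middle sum equals `∑_{k → j} u_{wk}`, which `u_{wi}` absorbs since `i → j`; row
orthogonality then compares `i` with `i'`. -/
theorem IsQAutFamily.mul_sum_adj_mul {B : Type*} [CStarAlgebra B] {u : V → V → B}
    (h : Γ.IsQAutFamily u) (w : V) {i j : V} (hij : Γ.Adj i j) (i' : V) :
    ∑ k, (if Γ.Adj w k then u w i * u k j * u w i' else 0) = if i = i' then u w i else 0 := by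
  have h1 : ∑ k, (if Γ.Adj w k then u k j else 0) = ∑ k, if Γ.Adj k j then u w k else 0 := by
    have := congrFun (congrFun h.comm w) j
    simpa [Matrix.mul_apply, vertexMatrix] using this.symm
  have h2 : ∑ k, (if Γ.Adj w k then u w i * u k j * u w i' else 0) =
      u w i * (∑ k, if Γ.Adj w k then u k j else 0) * u w i' := by
    rw [Finset.mul_sum, Finset.sum_mul]
    exact Finset.sum_congr rfl fun k _ => by split_ifs <;> simp
  have h3 : ∀ k, (u w i * if Γ.Adj k j then u w k else 0) = if i = k then u w i else 0 :=
    fun k => by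
      by_cases hk : i = k
      · subst hk; rw [if_pos hij, h.row_mul]
      · rw [if_neg hk]; split_ifs
        · rw [h.row_mul, if_neg hk]
        · simp
  rw [h2, h1, Finset.mul_sum]
  simp only [h3, Finset.sum_ite_eq, Finset.mem_univ, if_true, h.row_mul]

variable {r : ℝ} {τ : Γ.CStar →L[ℂ] ℂ} {E : MinTensor Γ.CStar Γ.QAut →L[ℂ] Γ.QAut}

/-- After expansion of both edge sums on an elementary tensor, `τ(p_w S_g b S_k^*)` survives only
for `g = k` with source `w`, where scaling turns it into `r⁻¹ τ(p_{t(g)} b)`. Density gives the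
rest. -/
theorem IsScalingState.slice_sandwich (h : Γ.IsScalingState r τ) (hr : r ≠ 0)
    (hE : ∀ a q, E (minTmul a q) = τ a • q) (w : V) (e f : Γ.Edge)
    (y : MinTensor Γ.CStar Γ.QAut) :
    E (minTmul (Γ.p w) 1 * (Γ.action (Γ.S e) * y * star (Γ.action (Γ.S f)))) =
      (r : ℂ)⁻¹ • ∑ g with Γ.src g = w, Γ.u w (Γ.src e) * Γ.u (Γ.tgt g) (Γ.tgt e) *
        E (minTmul (Γ.p (Γ.tgt g)) 1 * y) *
          (Γ.u (Γ.tgt g) (Γ.tgt f) * Γ.u w (Γ.src f)) := by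
  have hG := Γ.isGraphFamily
  have hQ := Γ.isQAutFamily
  have hterm : ∀ q c q', Continuous fun y : MinTensor Γ.CStar Γ.QAut => q * E (c * y) * q' :=
    fun q c q' => (continuous_const.mul (E.continuous.comp
      (continuous_const.mul continuous_id))).mul continuous_const
  have hsum : Continuous fun y : MinTensor Γ.CStar Γ.QAut =>
      ∑ g with Γ.src g = w, Γ.u w (Γ.src e) * Γ.u (Γ.tgt g) (Γ.tgt e) *
        E (minTmul (Γ.p (Γ.tgt g)) 1 * y) *
          (Γ.u (Γ.tgt g) (Γ.tgt f) * Γ.u w (Γ.src f)) :=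
    continuous_finsetSum _ fun g _ => hterm _ _ _
  refine (spatialFamily Γ.CStar Γ.QAut).denseRange_of.induction_on
    (p := fun y => E (minTmul (Γ.p w) 1 * (Γ.action (Γ.S e) * y * star (Γ.action (Γ.S f)))) =
      (r : ℂ)⁻¹ • ∑ g with Γ.src g = w, Γ.u w (Γ.src e) * Γ.u (Γ.tgt g) (Γ.tgt e) *
        E (minTmul (Γ.p (Γ.tgt g)) 1 * y) *
          (Γ.u (Γ.tgt g) (Γ.tgt f) * Γ.u w (Γ.src f))) y
    (isClosed_eq
      (E.continuous.comp (continuous_const.mul ((continuous_const.mul continuous_id).mul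
        continuous_const)))
      (hsum.const_smul (r : ℂ)⁻¹))
    fun x => ?_
  induction x with
  | zero => simp
  | add x y hx hy =>
    simp only [map_add, mul_add, add_mul, Finset.sum_add_distrib, smul_add, hx, hy]
  | tmul b q =>
    change E (minTmul (Γ.p w) 1 * (Γ.action (Γ.S e) * minTmul b q * star (Γ.action (Γ.S f)))) =
      (r : ℂ)⁻¹ • ∑ g with Γ.src g = w, Γ.u w (Γ.src e) * Γ.u (Γ.tgt g) (Γ.tgt e) *
        E (minTmul (Γ.p (Γ.tgt g)) 1 * minTmul b q) *
          (Γ.u (Γ.tgt g) (Γ.tgt f) * Γ.u w (Γ.src f))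
    simp only [action_S, star_sum, star_minTmul, Finset.mul_sum, Finset.sum_mul, minTmul_mul,
      map_sum, hE, one_mul, star_mul, hQ.star_u]
    have key : ∀ g k : Γ.Edge, τ (Γ.p w * (Γ.S g * b * star (Γ.S k))) =
        if g = k then if Γ.src g = w then (r : ℂ)⁻¹ * τ (Γ.p (Γ.tgt g) * b) else 0 else 0 :=
      fun g k => by
        rw [mul_assoc (Γ.S g), ← mul_assoc, hG.p_mul_S_eq]
        by_cases hw : Γ.src g = w
        · rw [if_pos hw.symm, if_pos hw, h.S_mul, mul_assoc, hG.star_S_mul_S_eq, h.p_mul hr]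
          by_cases hgk : g = k
          · rw [if_pos hgk.symm, if_pos hgk, hgk]
          · rw [if_neg (Ne.symm hgk), if_neg hgk, mul_zero, map_zero, mul_zero]
        · rw [if_neg (Ne.symm hw), if_neg hw, zero_mul, map_zero, ite_self]
    simp only [key, ite_smul, zero_smul, Finset.sum_ite_eq', Finset.mem_univ, if_true]
    rw [← Finset.sum_filter, Finset.smul_sum]
    refine Finset.sum_congr rfl fun g hg => ?_
    obtain rfl := (Finset.mem_filter.mp hg).2
    simp only [mul_smul_comm, smul_mul_assoc, smul_smul]

/-- The unlocalized identity `E(α(a)) = τ(a) 1` would not pass to `S_e a S_f^*`, because the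
coefficients produced on both sides depend on the vertices. Cutting by `p_w` keeps track of them and
makes the induction close. -/
theorem IsScalingState.slice_p_mul_action [Nonempty V] (h : Γ.IsScalingState r τ) (hr : r ≠ 0)
    {x : V → ℝ} (hx : Γ.IsPerronVector x r) (hconn : Γ.StronglyConnected)
    (hτ : ∀ v, τ (Γ.p v) = x v) (hE : ∀ a q, E (minTmul a q) = τ a • q) (a : Γ.CStar) (w : V) :
    E (minTmul (Γ.p w) 1 * Γ.action a) = ∑ i, τ (Γ.p i * a) • Γ.u w i := by
  have hG := Γ.isGraphFamily
  have hQ := Γ.isQAutFamily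
  have hact : Continuous Γ.action :=
    (AddMonoidHomClass.lipschitz_of_bound Γ.action 1 fun x => by
      rw [one_mul]; exact NonUnitalStarAlgHom.norm_apply_le _ x).continuous
  let C : Submodule ℂ Γ.CStar :=
    { carrier := {a | ∀ w, E (minTmul (Γ.p w) 1 * Γ.action a) = ∑ i, τ (Γ.p i * a) • Γ.u w i}
      add_mem' := fun ha hb w => by
        simp only [map_add, mul_add, add_smul, Finset.sum_add_distrib, ha w, hb w]
      zero_mem' := fun w => by simp
      smul_mem' := fun c a ha w => by
        simp only [map_smul, mul_smul_comm, ha w, Finset.smul_sum, smul_smul, smul_eq_mul] }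
  have hC : IsClosed (C : Set Γ.CStar) := by
    have : (C : Set Γ.CStar) = {a | ∀ w, E (minTmul (Γ.p w) 1 * Γ.action a) =
        ∑ i, τ (Γ.p i * a) • Γ.u w i} := rfl
    rw [this, Set.ofPred_forall]
    exact isClosed_iInter fun w => isClosed_eq (by fun_prop) (by fun_prop)
  refine Γ.mem_of_sandwich C hC (fun v w => ?_) (fun e f a ha w => ?_) (fun l v l' hl w => ?_) a w
  · simp only [action_p, Finset.mul_sum, minTmul_mul, map_sum, hE, one_mul, hG.p_mul_p,
      apply_ite τ, map_zero, ite_smul, zero_smul, Finset.sum_ite_eq, Finset.sum_ite_eq',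
      Finset.mem_univ, if_true, hτ]
    exact hx.smul_u hconn w v
  · rw [map_mul Γ.action, map_mul Γ.action, map_star Γ.action, h.slice_sandwich hr hE]
    -- Row orthogonality at `k` selects `i = t(e)` from the inductive formula and forces `t(e) =
    -- t(f)`.
    have h1 : ∀ k, Γ.u w (Γ.src e) * Γ.u k (Γ.tgt e) * E (minTmul (Γ.p k) 1 * Γ.action a) *
        (Γ.u k (Γ.tgt f) * Γ.u w (Γ.src f)) = if Γ.tgt e = Γ.tgt f then
          τ (Γ.p (Γ.tgt e) * a) • (Γ.u w (Γ.src e) * Γ.u k (Γ.tgt e) * Γ.u w (Γ.src f))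
          else 0 := fun k => by
      rw [ha k]
      simp only [Finset.mul_sum, mul_smul_comm, mul_assoc (Γ.u w (Γ.src e)), hQ.row_mul, smul_ite,
        smul_zero, Finset.sum_ite_eq, Finset.mem_univ, if_true]
      rw [smul_mul_assoc, mul_assoc, ← mul_assoc (Γ.u k (Γ.tgt e)), hQ.row_mul]
      split_ifs <;> simp
    have h2 : ∑ g with Γ.src g = w, Γ.u w (Γ.src e) * Γ.u (Γ.tgt g) (Γ.tgt e) *
        E (minTmul (Γ.p (Γ.tgt g)) 1 * Γ.action a) *
          (Γ.u (Γ.tgt g) (Γ.tgt f) * Γ.u w (Γ.src f)) =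
        if Γ.tgt e = Γ.tgt f then τ (Γ.p (Γ.tgt e) * a) • ∑ k, (if Γ.Adj w k then
          Γ.u w (Γ.src e) * Γ.u k (Γ.tgt e) * Γ.u w (Γ.src f) else 0) else 0 := by
      simp only [h1]
      rw [Finset.sum_filter, sum_edge fun i k => if i = w then (if Γ.tgt e = Γ.tgt f then
          τ (Γ.p (Γ.tgt e) * a) • (Γ.u w (Γ.src e) * Γ.u k (Γ.tgt e) * Γ.u w (Γ.src f))
          else 0) else 0,
        Finset.sum_eq_single w (fun i _ hi => by simp [hi]) (by simp)]
      simp only [↓reduceIte]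
      split_ifs
      · rw [Finset.smul_sum]
        exact Finset.sum_congr rfl fun k _ => by split_ifs <;> simp
      · simp
    rw [h2, hQ.mul_sum_adj_mul w e.2]
    have h3 : ∀ i, τ (Γ.p i * (Γ.S e * a * star (Γ.S f))) • Γ.u w i =
        if i = Γ.src e then (if e = f then ((r : ℂ)⁻¹ * τ (Γ.p (Γ.tgt e) * a)) • Γ.u w i else 0)
          else 0 := fun i => by
      rw [mul_assoc (Γ.S e), ← mul_assoc, hG.p_mul_S_eq]
      by_cases hi : i = Γ.src e
      · rw [if_pos hi, if_pos hi, h.S_mul, mul_assoc, hG.star_S_mul_S_eq, h.p_mul hr]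
        by_cases hef : e = f
        · rw [if_pos hef.symm, if_pos hef, hef]
        · rw [if_neg (Ne.symm hef), if_neg hef, mul_zero, map_zero, mul_zero, zero_smul]
      · rw [if_neg hi, if_neg hi, zero_mul, map_zero, zero_smul]
    simp only [h3, Finset.sum_ite_eq', Finset.mem_univ, if_true]
    by_cases hef : e = f
    · subst hef; simp [smul_smul]
    · rw [if_neg hef]
      by_cases ht : Γ.tgt e = Γ.tgt f
      -- The absence of multiple edges enters here: distinct edges with equal targets have distinct
      -- sources.
      · have hs : Γ.src e ≠ Γ.src f := fun hs => hef (Subtype.ext (Prod.ext hs ht))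
        rw [if_pos ht, if_neg hs, smul_zero, smul_zero]
      · rw [if_neg ht, smul_zero]
  -- In nonzero degree both sides vanish: the action and multiplication by `p_w` or `p_i` preserve
  -- the degree, and `τ` kills it.
  · have hk : (0 : ℤ) + (l.length - l'.length) ≠ 0 := by omega
    have h1 := mul_mem_tensorSpectralSubspace
      (minTmul_mem_tensorSpectralSubspace (p_mem_spectralSubspace w) 1)
      (action_spanning_mem l v l')
    have h2 : Γ.tensorSpectralSubspace (0 + ((l.length : ℤ) - l'.length)) ≤
        LinearMap.ker (E : MinTensor Γ.CStar Γ.QAut →ₗ[ℂ] Γ.QAut) := Submodule.span_le.mpr (by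
      rintro _ ⟨b, hb, q, rfl⟩
      exact (hE b q).trans (by rw [h.degree _ hk b hb, zero_smul]))
    rw [show E _ = 0 from h2 h1]
    refine (Finset.sum_eq_zero fun i _ => ?_).symm
    rw [h.degree _ hk _ (mul_mem_spectralSubspace (p_mem_spectralSubspace i)
      (spanning_mem_spectralSubspace l v l')), zero_smul]

/-- Summing the localized identities over `w` restores the unit on the left and, since columns of
`A` sum to `1`, gives `∑_i τ(p_i a) 1 = τ(a) 1` on the right. -/
theorem IsScalingState.preservesState [Nonempty V] (h : Γ.IsScalingState r τ)
    {x : V → ℝ} (hx : Γ.IsPerronVector x r) (hconn : Γ.StronglyConnected)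
    (hτ : ∀ v, τ (Γ.p v) = x v) : PreservesState Γ.action τ := by
  have hG := Γ.isGraphFamily
  obtain ⟨E, hE⟩ := exists_sliceMap (B := Γ.QAut) h.isState
  refine ⟨E, hE, fun a => ?_⟩
  rw [← one_mul (Γ.action a), ← minTmul_one, ← hG.sum_p, sum_minTmul, Finset.sum_mul, map_sum,
    Finset.sum_congr rfl fun w _ => h.slice_p_mul_action hx.r_pos.ne' hx hconn hτ hE a w,
    Finset.sum_comm]
  simp only [← Finset.smul_sum, Γ.isQAutFamily.col_sum]
  rw [← Finset.sum_smul, ← map_sum, ← Finset.sum_mul, hG.sum_p, one_mul]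

end Digraph

theorem mainTheorem1 {V : Type*} [Fintype V] [DecidableEq V] [Nonempty V] (Γ : Digraph V)
    [DecidableRel Γ.Adj] (hsink : Γ.NoSinks) (hconn : Γ.StronglyConnected) :
    ∃ τ : Γ.CStar →L[ℂ] ℂ,
      (∀ (β : ℝ) (φ : Γ.CStar →L[ℂ] ℂ),
        IsKMS Γ.dynamics β φ ↔ β = Real.log Γ.vertexSpectralRadius ∧ φ = τ) ∧
      PreservesState Γ.action τ := by
  obtain ⟨x, r, hx⟩ := Digraph.exists_isPerronVector hsink hconn
  obtain ⟨τ, hτ, hτp⟩ := Digraph.exists_isScalingState hsink (fun v => (hx.pos v).le) hx.sum_eq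
    hx.r_pos hx.eigen
  refine ⟨τ, fun β φ => ?_, hτ.preservesState hx hconn hτp⟩
  rw [Digraph.isKMS_iff_isScalingState, hx.r_eq]
  constructor
  · intro h
    obtain ⟨hβ, hp⟩ := hx.isScalingState_apply_p (Real.exp_pos β) h
    refine ⟨by rw [← hβ, Real.log_exp], ?_⟩
    rw [hβ] at h
    exact h.eq_of_apply_p_eq hτ hx.r_pos.ne' fun v => by rw [hp, hτp]
  · rintro ⟨rfl, rfl⟩
    rwa [Real.exp_log hx.r_pos]
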